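/- Setting. Let $\varphi\in C^\infty(\mathbb R^2\setminus\{0\};(0,\infty))$ be positively one-homogeneous, with $D^2\varphi(\nu)\tau\cdot\tau\ge c_0>0$ for all unit vectors $\nu\perp\tau$; put $g(\nu):=D^2\varphi(\nu)\tau\cdot\tau$ for $\nu\in\mathbb S^1$ and a unit vector $\tau\perp\nu$. For a bounded open set $F\subset\mathbb R^2$ with $C^\infty$ boundary let $\nu_F$ be the outer unit normal, $\tau_F$ its counterclockwise rotation by $\pi/2$, $\partial_\sigma$ the tangential derivative along $\partial F$, $k_F$ the curvature ($\partial_\sigma\nu_F=k_F\tau_F$), $P(F)=\mathcal H^1(\partial F)$, and $d_F$ the signed distance from $\partial F$, negative inside $F$. Let $G\subset\mathbb R^2$ be a bounded open set with $C^\infty$ boundary, and let $\bar\eta>0$ be such that the orthogonal projection $\pi_G$ onto $\partial G$ is well defined on the open $\bar\eta$-neighbourhood of $\partial G$, and $d_G$ and $\pi_G$ are $C^\infty$ there. Let $T>0$ and $f\in C^\infty(\partial G\times[0,\infty))$, $f_t:=f(\cdot,t)$, $\dot f_t:=\partial_t f(\cdot,t)$. A smooth flow on $(0,T)$ with initial datum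 $F_0$ is a family $(F_t)_{t\in[0,T)}$ of bounded open sets with $C^\infty$ boundary such that $$\partial F_t=\{x+h_t(x)\nu_G(x): x\in\partial G\},\qquad \|h_t\|_{L^\infty(\partial G)}\le\bar\eta/2,$$ where $(x,t)\mapsto h_t(x)$ is $C^\infty$ on $\partial G\times(0,T)$ and continuous on $\partial G\times[0,T)$. Its outer normal velocity $V_t$ at $x+h_t(x)\nu_G(x)$ is $\partial_t h_t(x)\,\nu_G(x)\cdot\nu_{F_t}$. We consider smooth flows that satisfy, for every $t\in(0,T)$, $$V_t=\partial_{\sigma\sigma}R_t\ \text{ on }\partial F_t,\qquad R_t:=g(\nu_{F_t})k_{F_t}+f_t\circ\pi_G .$$ Lemma 3.3. (i) For every such flow and every $t\in(0,T)$, the derivative below exists and $$\frac{d}{dt}\int_{F_t\Delta G}\operatorname{dist}(x,\partial G)\,dx=\int_{\partial F_t}d_G\,\partial_{\sigma\sigma}R_t\,d\mathcal H^1\le P(F_t)^{1/2}\Bigl(\int_{\partial F_t}(\partial_\sigma R_t)^2\,d\mathcal H^1\Bigr)^{1/2}.$$ (ii) Let $\alpha\in(0,1)$ and $M_h,M_f\ge0$.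 There is a constant $C_1>0$, depending only on $\varphi,c_0,G,\bar\eta,\alpha,M_h,M_f$ (and not on $T$, $f$ or the flow), such that for every such flow with $\sup_{t\in(0,T)}\|h_t\|_{C^{2,\alpha}(\partial G)}\le M_h$ and $\sup_{t\in(0,T)}\|f_t\|_{C^{1,\alpha}(\partial G)}\le M_f$, and for every $t\in(0,T)$, the derivative below exists and $$\frac{d}{dt}\int_{\partial F_t}(\partial_\sigma R_t)^2\,d\mathcal H^1+c_0\int_{\partial F_t}(\partial_{\sigma\sigma\sigma}R_t)^2\,d\mathcal H^1\le C_1\|\dot f_t\|_{H^{-1/2}(\partial G)}^2+C_1\Bigl(1+\int_{\partial F_t}(\partial_\sigma R_t)^2\,d\mathcal H^1\Bigr)^{7/3}.$$ Here $H^{-1/2}(\partial G)$ is the dual of $H^{1/2}(\partial G)$ (with the Gagliardo norm) under the pairing $w\mapsto\int_{\partial G}\dot f_t\,w\,d\mathcal H^1$. -/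

import Mathlib

open Set Filter Topology MeasureTheory Metric
open scoped ENNReal NNReal ContDiff symmDiff

noncomputable section

/-- The Euclidean plane. -/
abbrev Plane : Type := EuclideanSpace ℝ (Fin 2)

/-- Counterclockwise rotation by `π / 2`. -/
def rot (v : Plane) : Plane := !₂[-(v 1), v 0]

/-- A bounded open set with `C^∞` boundary: near each boundary point the set is the sublevel set
`{ψ < 0}` of a smooth function with nonvanishing differential. -/
structure IsSmoothSet (F : Set Plane) : Prop where
  isOpen : IsOpen F
  bounded : Bornology.IsBounded F
  smooth : ∀ p ∈ frontier F, ∃ ψ : Plane → ℝ, ContDiff ℝ ∞ ψ ∧ fderiv ℝ ψ p ≠ 0 ∧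
    ∀ᶠ x in 𝓝 p, (x ∈ F ↔ ψ x < 0)

/-- The signed distance function `d_F` from `∂F`, negative inside `F`. -/
def signedDistFrom (F : Set Plane) (x : Plane) : ℝ := infDist x F - infDist x Fᶜ

/-- The unit outer normal `ν_F = ∇ d_F` (used at points of `∂F`). -/
def outerNormal (F : Set Plane) (x : Plane) : Plane := gradient (signedDistFrom F) x

/-- The unit tangent `τ_F`, obtained by rotating `ν_F` counterclockwise by `π / 2`. -/
def unitTangent (F : Set Plane) (x : Plane) : Plane := rot (outerNormal F x)

/-- The tangential derivative `∂_σ u` along `∂F`. It depends only on the values of `u` on `∂F`: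
the derivative of `u` within the curve `∂F` is unique in the tangent direction. -/
def tderiv {V : Type*} [NormedAddCommGroup V] [NormedSpace ℝ V]
    (F : Set Plane) (u : Plane → V) (x : Plane) : V :=
  fderivWithin ℝ u (frontier F) x (unitTangent F x)

/-- The curvature `k_F`, determined by `∂_σ ν_F = k_F τ_F`; it is positive on circles
bounding discs. -/
def curvature (F : Set Plane) (x : Plane) : ℝ :=
  inner ℝ (tderiv F (outerNormal F) x) (unitTangent F x)

/-- The integral of `u` over `∂F` with respect to the one-dimensional Hausdorff measure. -/
def bdryIntegral (F : Set Plane) (u : Plane → ℝ) : ℝ := ∫ x in frontier F, u x ∂μH[1]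

/-- The perimeter of a smooth set: the length of its boundary. -/
def perimeter (F : Set Plane) : ℝ := (μH[1] (frontier F)).toReal

/-- A point of `Γ` nearest to `x`. For `Γ = ∂G` and `x` in a tubular neighbourhood of `∂G`, where
the nearest point is unique, this is the orthogonal projection `π_G`. -/
def nearestPt (Γ : Set Plane) (x : Plane) : Plane :=
  Classical.epsilon fun y => y ∈ Γ ∧ dist x y = infDist x Γ

/-- `η` is a positive number such that the orthogonal projection onto `∂G` is well defined on the
`η`-tubular neighbourhood of `∂G`, and both it and the signed distance from `∂G` are smooth
there. -/
structure IsTubularRadius (G : Set Plane) (η : ℝ) : Prop where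
  pos : 0 < η
  unique_nearest : ∀ x ∈ thickening η (frontier G),
    ∃! y, y ∈ frontier G ∧ dist x y = infDist x (frontier G)
  smooth_dist : ContDiffOn ℝ ∞ (signedDistFrom G) (thickening η (frontier G))
  smooth_proj : ContDiffOn ℝ ∞ (nearestPt (frontier G)) (thickening η (frontier G))

/-- A positively one-homogeneous surface energy density, smooth and positive away from `0`. -/
structure IsAnisotropy (φ : Plane → ℝ) : Prop where
  smooth : ContDiffOn ℝ ∞ φ {0}ᶜ
  pos : ∀ x, x ≠ 0 → 0 < φ x
  homogeneous : ∀ r : ℝ, 0 < r → ∀ x, φ (r • x) = r * φ x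

/-- The second derivative `D²φ(v) w · w`. -/
def hess (φ : Plane → ℝ) (v w : Plane) : ℝ := fderiv ℝ (fderiv ℝ φ) v w w

/-- Ellipticity with constant `c₀ > 0`. -/
def IsElliptic (φ : Plane → ℝ) (c₀ : ℝ) : Prop :=
  0 < c₀ ∧ ∀ v w : Plane, ‖v‖ = 1 → ‖w‖ = 1 → inner ℝ v w = 0 → c₀ ≤ hess φ v w

/-- The anisotropic curvature `g(ν_F) k_F`, where `g(ν) = D²φ(ν) τ · τ`. -/
def anisoCurvature (φ : Plane → ℝ) (F : Set Plane) (x : Plane) : ℝ :=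
  hess φ (outerNormal F x) (unitTangent F x) * curvature F x

/-- `R = g(ν_F) k_F + f ∘ π_G` on `∂F`, for a function `f` on `∂G`. -/
def potential (φ : Plane → ℝ) (G : Set Plane) (f : Plane → ℝ) (F : Set Plane) (x : Plane) : ℝ :=
  anisoCurvature φ F x + f (nearestPt (frontier G) x)

/-- The map `x ↦ x + h(x) ν_G(x)` on `∂G`. -/
def graphMap (G : Set Plane) (h : Plane → ℝ) (x : Plane) : Plane := x + h x • outerNormal G x

/-- A smooth flow of smooth sets `F t`, `0 < t < T`, with smooth initial set `F 0`: the boundary of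
`F t` is the normal graph over `∂G` of a function `h t` with `|h t| ≤ η / 2`; the function
`(x, t) ↦ h t x` is smooth on `∂G × (0, T)` and continuous up to `t = 0`.
Smoothness within `∂G × (0, T)` is the same as smoothness on this embedded manifold. -/
structure IsSmoothFlow (G : Set Plane) (η T : ℝ) (F : ℝ → Set Plane) (h : ℝ → Plane → ℝ) :
    Prop where
  smooth_set : ∀ t ∈ Ico 0 T, IsSmoothSet (F t)
  boundary : ∀ t ∈ Ico 0 T, frontier (F t) = graphMap G (h t) '' frontier G
  height_le : ∀ t ∈ Ico 0 T, ∀ x ∈ frontier G, |h t x| ≤ η / 2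
  smooth : ContDiffOn ℝ ∞ (fun p : Plane × ℝ => h p.2 p.1) (frontier G ×ˢ Ioo 0 T)
  continuous : ContinuousOn (fun p : Plane × ℝ => h p.2 p.1) (frontier G ×ˢ Ico 0 T)

/-- The outer normal velocity at a point `y` of the boundary of `F` at time `t`, when the boundary
moves as the normal graph of `h` over `∂G`: the normal component of the velocity at time `t` of the
moving boundary point that projects to the same point of `∂G` as `y` does. -/
def normalVelocity (G : Set Plane) (h : ℝ → Plane → ℝ) (F : Set Plane) (t : ℝ) (y : Plane) : ℝ :=
  inner ℝ (deriv (fun s => graphMap G (h s) (nearestPt (frontier G) y)) t) (outerNormal F y)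

/-- A smooth flow that solves `V_t = ∂_σσ (g(ν_t) k_t + f_t ∘ π_G)` on `∂F_t` for `0 < t < T`. -/
structure IsForcedFlow (φ : Plane → ℝ) (G : Set Plane) (η T : ℝ) (f : ℝ → Plane → ℝ)
    (F : ℝ → Set Plane) (h : ℝ → Plane → ℝ) : Prop where
  flow : IsSmoothFlow G η T F h
  equation : ∀ t ∈ Ioo 0 T, ∀ y ∈ frontier (F t),
    normalVelocity G h (F t) t y = tderiv (F t) (tderiv (F t) (potential φ G (f t) (F t))) y

/-- The forcing term is a smooth function on `∂G × [0, ∞)`. -/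
def IsSmoothForcing (G : Set Plane) (f : ℝ → Plane → ℝ) : Prop :=
  ContDiffOn ℝ ∞ (fun p : Plane × ℝ => f p.2 p.1) (frontier G ×ˢ Ici 0)

/-- The `C^{k,α}` norm of a function of class `C^k` on `∂G`: the sum of the sup norms of
`∂_σ^j u`, `j ≤ k`, and of the `α`-Hölder seminorm of `∂_σ^k u`. -/
def holderNorm (G : Set Plane) (k : ℕ) (α : ℝ) (u : Plane → ℝ) : ℝ≥0∞ :=
  (∑ j ∈ Finset.range (k + 1), ⨆ x ∈ frontier G, ‖((tderiv G)^[j] u) x‖ₑ) +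
    ⨆ x ∈ frontier G, ⨆ y ∈ frontier G,
      ‖((tderiv G)^[k] u) x - ((tderiv G)^[k] u) y‖ₑ / edist x y ^ α

/-- The square of the Gagliardo norm of `H^{1/2}(∂G)`. -/
def hHalfNormSq (G : Set Plane) (w : Plane → ℝ) : ℝ≥0∞ :=
  (∫⁻ x in frontier G, ‖w x‖ₑ ^ 2 ∂μH[1]) +
    ∫⁻ x in frontier G, ∫⁻ y in frontier G, ‖w x - w y‖ₑ ^ 2 / edist x y ^ 2 ∂μH[1] ∂μH[1]

/-- The norm of a bounded measurable function `u` on `∂G` as an element of `H^{-1/2}(∂G)`, the dual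
of `H^{1/2}(∂G)`, acting by `w ↦ ∫_{∂G} u w`. -/
def hNegHalfNorm (G : Set Plane) (u : Plane → ℝ) : ℝ≥0∞ :=
  ⨆ (w : Plane → ℝ) (_ : AEStronglyMeasurable w (μH[1].restrict (frontier G)))
    (_ : hHalfNormSq G w ≤ 1), ‖bdryIntegral G fun x => u x * w x‖ₑ

end

open Set Filter Topology MeasureTheory Metric
open scoped ENNReal NNReal ContDiff symmDiff

noncomputable section

/-! ### Rotation by a right angle -/

/-! Everything is pulled back to fixed closed curves. The boundary of `G` consists of finitely many
closed orbits γ_i of its unit tangent field (`exists_boundaryParam`), and ∂F_t is parametrised by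
c_i(s,t) = γ_i(s) + h_t(γ_i(s)) ν_G(γ_i(s)). With ρ = |∂_s c|, boundary integrals become sums of
interval integrals with weight ρ, by the one-dimensional area formula
(`hausdorffMeasure_image_curve`), and ∂_σ becomes ρ⁻¹ ∂_s. Since the outer normal is defined through
the signed distance of F_t, one must know on which side of the graph F_t lies: `IsSmoothFlow.set_eq`
shows F_t = {d_G < h_t ∘ π_G}, because F_t is bounded and the plane is connected.

Write r, V, Z for the first three arc length derivatives of R, W for the tangential component of ∂_t
c, k for the curvature of ∂F_t and κ for that of ∂G.

Part (i). In Fermi coordinates the weighted area of F_t Δ G is Σ ∫ (h²/2 + κ h³/3) ds, whatever the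
sign of h. Its time derivative has density h (1 + κh) ∂_t h, and (1 + κh) ∂_t h = ρV. For the bound,
ρV = ∂_s r; integrating by parts leaves -Σ ∫ r ∂_s h, and |∂_s h| ≤ ρ because ρ² = (1 + κh)² + (∂_s
h)². Cauchy-Schwarz concludes.

Part (ii). Commuting ∂_s and ∂_t on c and on the normal gives the evolution of ρ and k, hence of R.
Up to the s-derivative of a periodic function (`IsCurveFlow.dt_energy_density`), ∂_t(ρr²) equals
-2ρgZ² + 2ρgk²V² - ρkr²V + 2VW∂_s f - 2ρV∂_t f. The first term is at most -2c₀ρZ². The C² bound on h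
controls ρ, ∂_s ρ and k. Let E, B, D be the integrals of r², V², Z² with respect to arc length.
Integration by parts gives B² ≤ ED. The points of the graph move along ν_G, which forces |W| ≤ 2 M_h
|V|. On each closed curve r has a zero, so r² ≤ 2 ∫ |r||V|, and the cubic term is of order E
D^{1/2}. The forcing term is the pairing on ∂G of ∂_t f with ρV, whose H^{1/2} norm is bounded by
its H¹ norm, that is by (D + B)^{1/2} up to a constant. Young's inequality absorbs all powers of D
(`rate_add_le`); what remains grows like (1 + E)², which is below (1 + E)^{7/3}. -/

theorem rot_apply_zero (v : Plane) : rot v 0 = -(v 1) := rfl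

theorem rot_apply_one (v : Plane) : rot v 1 = v 0 := rfl

theorem inner_plane (v w : Plane) : inner ℝ v w = v 0 * w 0 + v 1 * w 1 := by
  simp [PiLp.inner_apply, Fin.sum_univ_two]; ring

theorem norm_sq_plane (v : Plane) : ‖v‖ ^ 2 = v 0 ^ 2 + v 1 ^ 2 := by
  rw [← real_inner_self_eq_norm_sq, inner_plane]; ring

theorem plane_ext {v w : Plane} (h0 : v 0 = w 0) (h1 : v 1 = w 1) : v = w := by
  ext i; fin_cases i <;> assumption

/-- The rotation `rot` as a continuous linear map. -/
def rotCLM : Plane →L[ℝ] Plane :=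
  LinearMap.toContinuousLinearMap
    { toFun := rot
      map_add' := fun v w => plane_ext (by simp [rot_apply_zero]; ring) (by simp [rot_apply_one])
      map_smul' := fun c v => plane_ext (by simp [rot_apply_zero]) (by simp [rot_apply_one]) }

theorem norm_rot (v : Plane) : ‖rot v‖ = ‖v‖ := by
  have : ‖rot v‖ ^ 2 = ‖v‖ ^ 2 := by
    rw [norm_sq_plane, norm_sq_plane, rot_apply_zero, rot_apply_one]; ring
  exact (pow_left_inj₀ (norm_nonneg _) (norm_nonneg _) two_ne_zero).1 this

theorem inner_rot_self (v : Plane) : inner ℝ v (rot v) = 0 := by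
  rw [inner_plane, rot_apply_zero, rot_apply_one]; ring

theorem rot_rot (v : Plane) : rot (rot v) = -v :=
  plane_ext (by simp [rot_apply_zero, rot_apply_one]) (by simp [rot_apply_zero, rot_apply_one])

theorem rot_smul (c : ℝ) (v : Plane) : rot (c • v) = c • rot v := rotCLM.map_smul c v

theorem rot_add (v w : Plane) : rot (v + w) = rot v + rot w := rotCLM.map_add v w

theorem rot_neg (v : Plane) : rot (-v) = -rot v := rotCLM.map_neg v

/-- Expansion in the orthonormal frame `e, rot e`. -/
theorem frame_expansion {e : Plane} (he : ‖e‖ = 1) (v : Plane) :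
    v = inner ℝ v e • e + inner ℝ v (rot e) • rot e := by
  have h1 : e 0 ^ 2 + e 1 ^ 2 = 1 := by rw [← norm_sq_plane, he]; norm_num
  apply plane_ext
  · simp only [PiLp.add_apply, PiLp.smul_apply, smul_eq_mul, inner_plane, rot_apply_zero,
      rot_apply_one]
    linear_combination (- v 0) * h1
  · simp only [PiLp.add_apply, PiLp.smul_apply, smul_eq_mul, inner_plane, rot_apply_zero,
      rot_apply_one]
    linear_combination (- v 1) * h1

/-! ### The signed distance -/

/-- The nearest point of the complement to a point of `F` lies on the boundary. -/
theorem infDist_compl_eq_infDist_frontier {F : Set Plane} {x : Plane} (hx : x ∈ F) :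
    infDist x Fᶜ = infDist x (frontier F) := by
  -- Complement and frontier are then both empty, and `infDist` to the empty set is 0.
  by_cases hF : F = univ
  · simp [hF]
  obtain ⟨y, hy, hxy⟩ := exists_mem_frontier_infDist_compl_eq_dist hx hF
  apply le_antisymm
  · rw [← infDist_closure (s := Fᶜ)]
    exact infDist_le_infDist_of_subset
      (by rw [closure_compl]; exact fun z hz => hz.2) ⟨y, hy⟩
  · rw [hxy]; exact infDist_le_dist_of_mem hy

theorem signedDistFrom_of_mem {F : Set Plane} {x : Plane} (hx : x ∈ F) :
    signedDistFrom F x = -infDist x (frontier F) := by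
  rw [signedDistFrom, infDist_zero_of_mem hx, infDist_compl_eq_infDist_frontier hx]; ring

theorem signedDistFrom_of_notMem {F : Set Plane} {x : Plane} (hx : x ∉ F) :
    signedDistFrom F x = infDist x (frontier F) := by
  have h1 : x ∈ Fᶜ := hx
  have := infDist_compl_eq_infDist_frontier h1
  rw [compl_compl, frontier_compl] at this
  rw [signedDistFrom, infDist_zero_of_mem h1, this]; ring

theorem abs_signedDistFrom (F : Set Plane) (x : Plane) :
    |signedDistFrom F x| = infDist x (frontier F) := by
  by_cases hx : x ∈ F
  · rw [signedDistFrom_of_mem hx, abs_neg, abs_of_nonneg infDist_nonneg]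
  · rw [signedDistFrom_of_notMem hx, abs_of_nonneg infDist_nonneg]

theorem continuous_signedDistFrom (F : Set Plane) : Continuous (signedDistFrom F) :=
  (continuous_infDist_pt F).sub (continuous_infDist_pt Fᶜ)

theorem signedDistFrom_of_mem_frontier {F : Set Plane} {x : Plane} (hx : x ∈ frontier F) :
    signedDistFrom F x = 0 := by
  rw [← abs_eq_zero, abs_signedDistFrom, infDist_zero_of_mem hx]

theorem mem_frontier_of_signedDistFrom_eq_zero {F : Set Plane} (hne : (frontier F).Nonempty)
    {x : Plane} (hx : signedDistFrom F x = 0) : x ∈ frontier F := by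
  rw [isClosed_frontier.mem_iff_infDist_zero hne, ← abs_signedDistFrom, hx, abs_zero]

theorem mem_of_signedDistFrom_neg {F : Set Plane} {x : Plane} (hx : signedDistFrom F x < 0) :
    x ∈ F := by
  by_contra h
  rw [signedDistFrom_of_notMem h] at hx
  exact absurd hx (not_lt.2 infDist_nonneg)

theorem signedDistFrom_neg_iff {F : Set Plane} (hF : IsOpen F) (hne : (frontier F).Nonempty)
    (x : Plane) : signedDistFrom F x < 0 ↔ x ∈ F := by
  refine ⟨mem_of_signedDistFrom_neg, fun hx => ?_⟩
  rw [signedDistFrom_of_mem hx, neg_lt_zero]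
  refine lt_of_le_of_ne infDist_nonneg fun h => ?_
  have := (isClosed_frontier.mem_iff_infDist_zero hne).2 h.symm
  rw [hF.frontier_eq] at this
  exact this.2 hx

/-- Here χ is linear with slope `e` up to a relative error ε, and `A` is {χ > 0} up to points of the
zero level. Walking from `x` in direction `e` raises χ at rate at least 1 - ε, which bounds the
distance to `A` from above; χ being (1 + ε)-Lipschitz on the ball bounds it from below. Leaving the
zero level undecided makes the lemma applicable both to a set and to its complement, with χ and -χ.
-/
theorem abs_infDist_add_le {A : Set Plane} {χ : Plane → ℝ} {p x e : Plane} {ε r : ℝ}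
    (he : ‖e‖ = 1) (hε : 0 < ε) (hε' : ε ≤ 1 / 4)
    (hχ : ∀ y ∈ ball p r, ∀ z ∈ ball p r, |χ y - χ z - inner ℝ e (y - z)| ≤ ε * ‖y - z‖)
    (h0 : χ p = 0) (hA : ∀ y ∈ ball p r, 0 < χ y → y ∈ A)
    (hA' : ∀ y ∈ ball p r, y ∈ A → 0 ≤ χ y) (hx : ‖x - p‖ < r / 4) (hχx : χ x ≤ 0) :
    |infDist x A + χ x| ≤ 4 * ε * ‖x - p‖ := by
  have hr : 0 < r := by linarith [norm_nonneg (x - p)]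
  have hxb : x ∈ ball p r := by rw [mem_ball_iff_norm]; linarith
  have hpb : p ∈ ball p r := mem_ball_self hr
  have hlip : ∀ y ∈ ball p r, ∀ z ∈ ball p r, |χ y - χ z| ≤ (1 + ε) * ‖y - z‖ := by
    intro y hy z hz
    have h1 := hχ y hy z hz
    have h2 : |inner ℝ e (y - z)| ≤ ‖y - z‖ := by
      simpa [he] using abs_real_inner_le_norm e (y - z)
    rw [abs_le] at *
    constructor <;> linarith
  have hxp : -χ x ≤ (1 + ε) * ‖x - p‖ := by
    have := hlip x hxb p hpb
    rw [h0, sub_zero] at this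
    exact (neg_le_abs _).trans this
  have hn := norm_nonneg (x - p)
  have hstep : ∀ s, 0 ≤ s → s < 3 * r / 4 → -χ x < s * (1 - ε) → infDist x A ≤ s := by
    intro s hs hsr hs'
    have hy : x + s • e ∈ ball p r := by
      rw [mem_ball_iff_norm, show x + s • e - p = (x - p) + s • e by abel]
      refine (norm_add_le _ _).trans_lt ?_
      rw [norm_smul, he, Real.norm_of_nonneg hs]; linarith
    have h1 := hχ _ hy x hxb
    rw [show x + s • e - x = s • e by abel, inner_smul_right, real_inner_self_eq_norm_sq, he,
      norm_smul, he, Real.norm_of_nonneg hs] at h1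
    have h2 := (abs_le.1 h1).1
    have h3 := infDist_le_dist_of_mem (x := x) (hA _ hy (by nlinarith))
    rwa [dist_eq_norm, show x - (x + s • e) = -(s • e) by abel, norm_neg, norm_smul, he,
      Real.norm_of_nonneg hs, mul_one] at h3
  -- The walk must stay inside the ball, so only s < 3r/4 is tested directly; a larger s follows
  -- from a smaller one.
  have hup : infDist x A ≤ -χ x / (1 - ε) := by
    apply le_of_forall_gt_imp_ge_of_dense
    intro s hs
    have h1 : 0 < 1 - ε := by linarith
    have h2 : -χ x / (1 - ε) < 3 * r / 4 := by
      rw [div_lt_iff₀ h1]; nlinarith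
    have h3 : 0 ≤ -χ x / (1 - ε) := div_nonneg (by linarith) h1.le
    by_cases hsr : s < 3 * r / 4
    · exact hstep s (h3.trans hs.le) hsr (by rwa [div_lt_iff₀ h1] at hs)
    · obtain ⟨s', hs1, hs2⟩ := exists_between h2
      exact (hstep s' (h3.trans hs1.le) hs2 (by rwa [div_lt_iff₀ h1] at hs1)).trans
        (hs2.le.trans (not_lt.1 hsr))
  have hne : A.Nonempty := by
    refine ⟨p + (r / 2) • e, hA _ ?_ ?_⟩
    · rw [mem_ball_iff_norm, add_sub_cancel_left, norm_smul, he,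
        Real.norm_of_nonneg (by linarith)]; linarith
    · have hy : p + (r / 2) • e ∈ ball p r := by
        rw [mem_ball_iff_norm, add_sub_cancel_left, norm_smul, he,
          Real.norm_of_nonneg (by linarith)]; linarith
      have h1 := hχ _ hy p hpb
      rw [add_sub_cancel_left, inner_smul_right, real_inner_self_eq_norm_sq, he,
        norm_smul, he, Real.norm_of_nonneg (by linarith), h0] at h1
      have h2 := (abs_le.1 h1).1
      nlinarith
  -- A point of `A` outside the ball is at distance more than 3r/4 from `x`, whereas -χ(x)/(1 + ε)
  -- is at most r/4.
  have hlow : -χ x / (1 + ε) ≤ infDist x A := by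
    rw [le_infDist hne]
    intro y hy
    rw [div_le_iff₀ (by linarith), mul_comm, dist_comm, dist_eq_norm]
    by_cases hyb : y ∈ ball p r
    · have h1 := hlip y hyb x hxb
      linarith [le_abs_self (χ y - χ x), hA' y hyb hy]
    · rw [mem_ball_iff_norm, not_lt] at hyb
      have h1 : ‖y - p‖ ≤ ‖y - x‖ + ‖x - p‖ := by
        simpa using norm_add_le (y - x) (x - p)
      nlinarith
  have h4 : -χ x / (1 - ε) ≤ -χ x + 4 * ε * ‖x - p‖ := by
    rw [div_le_iff₀ (by linarith)]
    nlinarith [mul_nonneg hε.le hn, mul_nonneg (mul_nonneg hε.le hn) hε.le]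
  have h5 : -χ x - 4 * ε * ‖x - p‖ ≤ -χ x / (1 + ε) := by
    rw [le_div_iff₀ (by linarith)]
    nlinarith [mul_nonneg hε.le hn, mul_nonneg (mul_nonneg hε.le hn) hε.le]
  rw [abs_le]; constructor <;> linarith

/-- If `F = {ψ < 0}` near a zero `p` of `ψ`, where `∇ψ(p)` is a unit vector, then `∇ψ(p)` is the
gradient of the signed distance from `F` at `p`. -/
theorem hasGradientAt_signedDistFrom {F : Set Plane} {ψ : Plane → ℝ} {p e : Plane}
    (hψ : HasStrictFDerivAt ψ (innerSL ℝ e) p) (he : ‖e‖ = 1) (h0 : ψ p = 0)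
    (hF : ∀ᶠ x in 𝓝 p, (x ∈ F ↔ ψ x < 0)) : HasGradientAt (signedDistFrom F) e p := by
  rw [hasGradientAt_iff_isLittleO, Asymptotics.isLittleO_iff]
  intro c hc
  -- The distance differs from ψ by 4ε‖x - p‖ and ψ from its linear part by ε‖x - p‖, in all 5ε ≤ c.
  have hε : 0 < min (c / 5) (1 / 4) := by positivity
  set ε := min (c / 5) (1 / 4) with hεdef
  have hε1 : ε ≤ c / 5 := min_le_left _ _
  have hε2 : ε ≤ 1 / 4 := min_le_right _ _
  -- Strict differentiability is needed: the comparison uses increments between arbitrary pairs of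
  -- points near `p`.
  have h1 := hψ.isLittleO
  rw [Asymptotics.isLittleO_iff] at h1
  have h2 := h1 hε
  rw [nhds_prod_eq] at h2
  obtain ⟨r, hr, hball⟩ := Metric.mem_nhds_iff.1
    ((by rw [nhds_prod_eq]; exact h2) : {z : Plane × Plane | _} ∈ 𝓝 (p, p))
  obtain ⟨r', hr', hball'⟩ := Metric.mem_nhds_iff.1 hF
  have hχ : ∀ y ∈ ball p (min r r'), ∀ z ∈ ball p (min r r'),
      |ψ y - ψ z - inner ℝ e (y - z)| ≤ ε * ‖y - z‖ := by
    intro y hy z hz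
    have : ((y, z) : Plane × Plane) ∈ ball (p, p) r := by
      rw [mem_ball, Prod.dist_eq, max_lt_iff]
      exact ⟨(mem_ball.1 hy).trans_le (min_le_left _ _), (mem_ball.1 hz).trans_le (min_le_left _ _)⟩
    simpa using hball this
  have hFb : ∀ y ∈ ball p (min r r'), (y ∈ F ↔ ψ y < 0) := fun y hy =>
    hball' ((mem_ball.1 hy).trans_le (min_le_right _ _))
  have hpF : signedDistFrom F p = 0 := by
    have hpb : ∀ᶠ x in 𝓝 p, x ∈ ball p (min r r') := ball_mem_nhds _ (by positivity)
    have h3 := abs_infDist_add_le (A := Fᶜ) (χ := ψ) (x := p) he hε hε2 hχ h0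
      (fun y hy h => by rw [mem_compl_iff, hFb y hy]; linarith)
      (fun y hy h => by rw [mem_compl_iff, hFb y hy] at h; linarith) (by simp [hr, hr']) h0.le
    have h4 := abs_infDist_add_le (A := F) (χ := fun y => -ψ y) (x := p) (e := -e) (p := p)
      (by simpa using he) hε hε2
      (fun y hy z hz => by
        have := hχ y hy z hz
        rw [inner_neg_left, ← abs_neg]; convert this using 2; ring) (by simpa using h0)
      (fun y hy h => by rw [hFb y hy]; linarith)
      (fun y hy h => by rw [hFb y hy] at h; linarith) (by simp [hr, hr']) (by simp [h0])
    simp [h0] at h3 h4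
    simp [signedDistFrom, h3, h4]
  filter_upwards [ball_mem_nhds p (show 0 < min r r' / 4 by positivity)] with x hx
  rw [mem_ball_iff_norm] at hx
  have hn := norm_nonneg (x - p)
  have hxb : x ∈ ball p (min r r') := by rw [mem_ball_iff_norm]; linarith
  have hpb : p ∈ ball p (min r r') := mem_ball_self (by positivity)
  -- Inside `F` only the distance to the complement counts, outside only the distance to `F`; the
  -- comparison lemma is applied with ψ and -ψ respectively.
  have key : |signedDistFrom F x - ψ x| ≤ 4 * ε * ‖x - p‖ := by
    by_cases hx0 : ψ x < 0
    · have h3 := abs_infDist_add_le (A := Fᶜ) (χ := ψ) he hε hε2 hχ h0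
        (fun y hy h => by rw [mem_compl_iff, hFb y hy]; linarith)
        (fun y hy h => by rw [mem_compl_iff, hFb y hy] at h; linarith) hx hx0.le
      rw [signedDistFrom, infDist_zero_of_mem ((hFb x hxb).2 hx0), ← abs_neg]
      convert h3 using 2; ring
    · have h4 := abs_infDist_add_le (A := F) (χ := fun y => -ψ y) (e := -e) (p := p)
        (by simpa using he) hε hε2
        (fun y hy z hz => by
          have := hχ y hy z hz
          rw [inner_neg_left, ← abs_neg]; convert this using 2; ring) (by simpa using h0)
        (fun y hy h => by rw [hFb y hy]; linarith)
        (fun y hy h => by rw [hFb y hy] at h; linarith) hx (by simp; linarith)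
      have : x ∈ Fᶜ := fun h => hx0 ((hFb x hxb).1 h)
      rw [signedDistFrom, infDist_zero_of_mem this]
      convert h4 using 2; ring
  have h5 := hχ x hxb p hpb
  rw [h0, sub_zero] at h5
  rw [hpF, sub_zero, Real.norm_eq_abs]
  have : signedDistFrom F x - inner ℝ e (x - p) =
    (signedDistFrom F x - ψ x) + (ψ x - inner ℝ e (x - p)) := by ring
  rw [this]
  refine (abs_add_le _ _).trans ((add_le_add key h5).trans ?_)
  nlinarith

/-! ### The normal of a smooth set -/

theorem IsSmoothSet.zero_of_mem_frontier {F : Set Plane} (hF : IsOpen F) {p : Plane}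
    (hp : p ∈ frontier F) {ψ : Plane → ℝ} (hψ : ContinuousAt ψ p)
    (h : ∀ᶠ x in 𝓝 p, (x ∈ F ↔ ψ x < 0)) : ψ p = 0 := by
  rw [hF.frontier_eq] at hp
  apply le_antisymm
  · by_contra hneg
    have h1 : ∀ᶠ x in 𝓝 p, 0 < ψ x := hψ.eventually (lt_mem_nhds (not_le.1 hneg))
    obtain ⟨x, hx, hxF⟩ := mem_closure_iff_nhds.1 hp.1 _ (h.and h1)
    have := hx.1.1 hxF
    linarith [hx.2]
  · by_contra hneg
    exact hp.2 (h.self_of_nhds.2 (not_le.1 hneg))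

/-- Dividing the local defining function by the length of its gradient keeps its sublevel set and
makes the gradient a unit vector. -/
theorem IsSmoothSet.exists_hasGradientAt {F : Set Plane} (hF : IsSmoothSet F) {p : Plane}
    (hp : p ∈ frontier F) : ∃ e : Plane, ‖e‖ = 1 ∧ HasGradientAt (signedDistFrom F) e p := by
  obtain ⟨ψ, hψ, hd, hψF⟩ := hF.smooth p hp
  have h0 := IsSmoothSet.zero_of_mem_frontier hF.isOpen hp hψ.continuous.continuousAt hψF
  set g := gradient ψ p with hg
  have hgd : (InnerProductSpace.toDual ℝ Plane) g = fderiv ℝ ψ p := by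
    rw [hg, toDual_gradient]
  have hg0 : 0 < ‖g‖ := by
    rw [norm_pos_iff]; intro h
    rw [h, map_zero] at hgd
    exact hd hgd.symm
  refine ⟨‖g‖⁻¹ • g, by rw [norm_smul, norm_inv, norm_norm, inv_mul_cancel₀ hg0.ne'], ?_⟩
  have h1 : HasStrictFDerivAt ψ (fderiv ℝ ψ p) p :=
    (hψ.contDiffAt.hasStrictFDerivAt (by simp))
  have h2 : HasStrictFDerivAt (fun x => ‖g‖⁻¹ * ψ x) (innerSL ℝ (‖g‖⁻¹ • g)) p := by
    have h3 : innerSL ℝ (‖g‖⁻¹ • g) = ‖g‖⁻¹ • fderiv ℝ ψ p := by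
      rw [← hgd]
      ext w
      simp
    rw [h3]
    exact h1.const_mul ‖g‖⁻¹
  refine hasGradientAt_signedDistFrom h2 (by rw [norm_smul, norm_inv, norm_norm,
    inv_mul_cancel₀ hg0.ne']) (by simp [h0]) ?_
  filter_upwards [hψF] with x hx
  rw [hx]
  constructor
  · intro h; exact mul_neg_of_pos_of_neg (by positivity) h
  · intro h; by_contra h'
    exact absurd h (not_lt.2 (mul_nonneg (by positivity) (not_lt.1 h')))

theorem IsSmoothSet.norm_outerNormal {F : Set Plane} (hF : IsSmoothSet F) {p : Plane}
    (hp : p ∈ frontier F) : ‖outerNormal F p‖ = 1 := by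
  obtain ⟨e, he, h⟩ := hF.exists_hasGradientAt hp
  rw [outerNormal, h.gradient, he]

/-! ### Tubular neighbourhoods -/

section Tube

variable {G : Set Plane} {η : ℝ}

theorem IsTubularRadius.contDiffAt_signedDist (hη : IsTubularRadius G η) {x : Plane}
    (hx : x ∈ thickening η (frontier G)) : ContDiffAt ℝ ∞ (signedDistFrom G) x :=
  hη.smooth_dist.contDiffAt (isOpen_thickening.mem_nhds hx)

theorem IsTubularRadius.contDiffAt_proj (hη : IsTubularRadius G η) {x : Plane}
    (hx : x ∈ thickening η (frontier G)) : ContDiffAt ℝ ∞ (nearestPt (frontier G)) x :=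
  hη.smooth_proj.contDiffAt (isOpen_thickening.mem_nhds hx)

theorem IsTubularRadius.hasGradientAt (hη : IsTubularRadius G η) {x : Plane}
    (hx : x ∈ thickening η (frontier G)) :
    HasGradientAt (signedDistFrom G) (outerNormal G x) x :=
  ((hη.contDiffAt_signedDist hx).differentiableAt (by simp)).hasGradientAt

theorem outerNormal_eq (G : Set Plane) :
    outerNormal G = fun x => (InnerProductSpace.toDual ℝ Plane).symm
      (fderiv ℝ (signedDistFrom G) x) := rfl

theorem IsTubularRadius.contDiffAt_outerNormal (hη : IsTubularRadius G η) {x : Plane}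
    (hx : x ∈ thickening η (frontier G)) : ContDiffAt ℝ ∞ (outerNormal G) x := by
  rw [outerNormal_eq]
  exact (InnerProductSpace.toDual ℝ Plane).symm.toContinuousLinearEquiv.contDiff.contDiffAt.comp x
    ((hη.contDiffAt_signedDist hx).fderiv_right (by simp))

theorem mem_thickening_of_mem_frontier (hη : 0 < η) {x : Plane} (hx : x ∈ frontier G) :
    x ∈ thickening η (frontier G) := self_subset_thickening hη _ hx

theorem infDist_lt_of_mem_thickening {x : Plane} (hx : x ∈ thickening η (frontier G)) :
    infDist x (frontier G) < η := by
  obtain ⟨z, hz, hxz⟩ := mem_thickening_iff.1 hx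
  exact (infDist_le_dist_of_mem hz).trans_lt hxz

theorem mem_thickening_of_infDist_lt (hne : (frontier G).Nonempty) {x : Plane}
    (hx : infDist x (frontier G) < η) : x ∈ thickening η (frontier G) := by
  obtain ⟨z, hz, hxz⟩ := (infDist_lt_iff hne).1 hx
  exact mem_thickening_iff.2 ⟨z, hz, hxz⟩

/-- The eikonal equation. The distance is 1-Lipschitz, so the gradient has length at most 1; on the
segment towards a nearest boundary point the distance drops at unit rate, so some directional
derivative equals ±1. -/
theorem IsTubularRadius.norm_outerNormal (hG : IsSmoothSet G) (hη : IsTubularRadius G η)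
    {x : Plane} (hx : x ∈ thickening η (frontier G)) : ‖outerNormal G x‖ = 1 := by
  by_cases hxG : x ∈ frontier G
  · exact hG.norm_outerNormal hxG
  have hne : (frontier G).Nonempty := by
    obtain ⟨z, hz, _⟩ := mem_thickening_iff.1 hx
    exact ⟨z, hz⟩
  set d := signedDistFrom G with hd
  have hgrad := hη.hasGradientAt hx
  set n := outerNormal G x with hn
  have hdx : d x ≠ 0 := fun h => hxG (mem_frontier_of_signedDistFrom_eq_zero hne h)
  obtain ⟨q, hq, hxq⟩ := (isClosed_frontier (s := G)).exists_infDist_eq_dist hne x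
  set ℓ := dist x q with hℓ
  have hℓd : |d x| = ℓ := by rw [hd, abs_signedDistFrom, hxq]
  have hℓ0 : 0 < ℓ := by rw [← hℓd]; exact abs_pos.2 hdx
  -- Off the boundary the sign of the signed distance is locally constant.
  obtain ⟨σ, hσ, hσx⟩ : ∃ σ : ℝ, |σ| = 1 ∧ ∀ᶠ y in 𝓝 x, d y = σ * infDist y (frontier G) := by
    have hc : ContinuousAt d x := (continuous_signedDistFrom G).continuousAt
    rcases lt_or_gt_of_ne hdx with h | h
    · refine ⟨-1, by simp, ?_⟩
      filter_upwards [hc.eventually (gt_mem_nhds h)] with y hy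
      rw [← abs_signedDistFrom, abs_of_neg hy]; ring
    · refine ⟨1, by simp, ?_⟩
      filter_upwards [hc.eventually (lt_mem_nhds h)] with y hy
      rw [← abs_signedDistFrom, abs_of_pos hy]; ring
  apply le_antisymm
  · have h1 := hgrad.hasFDerivAt.le_of_lip' (C := 1) zero_le_one (by
      filter_upwards [hσx] with y hy
      rw [← hd, hy, hσx.self_of_nhds, ← mul_sub, norm_mul, Real.norm_eq_abs, hσ, one_mul, one_mul,
        ← dist_eq_norm]
      exact (lipschitz_infDist_pt (frontier G)).dist_le_mul y x |>.trans (by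
        simp [dist_eq_norm]))
    simpa using h1
  · set v := ℓ⁻¹ • (q - x) with hv
    have hvn : ‖v‖ = 1 := by
      rw [hv, norm_smul, norm_inv, Real.norm_of_nonneg hℓ0.le, ← dist_eq_norm, dist_comm q x, ← hℓ,
        inv_mul_cancel₀ hℓ0.ne']
    have hline : ∀ t ∈ Icc 0 ℓ, infDist (x + t • v) (frontier G) = ℓ - t := by
      intro t ht
      have hq' : q = x + ℓ • v := by
        rw [hv, smul_smul, mul_inv_cancel₀ hℓ0.ne', one_smul]; abel
      apply le_antisymm
      · refine (infDist_le_dist_of_mem hq).trans ?_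
        rw [dist_comm, hq', dist_eq_norm, show x + ℓ • v - (x + t • v) = (ℓ - t) • v by
          rw [sub_smul]; abel, norm_smul, hvn, mul_one, Real.norm_of_nonneg (by linarith [ht.2])]
      · have := infDist_le_infDist_add_dist (s := frontier G) (x := x) (y := x + t • v)
        rw [hxq, dist_eq_norm, show x - (x + t • v) = -(t • v) by abel, norm_neg, norm_smul, hvn,
          mul_one, Real.norm_of_nonneg ht.1] at this
        linarith
    have hγ : HasDerivAt (fun t : ℝ => x + t • v) v 0 := by
      simpa using ((hasDerivAt_id (0 : ℝ)).smul_const v).const_add x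
    have h1 : HasDerivAt (fun t : ℝ => d (x + t • v)) (inner ℝ n v) 0 := by
      have h2 : HasFDerivAt d (InnerProductSpace.toDual ℝ Plane n) (x + (0 : ℝ) • v) := by
        simpa using hgrad.hasFDerivAt
      exact h2.comp_hasDerivAt (0 : ℝ) hγ
    have h3 : HasDerivWithinAt (fun t : ℝ => d (x + t • v)) (-σ) (Ici 0) 0 := by
      have h4 : HasDerivWithinAt (fun t : ℝ => σ * (ℓ - t)) (-σ) (Ici 0) 0 := by
        have := (((hasDerivAt_id (0 : ℝ)).const_sub ℓ).const_mul σ).hasDerivWithinAt (s := Ici 0)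
        simpa using this
      have hev : ∀ᶠ t : ℝ in 𝓝[Ici 0] 0, d (x + t • v) = σ * (ℓ - t) := by
        have hc : Tendsto (fun t : ℝ => x + t • v) (𝓝[Ici 0] 0) (𝓝 x) := by
          have := hγ.continuousAt.tendsto
          rw [zero_smul, add_zero] at this
          exact this.mono_left nhdsWithin_le_nhds
        filter_upwards [hc.eventually hσx, self_mem_nhdsWithin,
          mem_nhdsWithin_of_mem_nhds (gt_mem_nhds hℓ0)] with t h5 h6 h7
        rw [h5, hline t ⟨h6, le_of_lt h7⟩]
      exact h4.congr_of_eventuallyEq hev (hev.self_of_nhdsWithin (by simp))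
    have h5 := (uniqueDiffWithinAt_Ici (0 : ℝ)).eq_deriv _ h1.hasDerivWithinAt h3
    have h6 : |inner ℝ n v| = 1 := by rw [h5, abs_neg, hσ]
    have h7 := abs_real_inner_le_norm n v
    rw [h6, hvn, mul_one] at h7
    exact h7

theorem IsTubularRadius.inner_fderiv_outerNormal_comm (hη : IsTubularRadius G η) {x : Plane}
    (hx : x ∈ thickening η (frontier G)) (v w : Plane) :
    inner ℝ (fderiv ℝ (outerNormal G) x v) w = inner ℝ (fderiv ℝ (outerNormal G) x w) v := by
  have hd : DifferentiableAt ℝ (fderiv ℝ (signedDistFrom G)) x :=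
    ((hη.contDiffAt_signedDist hx).fderiv_right (m := 1) (by norm_cast)).differentiableAt (by simp)
  have h1 : ∀ v w, inner ℝ (fderiv ℝ (outerNormal G) x v) w =
      fderiv ℝ (fderiv ℝ (signedDistFrom G)) x v w := by
    intro v w
    have h2 : (fun y => inner ℝ (outerNormal G y) w) =
        fun y => fderiv ℝ (signedDistFrom G) y w := by
      funext y; exact inner_gradient_left
    have hn : DifferentiableAt ℝ (outerNormal G) x :=
      (hη.contDiffAt_outerNormal hx).differentiableAt (by simp)
    have h3 : HasFDerivAt (fun y => inner ℝ (outerNormal G y) w) _ x :=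
      hn.hasFDerivAt.inner ℝ (hasFDerivAt_const w x)
    rw [h2] at h3
    have h4 := h3.unique (hd.hasFDerivAt.clm_apply (hasFDerivAt_const w x))
    have h5 := congrArg (fun A => A v) h4
    simpa using h5
  rw [h1, h1]
  exact (hη.contDiffAt_signedDist hx).isSymmSndFDerivAt (by simp; norm_cast) v w

/-- Differentiating |∇d|² = 1 gives D²d w · ∇d = 0 for all w, and the symmetry of D²d turns this
into D²d ∇d = 0. -/
theorem IsTubularRadius.fderiv_outerNormal_self (hG : IsSmoothSet G) (hη : IsTubularRadius G η)
    {x : Plane} (hx : x ∈ thickening η (frontier G)) :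
    fderiv ℝ (outerNormal G) x (outerNormal G x) = 0 := by
  have hd : DifferentiableAt ℝ (outerNormal G) x :=
    (hη.contDiffAt_outerNormal hx).differentiableAt (by simp)
  have h1 : ∀ w, inner ℝ (fderiv ℝ (outerNormal G) x w) (outerNormal G x) = 0 := by
    intro w
    have h2 := (hd.hasFDerivAt.norm_sq).fderiv
    have h3 : (fun y => ‖outerNormal G y‖ ^ 2) =ᶠ[𝓝 x] fun _ => (1 : ℝ) := by
      filter_upwards [isOpen_thickening.mem_nhds hx] with y hy
      rw [hη.norm_outerNormal hG hy]; norm_num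
    rw [h3.fderiv_eq] at h2
    have h4 := congrArg (fun A => A w) h2
    simp at h4
    rw [real_inner_comm]; exact h4
  apply ext_inner_right ℝ
  intro w
  rw [hη.inner_fderiv_outerNormal_comm hx, h1, inner_zero_left]

theorem ray_mem_thickening (hG : IsSmoothSet G) {p : Plane}
    (hp : p ∈ frontier G) {u : ℝ} (hu : |u| < η) :
    p + u • outerNormal G p ∈ thickening η (frontier G) := by
  refine mem_thickening_iff.2 ⟨p, hp, ?_⟩
  rw [dist_eq_norm, add_sub_cancel_left, norm_smul, hG.norm_outerNormal hp, mul_one]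
  exact hu

/-- Along the ray, n = ∇d minus its initial value solves a linear differential inequality |n'| ≤
K|n| with n = 0 at the start, since D²d annihilates ∇d. Hence ∇d is constant on the ray and `d`
grows at rate σ. The sign σ reduces both directions to a nonnegative parameter. -/
theorem IsTubularRadius.ray_aux (hη : IsTubularRadius G η) (hG : IsSmoothSet G) {p : Plane}
    (hp : p ∈ frontier G) {σ b : ℝ} (hσ : |σ| = 1) (hb : b < η) (hb0 : 0 ≤ b) :
    outerNormal G (p + (σ * b) • outerNormal G p) = outerNormal G p ∧
      signedDistFrom G (p + (σ * b) • outerNormal G p) = σ * b := by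
  set ν := outerNormal G p with hν
  set c : ℝ → Plane := fun u => p + (σ * u) • ν with hc
  have hcd : ∀ u, HasDerivAt c (σ • ν) u := by
    intro u
    have := (((hasDerivAt_id u).const_mul σ).smul_const ν).const_add p
    rw [mul_one] at this
    exact this
  have hmem : ∀ u ∈ Icc 0 b, c u ∈ thickening η (frontier G) := by
    intro u hu
    apply ray_mem_thickening hG hp
    rw [abs_mul, hσ, one_mul, abs_of_nonneg hu.1]
    exact hu.2.trans_lt hb
  have hcc : Continuous c := continuous_iff_continuousAt.2 fun u => (hcd u).continuousAt
  have hK : ∃ K : ℝ, ∀ u ∈ Icc 0 b, ‖fderiv ℝ (outerNormal G) (c u)‖ ≤ K := by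
    have : ContinuousOn (fun u => ‖fderiv ℝ (outerNormal G) (c u)‖) (Icc 0 b) := by
      intro u hu
      have h1 : ContinuousAt (fderiv ℝ (outerNormal G)) (c u) :=
        ((hη.contDiffAt_outerNormal (hmem u hu)).fderiv_right (m := 0) (by simp)).continuousAt
      exact (h1.norm.comp hcc.continuousAt).continuousWithinAt
    obtain ⟨K, hK⟩ := isCompact_Icc.exists_bound_of_continuousOn this
    exact ⟨K, fun u hu => by simpa using hK u hu⟩
  obtain ⟨K, hK⟩ := hK
  have hnd : ∀ u ∈ Icc 0 b, HasDerivAt (fun u => outerNormal G (c u))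
      (fderiv ℝ (outerNormal G) (c u) (σ • ν)) u := fun u hu =>
    ((hη.contDiffAt_outerNormal (hmem u hu)).differentiableAt
      (by simp)).hasFDerivAt.comp_hasDerivAt u (hcd u)
  have h1 : ∀ u ∈ Icc 0 b, outerNormal G (c u) - ν = 0 := by
    apply eq_zero_of_abs_deriv_le_mul_abs_self_of_eq_zero_right
      (f' := fun u => fderiv ℝ (outerNormal G) (c u) (σ • ν)) (K := K)
    · exact fun u hu => ((hnd u hu).sub_const ν).continuousAt.continuousWithinAt
    · exact fun u hu => ((hnd u (Ico_subset_Icc_self hu)).sub_const ν).hasDerivWithinAt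
    · simp [hc, hν]
    · intro u hu
      have hu' := Ico_subset_Icc_self hu
      -- Subtracting the normal at the current point costs nothing and exhibits the difference that
      -- Grönwall's argument needs.
      have h2 : fderiv ℝ (outerNormal G) (c u) (σ • ν) =
          fderiv ℝ (outerNormal G) (c u) (σ • (ν - outerNormal G (c u))) := by
        rw [smul_sub, map_sub, map_smul _ σ (outerNormal G (c u)),
          hη.fderiv_outerNormal_self hG (hmem u hu'), smul_zero, sub_zero]
      rw [h2]
      refine (ContinuousLinearMap.le_opNorm _ _).trans ?_
      rw [norm_smul, Real.norm_eq_abs, hσ, one_mul, norm_sub_rev]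
      gcongr
      exact hK u hu'
  have h2 : ∀ u ∈ Icc 0 b, signedDistFrom G (c u) - σ * u = 0 := by
    have hdd : ∀ u ∈ Icc 0 b, HasDerivAt (fun u => signedDistFrom G (c u) - σ * u) 0 u := by
      intro u hu
      have h3 := (hη.hasGradientAt (hmem u hu)).hasFDerivAt.comp_hasDerivAt u (hcd u)
      have h4 : outerNormal G (c u) = ν := sub_eq_zero.1 (h1 u hu)
      have h5 : ‖ν‖ = 1 := hG.norm_outerNormal hp
      have h6 := h3.sub ((hasDerivAt_id u).const_mul σ)
      rw [InnerProductSpace.toDual_apply_apply, h4, inner_smul_right, real_inner_self_eq_norm_sq, h5, one_pow, sub_self] at h6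
      exact h6
    apply eq_zero_of_abs_deriv_le_mul_abs_self_of_eq_zero_right (f' := fun _ => 0) (K := 0)
    · exact fun u hu => (hdd u hu).continuousAt.continuousWithinAt
    · exact fun u hu => (hdd u (Ico_subset_Icc_self hu)).hasDerivWithinAt
    · simp [hc, signedDistFrom_of_mem_frontier hp]
    · simp
  exact ⟨sub_eq_zero.1 (h1 b ⟨hb0, le_rfl⟩), sub_eq_zero.1 (h2 b ⟨hb0, le_rfl⟩)⟩

theorem IsTubularRadius.ray (hη : IsTubularRadius G η) (hG : IsSmoothSet G) {p : Plane}
    (hp : p ∈ frontier G) {u : ℝ} (hu : |u| < η) :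
    outerNormal G (p + u • outerNormal G p) = outerNormal G p ∧
      signedDistFrom G (p + u • outerNormal G p) = u := by
  rcases le_total 0 u with h | h
  · have := hη.ray_aux hG hp (σ := 1) (b := u) (by simp) (lt_of_abs_lt hu) h
    simpa using this
  · have := hη.ray_aux hG hp (σ := -1) (b := -u) (by simp) (by rwa [abs_of_nonpos h] at hu)
      (by linarith)
    simpa using this

theorem IsTubularRadius.nearestPt_spec (hη : IsTubularRadius G η) {x : Plane}
    (hx : x ∈ thickening η (frontier G)) : nearestPt (frontier G) x ∈ frontier G ∧
      dist x (nearestPt (frontier G) x) = infDist x (frontier G) :=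
  Classical.epsilon_spec (hη.unique_nearest x hx).exists

theorem IsTubularRadius.nearestPt_eq (hη : IsTubularRadius G η) {x y : Plane}
    (hx : x ∈ thickening η (frontier G)) (hy : y ∈ frontier G)
    (hxy : dist x y = infDist x (frontier G)) : nearestPt (frontier G) x = y :=
  (hη.unique_nearest x hx).unique (hη.nearestPt_spec hx) ⟨hy, hxy⟩

theorem IsTubularRadius.nearestPt_ray (hη : IsTubularRadius G η) (hG : IsSmoothSet G) {p : Plane}
    (hp : p ∈ frontier G) {u : ℝ} (hu : |u| < η) :
    nearestPt (frontier G) (p + u • outerNormal G p) = p := by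
  apply hη.nearestPt_eq (ray_mem_thickening hG hp hu) hp
  rw [← abs_signedDistFrom, (hη.ray hG hp hu).2, dist_eq_norm, add_sub_cancel_left, norm_smul,
    hG.norm_outerNormal hp, mul_one, Real.norm_eq_abs]

end Tube

/-! ### Parametrization of the boundary by closed curves -/

/-- The boundary of `F` is the disjoint union of the smooth closed curves `c i`, of periods `L i`,
which are embedded and run in the direction of the unit tangent. -/
structure IsBoundaryParam (F : Set Plane) {ι : Type} (L : ι → ℝ) (c : ι → ℝ → Plane) : Prop where
  period_pos : ∀ i, 0 < L i
  smooth : ∀ i, ContDiff ℝ ∞ (c i)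
  periodic : ∀ i, Function.Periodic (c i) (L i)
  injOn : ∀ i, InjOn (c i) (Ico 0 (L i))
  disjoint : Pairwise fun i j => Disjoint (range (c i)) (range (c j))
  iUnion_range : ⋃ i, range (c i) = frontier F
  deriv_eq : ∀ i s, deriv (c i) s = ‖deriv (c i) s‖ • unitTangent F (c i s)
  speed_pos : ∀ i s, 0 < ‖deriv (c i) s‖

/-- A field bounded by `C` cannot leave the ball of radius C(n + 1) during time n + 1, so
Picard-Lindelöf applies on every such interval; the solutions agree by uniqueness and are glued. -/
theorem exists_global_solution {X : Plane → Plane} {K C : ℝ≥0} (hK : LipschitzWith K X)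
    (hC : ∀ x, ‖X x‖ ≤ C) (x₀ : Plane) :
    ∃ γ : ℝ → Plane, γ 0 = x₀ ∧ ∀ t, HasDerivAt γ (X (γ t)) t := by
  have h1 : ∀ n : ℕ, ∃ α : ℝ → Plane, α 0 = x₀ ∧
      ∀ t ∈ Ioo (-((n : ℝ) + 1)) (n + 1), HasDerivAt α (X (α t)) t := by
    intro n
    have hn : (0 : ℝ) ≤ (n : ℝ) + 1 := by positivity
    have hp : IsPicardLindelof (fun _ : ℝ => X) (tmin := -((n : ℝ) + 1)) (tmax := n + 1)
        ⟨0, by constructor <;> linarith⟩ x₀ (C * ((n : ℝ≥0) + 1)) 0 C K := by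
      apply IsPicardLindelof.of_time_independent (fun x _ => hC x) hK.lipschitzOnWith
      simp
    obtain ⟨α, hα0, hα⟩ := hp.exists_eq_forall_mem_Icc_hasDerivWithinAt₀
    exact ⟨α, hα0, fun t ht => (hα t (Ioo_subset_Icc_self ht)).hasDerivAt
      (Icc_mem_nhds ht.1 ht.2)⟩
  choose α hα0 hα using h1
  have huniq : ∀ m n : ℕ, m ≤ n → EqOn (α m) (α n) (Ioo (-((m : ℝ) + 1)) (m + 1)) := by
    intro m n hmn
    have hmn' : (m : ℝ) ≤ n := by exact_mod_cast hmn
    apply ODE_solution_unique_of_mem_Ioo (v := fun _ => X) (s := fun _ => univ) (K := K) (t₀ := 0)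
    · exact fun _ _ => hK.lipschitzOnWith
    · constructor <;> linarith [(Nat.cast_nonneg m : (0 : ℝ) ≤ m)]
    · exact fun t ht => ⟨hα m t ht, mem_univ _⟩
    · exact fun t ht => ⟨hα n t ⟨by linarith [ht.1], by linarith [ht.2]⟩, mem_univ _⟩
    · rw [hα0, hα0]
  -- The index ⌈|t|⌉ guarantees that t lies in the open interval on which that solution is known.
  set γ : ℝ → Plane := fun t => α ⌈|t|⌉₊ t with hγ
  have hγα : ∀ n : ℕ, EqOn γ (α n) (Ioo (-((n : ℝ) + 1)) (n + 1)) := by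
    intro n t ht
    rcases le_total n ⌈|t|⌉₊ with h | h
    · exact (huniq _ _ h ht).symm
    · apply huniq _ _ h
      have := Nat.le_ceil |t|
      rw [abs_le] at this
      constructor <;> linarith
  refine ⟨γ, by rw [hγ]; simp [hα0], fun t => ?_⟩
  have ht : t ∈ Ioo (-((⌈|t|⌉₊ : ℝ) + 1)) (⌈|t|⌉₊ + 1) := by
    have := Nat.le_ceil |t|
    rw [abs_le] at this
    constructor <;> linarith
  have h2 := hα _ t ht
  rw [← hγα _ ht] at h2
  exact h2.congr_of_eventuallyEq
    (eventually_of_mem (Ioo_mem_nhds ht.1 ht.2) (hγα _))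

/-! ### The orbits of the tangent field of the boundary -/

section Tube

variable {G : Set Plane} {η : ℝ}

theorem IsSmoothSet.isCompact_frontier {F : Set Plane} (hF : IsSmoothSet F) :
    IsCompact (frontier F) :=
  Metric.isCompact_of_isClosed_isBounded isClosed_frontier
    (hF.bounded.closure.subset frontier_subset_closure)

theorem unitTangent_eq (G : Set Plane) : unitTangent G = fun x => rotCLM (outerNormal G x) := rfl

theorem IsTubularRadius.contDiffAt_unitTangent (hη : IsTubularRadius G η) {x : Plane}
    (hx : x ∈ thickening η (frontier G)) : ContDiffAt ℝ ∞ (unitTangent G) x := by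
  rw [unitTangent_eq]
  exact rotCLM.contDiff.contDiffAt.comp x (hη.contDiffAt_outerNormal hx)

/-- A smooth compactly supported vector field which extends the unit tangent of `∂G`. -/
theorem exists_tangent_field (hG : IsSmoothSet G) (hη : IsTubularRadius G η) :
    ∃ (X : Plane → Plane) (χ : Plane → ℝ), ContDiff ℝ ∞ X ∧ HasCompactSupport X ∧
      (∀ x, X x = χ x • unitTangent G x) ∧ ∀ x ∈ frontier G, X x = unitTangent G x := by
  have hη2 : 0 < η / 2 := half_pos hη.pos
  -- Cutting off at η/2 makes the product vanish near every point outside the η-tube, where the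
  -- tangent need not be smooth.
  obtain ⟨χ, hχ0, hχ1, -⟩ := exists_contMDiffMap_zero_one_of_isClosed (n := ⊤)
    (modelWithCornersSelf ℝ Plane)
    (s := (thickening (η / 2) (frontier G))ᶜ) (t := frontier G) isOpen_thickening.isClosed_compl
    isClosed_frontier (disjoint_compl_left_iff_subset.2 (self_subset_thickening hη2 _))
  have hχ : ContDiff ℝ ∞ χ := χ.contMDiff.contDiff
  have hz : ∀ x, x ∉ cthickening (η / 2) (frontier G) → χ x = 0 := fun x hx =>
    hχ0 fun h => hx (thickening_subset_cthickening _ _ h)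
  refine ⟨fun x => χ x • unitTangent G x, χ, ?_, ?_, fun _ => rfl, ?_⟩
  · rw [contDiff_iff_contDiffAt]
    intro x
    by_cases hx : x ∈ thickening η (frontier G)
    · exact hχ.contDiffAt.smul (hη.contDiffAt_unitTangent hx)
    · have hx' : x ∉ cthickening (η / 2) (frontier G) := fun h =>
        hx (cthickening_subset_thickening' hη.pos (by linarith [hη.pos]) _ h)
      apply (contDiffAt_const (c := (0 : Plane))).congr_of_eventuallyEq
      filter_upwards [isClosed_cthickening.isOpen_compl.mem_nhds hx'] with y hy
      rw [hz y hy, zero_smul]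
  · refine HasCompactSupport.intro (hG.isCompact_frontier.cthickening (r := η / 2)) fun x hx => ?_
    rw [hz x hx, zero_smul]
  · intro x hx
    change χ x • _ = _
    rw [hχ1 hx]; simp

/-- Bootstrap: if γ is C^n then γ' = X ∘ γ is C^n, so γ is C^{n+1}. -/
theorem contDiff_of_hasDerivAt_comp {X : Plane → Plane} (hX : ContDiff ℝ ∞ X) {γ : ℝ → Plane}
    (hγ : ∀ t, HasDerivAt γ (X (γ t)) t) : ContDiff ℝ ∞ γ := by
  have hd : deriv γ = fun t => X (γ t) := funext fun t => (hγ t).deriv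
  rw [contDiff_infty]
  intro n
  induction n with
  | zero => exact contDiff_zero.2 (continuous_iff_continuousAt.2 fun t => (hγ t).continuousAt)
  | succ n ih =>
    rw [Nat.cast_succ, contDiff_succ_iff_deriv]
    refine ⟨fun t => (hγ t).differentiableAt, by simp, ?_⟩
    rw [hd]
    exact (hX.of_le (by exact_mod_cast le_top)).comp ih

/-- The curve `γ` in `∂G` is locally onto `∂G`. -/
theorem nhdsWithin_frontier_le_map (hG : IsSmoothSet G) (hη : IsTubularRadius G η)
    {γ : ℝ → Plane} (hγ : ContDiff ℝ ∞ γ) (hmem : ∀ s, γ s ∈ frontier G)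
    (hd : ∀ s, HasDerivAt γ (unitTangent G (γ s)) s) (s₀ : ℝ) :
    𝓝[frontier G] (γ s₀) ≤ map γ (𝓝 s₀) := by
  -- Fermi coordinates around γ(s₀). Their differential sends the basis to tangent and normal, hence
  -- is onto, and Θ maps neighbourhoods onto neighbourhoods.
  set Θ : ℝ × ℝ → Plane := fun q => γ q.1 + q.2 • outerNormal G (γ q.1) with hΘ
  have hΘ0 : Θ (s₀, 0) = γ s₀ := by simp [hΘ]
  have hsm : ContDiffAt ℝ ∞ Θ (s₀, 0) := by
    have h1 : ContDiffAt ℝ ∞ (fun q : ℝ × ℝ => γ q.1) (s₀, 0) :=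
      (hγ.comp contDiff_fst).contDiffAt
    have h2 : ContDiffAt ℝ ∞ (fun q : ℝ × ℝ => outerNormal G (γ q.1)) (s₀, 0) :=
      ContDiffAt.comp (s₀, (0 : ℝ))
        (hη.contDiffAt_outerNormal (mem_thickening_of_mem_frontier hη.pos (hmem s₀))) h1
    exact h1.add (contDiffAt_snd.smul h2)
  have hst := hsm.hasStrictFDerivAt (by simp)
  have h10 : fderiv ℝ Θ (s₀, 0) (1, 0) = unitTangent G (γ s₀) := by
    have h1 : HasDerivAt (fun s : ℝ => ((s, 0) : ℝ × ℝ)) (1, 0) s₀ :=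
      (hasDerivAt_id s₀).prodMk (hasDerivAt_const s₀ (0 : ℝ))
    have h2 := hst.hasFDerivAt.comp_hasDerivAt s₀ h1
    have h3 : Θ ∘ (fun s : ℝ => ((s, 0) : ℝ × ℝ)) = γ := by
      funext s; simp [hΘ]
    rw [h3] at h2
    exact h2.unique (hd s₀)
  have h01 : fderiv ℝ Θ (s₀, 0) (0, 1) = outerNormal G (γ s₀) := by
    have h1 : HasDerivAt (fun r : ℝ => ((s₀, r) : ℝ × ℝ)) (0, 1) 0 :=
      (hasDerivAt_const (0 : ℝ) s₀).prodMk (hasDerivAt_id (0 : ℝ))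
    have h2 := hst.hasFDerivAt.comp_hasDerivAt (0 : ℝ) h1
    have h3 : HasDerivAt (Θ ∘ (fun r : ℝ => ((s₀, r) : ℝ × ℝ))) (outerNormal G (γ s₀)) 0 := by
      have := ((hasDerivAt_id (0 : ℝ)).smul_const (outerNormal G (γ s₀))).const_add (γ s₀)
      rw [one_smul] at this
      exact this
    exact h2.unique h3
  have hsurj : (fderiv ℝ Θ (s₀, 0)).range = ⊤ := by
    rw [LinearMap.range_eq_top]
    intro w
    refine ⟨(inner ℝ w (unitTangent G (γ s₀)), inner ℝ w (outerNormal G (γ s₀))), ?_⟩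
    have h1 : ((inner ℝ w (unitTangent G (γ s₀)), inner ℝ w (outerNormal G (γ s₀))) : ℝ × ℝ) =
        (inner ℝ w (unitTangent G (γ s₀)) : ℝ) • ((1, 0) : ℝ × ℝ) +
          (inner ℝ w (outerNormal G (γ s₀)) : ℝ) • ((0, 1) : ℝ × ℝ) := by simp
    have h2 := frame_expansion (hG.norm_outerNormal (hmem s₀)) w
    conv_rhs => rw [h2]
    rw [h1]
    simp only [ContinuousLinearMap.coe_coe, map_add, map_smul, h10, h01]
    rw [add_comm]; rfl
  have hmap := hst.map_nhds_eq_of_surj hsurj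
  rw [hΘ0] at hmap
  intro U hU
  rw [mem_map] at hU
  have hV : {q : ℝ × ℝ | q.1 ∈ γ ⁻¹' U ∧ |q.2| < η} ∈ 𝓝 (s₀, (0 : ℝ)) := by
    apply Filter.inter_mem
    · exact (continuous_fst.tendsto (s₀, (0 : ℝ))).eventually hU
    · have : ContinuousAt (fun q : ℝ × ℝ => |q.2|) (s₀, 0) := continuous_snd.abs.continuousAt
      exact this.eventually (gt_mem_nhds (by simpa using hη.pos))
  have h4 := image_mem_map (m := Θ) hV
  rw [hmap] at h4
  rw [mem_nhdsWithin_iff_exists_mem_nhds_inter]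
  refine ⟨_, h4, ?_⟩
  rintro x ⟨⟨q, ⟨hq1, hq2⟩, rfl⟩, hxG⟩
  -- The second coordinate is the signed distance, so it vanishes at points of the boundary, which
  -- are therefore values of γ.
  have h5 := (hη.ray hG (hmem q.1) hq2).2
  have h6 : q.2 = 0 := by
    rw [← h5]; exact signedDistFrom_of_mem_frontier hxG
  change γ q.1 + q.2 • _ ∈ U
  rw [h6, zero_smul, add_zero]
  exact hq1

/-- A unit speed curve whose range is compact and which is locally onto its range is periodic. -/
theorem exists_minimal_period {γ : ℝ → Plane} (hc : Continuous γ)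
    (huniq : ∀ a b, γ a = γ b → Function.Periodic γ (b - a))
    (hK : IsCompact (range γ)) (hloc : ∀ s, 𝓝[range γ] (γ s) ≤ map γ (𝓝 s))
    (hne : ∃ a b, γ a ≠ γ b) :
    ∃ L, 0 < L ∧ Function.Periodic γ L ∧ InjOn γ (Ico 0 L) := by
  -- Finitely many short arcs cover the range. A time `N` beyond the right end of all these
  -- parameter intervals must repeat an earlier value.
  have h1 : ∃ a b, a < b ∧ γ a = γ b := by
    choose! σ hσ using fun (q : Plane) (hq : q ∈ range γ) => hq
    obtain ⟨t, -, ht⟩ := hK.elim_nhdsWithin_subcover (fun q => γ '' Ioo (σ q - 1) (σ q + 1)) (by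
      intro q hq
      have := hloc (σ q)
      rw [hσ q hq] at this
      exact this (image_mem_map (Ioo_mem_nhds (by linarith) (by linarith))))
    obtain ⟨N, hN⟩ := (t.image fun q => σ q + 1).finite_toSet.bddAbove
    have h2 := ht (mem_range_self (N : ℝ))
    simp only [mem_iUnion] at h2
    obtain ⟨q, hq, u, hu, huN⟩ := h2
    refine ⟨u, N, hu.2.trans_le (hN ?_), huN⟩
    simp only [Finset.coe_image, mem_image]
    exact ⟨q, hq, rfl⟩
  obtain ⟨a, b, hab, hγab⟩ := h1
  -- The periods form a closed subgroup of ℝ: if dense, γ is constant; otherwise it is cyclic and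
  -- its generator, up to sign, is the minimal period.
  let S : AddSubgroup ℝ :=
    { carrier := {P | Function.Periodic γ P}
      add_mem' := fun h1 h2 => h1.add_period h2
      zero_mem' := fun x => by simp
      neg_mem' := fun h => h.neg }
  have hSc : IsClosed (S : Set ℝ) := by
    have : (S : Set ℝ) = ⋂ s : ℝ, {P | γ (s + P) = γ s} := by
      ext P; simp [S, Function.Periodic]
    rw [this]
    exact isClosed_iInter fun s => isClosed_eq (hc.comp (by fun_prop)) continuous_const
  rcases S.dense_or_cyclic with h | ⟨L, hL⟩
  · exfalso
    obtain ⟨u, v, huv⟩ := hne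
    have : (v - u : ℝ) ∈ (S : Set ℝ) := by
      rw [← hSc.closure_eq, h.closure_eq]; trivial
    have h3 : Function.Periodic γ (v - u) := this
    have h4 := h3 u
    rw [add_sub_cancel] at h4
    exact huv h4.symm
  · have hper : ∀ P, Function.Periodic γ P ↔ ∃ n : ℤ, n • L = P := by
      intro P
      rw [← AddSubgroup.mem_closure_singleton, ← hL]; rfl
    have hL0 : L ≠ 0 := by
      rintro rfl
      obtain ⟨n, hn⟩ := (hper _).1 (huniq a b hγab)
      simp at hn
      linarith
    refine ⟨|L|, abs_pos.2 hL0, ?_, ?_⟩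
    · rw [hper]
      rcases abs_choice L with h | h
      · exact ⟨1, by rw [h]; simp⟩
      · exact ⟨-1, by rw [h]; simp⟩
    · intro u hu v hv huv
      obtain ⟨n, hn⟩ := (hper _).1 (huniq u v huv)
      rw [zsmul_eq_mul] at hn
      have h5 : |v - u| < |L| := by
        rw [abs_lt]; constructor <;> linarith [hu.1, hu.2, hv.1, hv.2]
      rw [← hn, abs_mul] at h5
      have h6 : |(n : ℝ)| < 1 := by
        by_contra h; push Not at h
        nlinarith [abs_nonneg L]
      have h7 : n = 0 := by
        rw [← Int.cast_abs] at h6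
        have : |n| < 1 := by exact_mod_cast h6
        exact Int.abs_lt_one_iff.1 this
      rw [h7] at hn
      simp at hn
      linarith

/-- The curves are the orbits of the extended tangent field. Orbits through boundary points stay on
the boundary and are relatively open in it; being disjoint or equal, they are finite in number by
compactness, and also closed, hence compact. A compact orbit that is locally onto itself is a closed
curve. -/
theorem exists_boundaryParam (hG : IsSmoothSet G) (hη : IsTubularRadius G η) :
    ∃ (ι : Type) (_ : Fintype ι) (L : ι → ℝ) (c : ι → ℝ → Plane), IsBoundaryParam G L c ∧
      ∀ i s, ‖deriv (c i) s‖ = 1 := by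
  obtain ⟨X, χ, hX, hXc, hXχ, hXG⟩ := exists_tangent_field hG hη
  obtain ⟨K, hK⟩ := ContDiff.lipschitzWith_of_hasCompactSupport hXc hX (by simp)
  obtain ⟨C, hC⟩ := hXc.exists_bound_of_continuous hX.continuous
  choose c hc0 hc using exists_global_solution (C := C.toNNReal) hK
    fun x => (hC x).trans (Real.le_coe_toNNReal C)
  have hcont : ∀ p, Continuous (c p) := fun p =>
    continuous_iff_continuousAt.2 fun t => (hc p t).continuousAt
  have hsm : ∀ p, ContDiff ℝ ∞ (c p) := fun p => contDiff_of_hasDerivAt_comp hX (hc p)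
  -- The set of times spent on the boundary is clopen: inside the tube the signed distance is
  -- constant along the flow, since the field is orthogonal to its gradient.
  have hmem : ∀ p ∈ frontier G, ∀ s, c p s ∈ frontier G := by
    intro p hp
    have hcl : IsClopen {s | c p s ∈ frontier G} := by
      refine ⟨isClosed_frontier.preimage (hcont p), ?_⟩
      rw [isOpen_iff_mem_nhds]
      intro s₀ hs₀
      have h1 : {s | c p s ∈ thickening η (frontier G)} ∈ 𝓝 s₀ :=
        (hcont p).continuousAt.preimage_mem_nhds
          (isOpen_thickening.mem_nhds (mem_thickening_of_mem_frontier hη.pos hs₀))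
      obtain ⟨ε, hε, hball⟩ := Metric.mem_nhds_iff.1 h1
      refine mem_of_superset (ball_mem_nhds s₀ hε) fun s hs => ?_
      have hder : ∀ u ∈ ball s₀ ε, HasDerivWithinAt (fun u => signedDistFrom G (c p u)) 0
          (ball s₀ ε) u := by
        intro u hu
        have h2 := (hη.hasGradientAt (hball hu)).hasFDerivAt.comp_hasDerivAt u (hc p u)
        rw [InnerProductSpace.toDual_apply_apply, hXχ, inner_smul_right, unitTangent,
          inner_rot_self, mul_zero] at h2
        exact h2.hasDerivWithinAt
      have h3 := (convex_ball s₀ ε).norm_image_sub_le_of_norm_hasDerivWithin_le (C := 0) hder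
        (fun u _ => by simp) (mem_ball_self hε) hs
      rw [zero_mul, norm_le_zero_iff, signedDistFrom_of_mem_frontier hs₀, sub_zero] at h3
      exact mem_frontier_of_signedDistFrom_eq_zero ⟨p, hp⟩ h3
    have h4 := hcl.eq_univ ⟨0, by rw [mem_ofPred_eq, hc0]; exact hp⟩
    intro s
    have : s ∈ {s | c p s ∈ frontier G} := by rw [h4]; trivial
    exact this
  have hd : ∀ p ∈ frontier G, ∀ s, HasDerivAt (c p) (unitTangent G (c p s)) s := by
    intro p hp s
    rw [← hXG _ (hmem p hp s)]; exact hc p s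
  have hshift : ∀ p q s u, c p s = c q u → ∀ v, c p (s + v) = c q (u + v) := by
    intro p q s u hsu
    have := ODE_solution_unique_univ (v := fun _ => X) (s := fun _ => univ) (K := K) (t₀ := 0)
      (f := fun v => c p (s + v)) (g := fun v => c q (u + v)) (fun _ => hK.lipschitzOnWith)
      (fun v => ⟨(hc p (s + v)).comp_const_add s v, trivial⟩)
      (fun v => ⟨(hc q (u + v)).comp_const_add u v, trivial⟩) (by simpa using hsu)
    exact fun v => congrFun this v
  have hrange : ∀ p q s u, c p s = c q u → range (c p) = range (c q) := by
    have : ∀ p q s u, c p s = c q u → range (c p) ⊆ range (c q) := by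
      rintro p q s u h _ ⟨v, rfl⟩
      exact ⟨u + (v - s), by rw [← hshift p q s u h]; simp⟩
    exact fun p q s u h => (this p q s u h).antisymm (this q p u s h.symm)
  have hloc : ∀ p ∈ frontier G, ∀ s, 𝓝[frontier G] (c p s) ≤ map (c p) (𝓝 s) := fun p hp =>
    nhdsWithin_frontier_le_map hG hη (hsm p) (hmem p hp) (hd p hp)
  have hrmem : ∀ p ∈ frontier G, range (c p) ∈ 𝓝[frontier G] p := by
    intro p hp
    have := hloc p hp 0
    rw [hc0] at this
    exact this range_mem_map
  set 𝒪 : Set (Set Plane) := (fun p => range (c p)) '' frontier G with h𝒪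
  have hfin : 𝒪.Finite := by
    obtain ⟨t, htG, ht⟩ := hG.isCompact_frontier.elim_nhdsWithin_subcover (fun p => range (c p))
      hrmem
    refine (t.finite_toSet.image fun p => range (c p)).subset ?_
    rintro _ ⟨p, hp, rfl⟩
    have h1 := ht hp
    simp only [mem_iUnion] at h1
    obtain ⟨q, hq, u, hu⟩ := h1
    exact ⟨q, hq, hrange q p u 0 (by rw [hu, hc0])⟩
  have hrep : ∀ O : 𝒪, ∃ p ∈ frontier G, range (c p) = O := fun O => O.2
  choose p hpG hp using hrep
  -- The orbit of a limit point is relatively open, so it meets the given orbit and coincides with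
  -- it.
  have hcomp : ∀ p ∈ frontier G, IsCompact (range (c p)) := by
    intro p hp
    apply hG.isCompact_frontier.of_isClosed_subset
    · rw [← closure_subset_iff_isClosed]
      intro q hq
      have hqG : q ∈ frontier G := by
        rw [← isClosed_frontier.closure_eq]
        exact closure_mono (range_subset_iff.2 (hmem p hp)) hq
      obtain ⟨V, hV, hVsub⟩ := mem_nhdsWithin_iff_exists_mem_nhds_inter.1 (hrmem q hqG)
      obtain ⟨x, hxV, s, rfl⟩ := mem_closure_iff_nhds.1 hq V hV
      obtain ⟨u, hu⟩ := hVsub ⟨hxV, hmem p hp s⟩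
      rw [← hrange q p u s hu]
      exact ⟨0, hc0 q⟩
    · exact range_subset_iff.2 (hmem p hp)
  have hnorm : ∀ q ∈ frontier G, ∀ s, ‖deriv (c q) s‖ = 1 := by
    intro q hq s
    rw [(hd q hq s).deriv, unitTangent, norm_rot, hG.norm_outerNormal (hmem q hq s)]
  have hper : ∀ O : 𝒪, ∃ L, 0 < L ∧ Function.Periodic (c (p O)) L ∧ InjOn (c (p O)) (Ico 0 L) := by
    intro O
    apply exists_minimal_period (hcont _) _ (hcomp _ (hpG O))
    · exact fun s => (nhdsWithin_mono _ (range_subset_iff.2 (hmem _ (hpG O)))).trans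
        (hloc _ (hpG O) s)
    · by_contra! h
      have h1 : c (p O) = fun _ => c (p O) 0 := funext fun s => h s 0
      have h2 := hnorm _ (hpG O) 0
      rw [h1] at h2
      simp at h2
    · intro a b hab x
      have := hshift _ _ b a hab.symm (x - a)
      rw [show b + (x - a) = x + (b - a) by ring, show a + (x - a) = x by ring] at this
      exact this
  choose L hL0 hLper hLinj using hper
  refine ⟨𝒪, hfin.fintype, L, fun O => c (p O), ⟨hL0, fun O => hsm _, hLper, hLinj, ?_, ?_, ?_, ?_⟩,
    fun O => hnorm _ (hpG O)⟩
  · intro O O' hne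
    rw [hp, hp]
    rw [Set.disjoint_left]
    intro x hx hx'
    rw [← hp O] at hx
    rw [← hp O'] at hx'
    obtain ⟨s, rfl⟩ := hx
    obtain ⟨u, hu⟩ := hx'
    apply hne
    apply Subtype.ext
    rw [← hp O, ← hp O']
    exact hrange _ _ s u hu.symm
  · apply Subset.antisymm
    · exact iUnion_subset fun O => range_subset_iff.2 (hmem _ (hpG O))
    · intro q hq
      rw [mem_iUnion]
      refine ⟨⟨range (c q), q, hq, rfl⟩, ?_⟩
      rw [hp]
      exact ⟨0, hc0 q⟩
  · intro O s
    rw [hnorm _ (hpG O), one_smul, (hd _ (hpG O) s).deriv]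
  · intro O s
    rw [hnorm _ (hpG O)]; exact one_pos

end Tube

/-! ### Length of curves -/

section Curve

variable {c : ℝ → Plane}

theorem norm_sub_sub_smul_le (hc : Differentiable ℝ c) {J : Set ℝ} (hJ : Convex ℝ J) {v : Plane}
    {ε : ℝ} (hv : ∀ s ∈ J, ‖deriv c s - v‖ ≤ ε) {x y : ℝ} (hx : x ∈ J) (hy : y ∈ J) :
    ‖c x - c y - (x - y) • v‖ ≤ ε * |x - y| := by
  have h1 : ∀ s ∈ J, HasDerivWithinAt (fun s => c s - s • v) (deriv c s - v) J s := by
    intro s _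
    have := ((hc s).hasDerivAt.sub ((hasDerivAt_id s).smul_const v)).hasDerivWithinAt (s := J)
    rw [one_smul] at this
    exact this
  have h2 := hJ.norm_image_sub_le_of_norm_hasDerivWithin_le h1 hv hy hx
  rw [Real.norm_eq_abs] at h2
  have e : c x - c y - (x - y) • v = c x - x • v - (c y - y • v) := by rw [sub_smul]; abel
  rw [e]
  exact h2

/-- Where c' stays within ε of a fixed vector `v`, the curve is bi-Lipschitz with constants ‖v‖ ± ε.
This and the next lemma turn the two Lipschitz bounds into bounds on length. -/
theorem hausdorffMeasure_image_le_of_near (hc : Differentiable ℝ c) {J : Set ℝ} (hJ : Convex ℝ J)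
    {v : Plane} {ε : ℝ} (hε : 0 ≤ ε) (hv : ∀ s ∈ J, ‖deriv c s - v‖ ≤ ε) {B : Set ℝ} (hB : B ⊆ J) :
    μH[1] (c '' B) ≤ ENNReal.ofReal (‖v‖ + ε) * volume B := by
  have h1 : LipschitzOnWith (‖v‖ + ε).toNNReal c B := by
    apply LipschitzOnWith.of_dist_le_mul
    intro x hx y hy
    rw [Real.coe_toNNReal _ (by positivity), dist_eq_norm, Real.dist_eq]
    have h2 := norm_sub_sub_smul_le hc hJ hv (hB hx) (hB hy)
    have h3 := norm_add_le (c x - c y - (x - y) • v) ((x - y) • v)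
    rw [sub_add_cancel, norm_smul, Real.norm_eq_abs] at h3
    nlinarith
  have h2 := h1.hausdorffMeasure_image_le (d := 1) zero_le_one
  rw [ENNReal.rpow_one, hausdorffMeasure_real] at h2
  exact h2

theorem le_hausdorffMeasure_image_of_near (hc : Differentiable ℝ c) {J : Set ℝ} (hJ : Convex ℝ J)
    {v : Plane} {ε : ℝ} (hε : ε < ‖v‖) (hv : ∀ s ∈ J, ‖deriv c s - v‖ ≤ ε) {B : Set ℝ}
    (hB : B ⊆ J) : ENNReal.ofReal (‖v‖ - ε) * volume B ≤ μH[1] (c '' B) := by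
  have hpos : 0 < ‖v‖ - ε := by linarith
  have hlow : ∀ x ∈ B, ∀ y ∈ B, (‖v‖ - ε) * |x - y| ≤ ‖c x - c y‖ := by
    intro x hx y hy
    have h2 := norm_sub_sub_smul_le hc hJ hv (hB hx) (hB hy)
    have h3 := norm_sub_le (c x - c y) (c x - c y - (x - y) • v)
    rw [sub_sub_cancel, norm_smul, Real.norm_eq_abs] at h3
    linarith
  have hinj : InjOn c B := by
    intro x hx y hy hxy
    have := hlow x hx y hy
    rw [hxy, sub_self, norm_zero] at this
    have h3 : |x - y| ≤ 0 := by
      by_contra h; push Not at h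
      nlinarith
    exact sub_eq_zero.1 (abs_nonpos_iff.1 h3)
  have h1 : LipschitzOnWith (‖v‖ - ε)⁻¹.toNNReal (Function.invFunOn c B) (c '' B) := by
    apply LipschitzOnWith.of_dist_le_mul
    rintro _ ⟨x, hx, rfl⟩ _ ⟨y, hy, rfl⟩
    rw [hinj.leftInvOn_invFunOn hx, hinj.leftInvOn_invFunOn hy,
      Real.coe_toNNReal _ (by positivity), dist_eq_norm (c x), Real.dist_eq]
    rw [inv_mul_eq_div, le_div_iff₀ hpos, mul_comm]
    exact hlow x hx y hy
  have h2 := h1.hausdorffMeasure_image_le (d := 1) zero_le_one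
  rw [ENNReal.rpow_one, hausdorffMeasure_real, hinj.leftInvOn_invFunOn.image_image] at h2
  calc ENNReal.ofReal (‖v‖ - ε) * volume B
      ≤ ENNReal.ofReal (‖v‖ - ε) * (ENNReal.ofReal (‖v‖ - ε)⁻¹ * μH[1] (c '' B)) := by
        gcongr; exact h2
    _ = μH[1] (c '' B) := by
        rw [← mul_assoc, ← ENNReal.ofReal_mul hpos.le, mul_inv_cancel₀ hpos.ne', ENNReal.ofReal_one,
          one_mul]

/-- Uniform continuity of c' cuts the parameter interval into pieces on which c' varies by at most
ε. On each piece length and integral of the speed differ by at most 2ε times the measure of the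
piece; injectivity lets the pieces be summed, and ε tends to 0. -/
theorem hausdorffMeasure_image_curve (hc : ContDiff ℝ 1 c) (hs : ∀ s, deriv c s ≠ 0) {L : ℝ}
    (hinj : InjOn c (Ico 0 L)) {A : Set ℝ} (hA : MeasurableSet A) (hAL : A ⊆ Ico 0 L) :
    μH[1] (c '' A) = ∫⁻ s in A, ‖deriv c s‖ₑ := by
  have hcd : Differentiable ℝ c := hc.differentiable (by simp)
  have hc' : Continuous (deriv c) := hc.continuous_deriv (by simp)
  have hvol : volume A ≤ ENNReal.ofReal L := by
    refine (measure_mono hAL).trans ?_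
    rw [Real.volume_Ico, sub_zero]
  rcases A.eq_empty_or_nonempty with rfl | ⟨a₀, ha₀⟩
  · simp
  have hL0 : 0 ≤ L := (hAL ha₀).1.trans (hAL ha₀).2.le
  obtain ⟨s₁, -, hs₁⟩ := (isCompact_Icc (a := (0 : ℝ)) (b := L)).exists_isMinOn
    ⟨a₀, Ico_subset_Icc_self (hAL ha₀)⟩ hc'.norm.continuousOn
  have hm : 0 < ‖deriv c s₁‖ := norm_pos_iff.2 (hs s₁)
  -- Staying below the minimal speed keeps the lower Lipschitz constant positive on every piece.
  have key : ∀ ε : ℝ, 0 < ε → ε < ‖deriv c s₁‖ →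
      μH[1] (c '' A) ≤ (∫⁻ s in A, ‖deriv c s‖ₑ) + ENNReal.ofReal (2 * ε) * volume A ∧
      (∫⁻ s in A, ‖deriv c s‖ₑ) ≤ μH[1] (c '' A) + ENNReal.ofReal (2 * ε) * volume A := by
    intro ε hε hεm
    have huc := isCompact_Icc.uniformContinuousOn_of_continuous (hc'.continuousOn (s := Icc 0 L))
    obtain ⟨δ, hδ, hδε⟩ := Metric.uniformContinuousOn_iff.1 huc ε hε
    set I : ℕ → Set ℝ := fun k => Ico (k * δ) ((k + 1) * δ) with hI
    have hIdisj : Pairwise (Function.onFun Disjoint I) := by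
      intro j k hjk
      rw [Function.onFun, Set.disjoint_left]
      rintro x ⟨h1, h2⟩ ⟨h3, h4⟩
      apply hjk
      have h5 : (j : ℝ) < k + 1 := lt_of_mul_lt_mul_right (h1.trans_lt h4) hδ.le
      have h6 : (k : ℝ) < j + 1 := lt_of_mul_lt_mul_right (h3.trans_lt h2) hδ.le
      norm_cast at h5 h6
      omega
    have hIcov : A = ⋃ k, A ∩ I k := by
      rw [← inter_iUnion, eq_comm, inter_eq_left]
      intro x hx
      have hx0 : 0 ≤ x / δ := div_nonneg (hAL hx).1 hδ.le
      rw [mem_iUnion]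
      refine ⟨⌊x / δ⌋₊, ?_, ?_⟩
      · rw [← le_div_iff₀ hδ]; exact Nat.floor_le hx0
      · rw [← div_lt_iff₀ hδ]; exact Nat.lt_floor_add_one _
    have hAm : ∀ k, MeasurableSet (A ∩ I k) := fun k => hA.inter measurableSet_Ico
    have hAdisj : Pairwise (Function.onFun Disjoint fun k => A ∩ I k) := fun j k hjk =>
      (hIdisj hjk).mono inter_subset_right inter_subset_right
    have hH : μH[1] (c '' A) = ∑' k, μH[1] (c '' (A ∩ I k)) := by
      conv_lhs => rw [hIcov, image_iUnion]
      apply measure_iUnion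
      · intro j k hjk
        refine disjoint_image_image fun x hx y hy hxy => ?_
        exact (disjoint_left.1 (hAdisj hjk)) hx (hinj (hAL hx.1) (hAL hy.1) hxy ▸ hy)
      · exact fun k => (hAm k).image_of_continuousOn_injOn hcd.continuous.continuousOn
          (hinj.mono (inter_subset_left.trans hAL))
    have hInt : (∫⁻ s in A, ‖deriv c s‖ₑ) = ∑' k, ∫⁻ s in A ∩ I k, ‖deriv c s‖ₑ := by
      conv_lhs => rw [hIcov]
      exact lintegral_iUnion hAm hAdisj _
    have hV : volume A = ∑' k, volume (A ∩ I k) := by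
      conv_lhs => rw [hIcov]
      exact measure_iUnion hAdisj hAm
    have hpiece : ∀ k, μH[1] (c '' (A ∩ I k)) ≤
        (∫⁻ s in A ∩ I k, ‖deriv c s‖ₑ) + ENNReal.ofReal (2 * ε) * volume (A ∩ I k) ∧
        (∫⁻ s in A ∩ I k, ‖deriv c s‖ₑ) ≤
          μH[1] (c '' (A ∩ I k)) + ENNReal.ofReal (2 * ε) * volume (A ∩ I k) := by
      intro k
      rcases (A ∩ I k).eq_empty_or_nonempty with h | ⟨s₀, hs₀⟩
      · simp [h]
      have hJ : Convex ℝ (Icc 0 L ∩ I k) := (convex_Icc 0 L).inter (convex_Ico _ _)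
      have hsub : A ∩ I k ⊆ Icc 0 L ∩ I k :=
        inter_subset_inter_left _ (hAL.trans Ico_subset_Icc_self)
      have hv : ∀ s ∈ Icc 0 L ∩ I k, ‖deriv c s - deriv c s₀‖ ≤ ε := by
        intro s hs
        rw [← dist_eq_norm]
        refine (hδε s hs.1 s₀ (hsub hs₀).1 ?_).le
        rw [Real.dist_eq, abs_lt]
        have h1 := hs.2
        have h2 := hs₀.2
        simp only [hI, mem_Ico] at h1 h2
        constructor <;> linarith
      have hε' : ε < ‖deriv c s₀‖ := hεm.trans_le (hs₁ (hsub hs₀).1)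
      have hup := hausdorffMeasure_image_le_of_near hcd hJ hε.le hv hsub
      have hlo := le_hausdorffMeasure_image_of_near hcd hJ hε' hv hsub
      have hmeas : Measurable fun s => ‖deriv c s‖ₑ := hc'.enorm.measurable
      constructor
      · refine hup.trans ?_
        rw [← setLIntegral_const, ← setLIntegral_const, ← lintegral_add_left hmeas]
        apply setLIntegral_mono' (hAm k)
        intro s hs
        rw [← ofReal_norm, ← ENNReal.ofReal_add (norm_nonneg _) (by positivity)]
        apply ENNReal.ofReal_le_ofReal
        have h3 := norm_sub_norm_le (deriv c s₀) (deriv c s)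
        rw [norm_sub_rev] at h3
        linarith [hv s (hsub hs)]
      · calc ∫⁻ s in A ∩ I k, ‖deriv c s‖ₑ
            ≤ ∫⁻ _ in A ∩ I k, (ENNReal.ofReal (‖deriv c s₀‖ - ε) + ENNReal.ofReal (2 * ε)) := by
              apply setLIntegral_mono' (hAm k)
              intro s hs
              rw [← ofReal_norm, ← ENNReal.ofReal_add (by linarith) (by positivity)]
              apply ENNReal.ofReal_le_ofReal
              have h3 := norm_sub_norm_le (deriv c s) (deriv c s₀)
              linarith [hv s (hsub hs)]
          _ ≤ _ := by
              rw [setLIntegral_const, add_mul]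
              gcongr
    rw [hH, hInt, hV, ← ENNReal.tsum_mul_left, ← ENNReal.tsum_add, ← ENNReal.tsum_add]
    exact ⟨ENNReal.tsum_le_tsum fun k => (hpiece k).1, ENNReal.tsum_le_tsum fun k => (hpiece k).2⟩
  have hlim : ∀ X Y : ℝ≥0∞, (∀ ε : ℝ, 0 < ε → ε < ‖deriv c s₁‖ →
      X ≤ Y + ENNReal.ofReal (2 * ε) * volume A) → X ≤ Y := by
    intro X Y h
    have h1 : Tendsto (fun ε : ℝ => Y + ENNReal.ofReal (2 * ε) * volume A) (𝓝[>] 0) (𝓝 Y) := by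
      have h2 : Tendsto (fun ε : ℝ => ENNReal.ofReal (2 * ε)) (𝓝[>] 0) (𝓝 0) := by
        have : Continuous fun ε : ℝ => ENNReal.ofReal (2 * ε) :=
        ENNReal.continuous_ofReal.comp (continuous_const.mul continuous_id)
        have h3 := this.tendsto 0
        simp only [mul_zero, ENNReal.ofReal_zero] at h3
        exact h3.mono_left nhdsWithin_le_nhds
      have h4 := ENNReal.Tendsto.mul_const (b := volume A) h2
        (Or.inr (hvol.trans_lt ENNReal.ofReal_lt_top).ne)
      rw [zero_mul] at h4
      simpa using h4.const_add Y
    refine ge_of_tendsto h1 ?_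
    filter_upwards [Ioo_mem_nhdsGT hm] with ε hε
    exact h ε hε.1 hε.2
  exact le_antisymm (hlim _ _ fun ε h1 h2 => (key ε h1 h2).1)
    (hlim _ _ fun ε h1 h2 => (key ε h1 h2).2)

theorem measurableEmbedding_curve (hc : Continuous c) {L : ℝ} (hinj : InjOn c (Ico 0 L)) :
    MeasurableEmbedding ((Ico 0 L).domRestrict c) :=
  hc.continuousOn.measurableEmbedding measurableSet_Ico hinj

/-- The area formula as an identity of measures. As the curve is a measurable embedding of [0, L),
integrals of arbitrary functions transfer to the parameter interval without any measurability
assumption. -/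
theorem comap_hausdorffMeasure_curve (hc : ContDiff ℝ 1 c) (hs : ∀ s, deriv c s ≠ 0) {L : ℝ}
    (hinj : InjOn c (Ico 0 L)) :
    Measure.comap ((Ico 0 L).domRestrict c) μH[1] =
      (Measure.comap Subtype.val volume).withDensity fun s : Ico (0 : ℝ) L => ‖deriv c s‖ₑ := by
  ext A hA
  have hm : Measurable fun s : ℝ => ‖deriv c s‖ₑ :=
    (hc.continuous_deriv (by simp)).enorm.measurable
  have hA' : MeasurableSet (Subtype.val '' A) := MeasurableSet.subtype_image measurableSet_Ico hA
  rw [(measurableEmbedding_curve hc.continuous hinj).comap_apply, withDensity_apply _ hA,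
    show (Ico 0 L).domRestrict c '' A = c '' (Subtype.val '' A) by rw [image_image]; rfl,
    hausdorffMeasure_image_curve hc hs hinj hA' (by rintro _ ⟨x, -, rfl⟩; exact x.2)]
  have h1 := (MeasurableEmbedding.subtype_coe (measurableSet_Ico (a := (0 : ℝ)) (b := L))).map_comap
    volume
  rw [Subtype.range_coe] at h1
  have h2 : (volume.restrict (Ico 0 L)).restrict (Subtype.val '' A) =
      volume.restrict (Subtype.val '' A) := by
    rw [Measure.restrict_restrict hA', inter_eq_left.2]
    rintro _ ⟨x, -, rfl⟩; exact x.2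
  rw [← h2, ← h1, (MeasurableEmbedding.subtype_coe measurableSet_Ico).restrict_map,
    preimage_image_eq _ Subtype.val_injective,
    (MeasurableEmbedding.subtype_coe measurableSet_Ico).lintegral_map]

theorem restrict_hausdorffMeasure_curve (hc : ContDiff ℝ 1 c) (hs : ∀ s, deriv c s ≠ 0) {L : ℝ}
    (hinj : InjOn c (Ico 0 L)) :
    μH[1].restrict (c '' Ico 0 L) = Measure.map ((Ico 0 L).domRestrict c)
      ((Measure.comap Subtype.val volume).withDensity fun s : Ico (0 : ℝ) L => ‖deriv c s‖ₑ) := by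
  rw [← comap_hausdorffMeasure_curve hc hs hinj,
    (measurableEmbedding_curve hc.continuous hinj).map_comap, range_domRestrict]

theorem lintegral_image_curve (hc : ContDiff ℝ 1 c) (hs : ∀ s, deriv c s ≠ 0) {L : ℝ}
    (hinj : InjOn c (Ico 0 L)) (u : Plane → ℝ≥0∞) :
    ∫⁻ x in c '' Ico 0 L, u x ∂μH[1] = ∫⁻ s in Ico 0 L, ‖deriv c s‖ₑ * u (c s) := by
  have hm : Measurable fun s : ℝ => ‖deriv c s‖ₑ :=
    (hc.continuous_deriv (by simp)).enorm.measurable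
  have hms : Measurable fun s : Ico (0 : ℝ) L => ‖deriv c s‖ₑ := hm.comp measurable_subtype_coe
  rw [restrict_hausdorffMeasure_curve hc hs hinj,
    (measurableEmbedding_curve hc.continuous hinj).lintegral_map,
    lintegral_withDensity_eq_lintegral_mul_non_measurable _ hms
      (ae_of_all _ fun s => enorm_lt_top)]
  exact lintegral_subtype_comap measurableSet_Ico fun s => ‖deriv c s‖ₑ * u (c s)

theorem setIntegral_image_curve (hc : ContDiff ℝ 1 c) (hs : ∀ s, deriv c s ≠ 0) {L : ℝ}
    (hinj : InjOn c (Ico 0 L)) (u : Plane → ℝ) :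
    ∫ x in c '' Ico 0 L, u x ∂μH[1] = ∫ s in Ico 0 L, ‖deriv c s‖ * u (c s) := by
  have hm : Measurable fun s : ℝ => ‖deriv c s‖ₑ :=
    (hc.continuous_deriv (by simp)).enorm.measurable
  have hms : Measurable fun s : Ico (0 : ℝ) L => ‖deriv c s‖ₑ := hm.comp measurable_subtype_coe
  rw [restrict_hausdorffMeasure_curve hc hs hinj,
    (measurableEmbedding_curve hc.continuous hinj).integral_map,
    integral_withDensity_eq_integral_toReal_smul hms
      (ae_of_all _ fun s => enorm_lt_top),
    ← integral_subtype_comap measurableSet_Ico fun s => ‖deriv c s‖ * u (c s)]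
  simp [Set.domRestrict]

theorem integrableOn_image_curve (hc : ContDiff ℝ 1 c) (hs : ∀ s, deriv c s ≠ 0) {L : ℝ}
    (hinj : InjOn c (Ico 0 L)) {u : Plane → ℝ} (hu : Continuous fun s => u (c s)) :
    IntegrableOn u (c '' Ico 0 L) μH[1] := by
  have hm : Measurable fun s : ℝ => ‖deriv c s‖ₑ :=
    (hc.continuous_deriv (by simp)).enorm.measurable
  have hms : Measurable fun s : Ico (0 : ℝ) L => ‖deriv c s‖ₑ := hm.comp measurable_subtype_coe
  rw [IntegrableOn, restrict_hausdorffMeasure_curve hc hs hinj,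
    (measurableEmbedding_curve hc.continuous hinj).integrable_map_iff,
    integrable_withDensity_iff_integrable_smul' hms
      (ae_of_all _ fun s => enorm_lt_top)]
  have h1 : IntegrableOn (fun s => ‖deriv c s‖ * u (c s)) (Ico 0 L) volume :=
    (((hc.continuous_deriv (by simp)).norm.mul hu).integrableOn_Icc (a := 0) (b := L)).mono_set
      Ico_subset_Icc_self
  have h2 := (measurePreserving_subtype_coe (μa := (volume : Measure ℝ))
    (measurableSet_Ico (a := (0 : ℝ)) (b := L))).integrable_comp_emb
      (MeasurableEmbedding.subtype_coe measurableSet_Ico)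
      (g := fun s => ‖deriv c s‖ * u (c s))
  have h3 := h2.2 h1
  refine h3.congr (ae_of_all _ fun s => ?_)
  simp [Set.domRestrict]

end Curve

/-! ### Integration and tangential derivatives in terms of boundary curves -/

section Param

theorem outerNormal_eq_neg_rot (F : Set Plane) (x : Plane) :
    outerNormal F x = -rot (unitTangent F x) := by
  rw [unitTangent, rot_rot, neg_neg]

variable {F : Set Plane} {ι : Type} {L : ι → ℝ} {c : ι → ℝ → Plane}

namespace IsBoundaryParam

theorem deriv_ne_zero (hP : IsBoundaryParam F L c) (i : ι) (s : ℝ) : deriv (c i) s ≠ 0 :=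
  norm_pos_iff.1 (hP.speed_pos i s)

theorem mem_frontier (hP : IsBoundaryParam F L c) (i : ι) (s : ℝ) : c i s ∈ frontier F := by
  rw [← hP.iUnion_range, mem_iUnion]; exact ⟨i, s, rfl⟩

theorem exists_eq (hP : IsBoundaryParam F L c) {x : Plane} (hx : x ∈ frontier F) :
    ∃ i s, c i s = x := by
  rw [← hP.iUnion_range, mem_iUnion] at hx; exact hx

theorem continuous (hP : IsBoundaryParam F L c) (i : ι) : Continuous (c i) :=
  (hP.smooth i).continuous

theorem differentiable (hP : IsBoundaryParam F L c) (i : ι) : Differentiable ℝ (c i) :=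
  (hP.smooth i).differentiable (by simp)

theorem contDiff_one (hP : IsBoundaryParam F L c) (i : ι) : ContDiff ℝ 1 (c i) :=
  (hP.smooth i).of_le (by simp)

theorem image_Ico (hP : IsBoundaryParam F L c) (i : ι) : c i '' Ico 0 (L i) = range (c i) := by
  refine (image_subset_range _ _).antisymm ?_
  rintro _ ⟨v, rfl⟩
  refine ⟨toIcoMod (hP.period_pos i) 0 v, toIcoMod_mem_Ico' _ _, ?_⟩
  conv_rhs => rw [← toIcoMod_add_toIcoDiv_zsmul (hP.period_pos i) 0 v]
  exact (((hP.periodic i).zsmul _) _).symm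

theorem frontier_eq (hP : IsBoundaryParam F L c) : frontier F = ⋃ i, c i '' Ico 0 (L i) := by
  simp_rw [hP.image_Ico, hP.iUnion_range]

theorem index_eq (hP : IsBoundaryParam F L c) {i j : ι} {s u : ℝ} (h : c i s = c j u) : i = j := by
  by_contra hij
  exact (disjoint_left.1 (hP.disjoint hij)) ⟨s, rfl⟩ ⟨u, h.symm⟩

theorem exists_zsmul_of_eq (hP : IsBoundaryParam F L c) {i : ι} {s u : ℝ} (h : c i s = c i u) :
    ∃ n : ℤ, u = s + n * L i := by
  have hL := hP.period_pos i
  have hmod : ∀ v, c i (toIcoMod hL 0 v) = c i v := by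
    intro v
    conv_rhs => rw [← toIcoMod_add_toIcoDiv_zsmul hL 0 v]
    exact (((hP.periodic i).zsmul _) _).symm
  have h1 := hP.injOn i (toIcoMod_mem_Ico' hL s) (toIcoMod_mem_Ico' hL u)
    (by rw [hmod, hmod, h])
  refine ⟨toIcoDiv hL 0 u - toIcoDiv hL 0 s, ?_⟩
  have h2 := toIcoMod_add_toIcoDiv_zsmul hL 0 u
  have h3 := toIcoMod_add_toIcoDiv_zsmul hL 0 s
  rw [zsmul_eq_mul] at h2 h3
  push_cast
  linarith

/-- A function on the boundary can be prescribed on each of the closed curves. -/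
theorem exists_function (hP : IsBoundaryParam F L c) {u : ι → ℝ → ℝ}
    (hu : ∀ i, Function.Periodic (u i) (L i)) : ∃ w : Plane → ℝ, ∀ i s, w (c i s) = u i s := by
  classical
  have h : ∀ x : Plane, ∃ y : ℝ, ∀ i s, c i s = x → u i s = y := by
    intro x
    by_cases hx : ∃ i s, c i s = x
    · obtain ⟨i, s, rfl⟩ := hx
      refine ⟨u i s, fun j v hj => ?_⟩
      obtain rfl := hP.index_eq hj
      obtain ⟨n, hn⟩ := hP.exists_zsmul_of_eq hj
      have h1 := (hu j).int_mul n v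
      rw [← hn] at h1
      exact h1.symm
    · exact ⟨0, fun i s h => (hx ⟨i, s, h⟩).elim⟩
  choose w hw using h
  exact ⟨w, fun i s => (hw _ i s rfl).symm⟩

theorem lintegral_eq [Fintype ι] (hP : IsBoundaryParam F L c) (u : Plane → ℝ≥0∞) :
    ∫⁻ x in frontier F, u x ∂μH[1] =
      ∑ i, ∫⁻ s in Ico 0 (L i), ‖deriv (c i) s‖ₑ * u (c i s) := by
  rw [hP.frontier_eq, lintegral_iUnion, tsum_fintype]
  · exact Finset.sum_congr rfl fun i _ =>
      lintegral_image_curve (hP.contDiff_one i) (hP.deriv_ne_zero i) (hP.injOn i) u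
  · exact fun i => measurableSet_Ico.image_of_continuousOn_injOn (hP.continuous i).continuousOn
      (hP.injOn i)
  · intro i j hij
    rw [Function.onFun, hP.image_Ico, hP.image_Ico]
    exact hP.disjoint hij

theorem integrableOn [Fintype ι] (hP : IsBoundaryParam F L c) {u : Plane → ℝ}
    (hu : ∀ i, Continuous fun s => u (c i s)) : IntegrableOn u (frontier F) μH[1] := by
  rw [hP.frontier_eq, integrableOn_finite_iUnion]
  exact fun i => integrableOn_image_curve (hP.contDiff_one i) (hP.deriv_ne_zero i) (hP.injOn i)
    (hu i)

theorem bdryIntegral_eq [Fintype ι] (hP : IsBoundaryParam F L c) {u : Plane → ℝ}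
    (hu : ∀ i, Continuous fun s => u (c i s)) :
    bdryIntegral F u = ∑ i, ∫ s in (0)..(L i), ‖deriv (c i) s‖ * u (c i s) := by
  have h1 := hP.integrableOn hu
  rw [hP.frontier_eq, integrableOn_finite_iUnion] at h1
  rw [bdryIntegral, hP.frontier_eq, integral_iUnion_fintype _ _ h1]
  · refine Finset.sum_congr rfl fun i _ => ?_
    rw [setIntegral_image_curve (hP.contDiff_one i) (hP.deriv_ne_zero i) (hP.injOn i) u,
      intervalIntegral.integral_of_le (hP.period_pos i).le, integral_Ico_eq_integral_Ioc]
  · exact fun i => measurableSet_Ico.image_of_continuousOn_injOn (hP.continuous i).continuousOn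
      (hP.injOn i)
  · intro i j hij
    rw [Function.onFun, hP.image_Ico, hP.image_Ico]
    exact hP.disjoint hij

theorem perimeter_eq [Fintype ι] (hP : IsBoundaryParam F L c) :
    perimeter F = ∑ i, ∫ s in (0)..(L i), ‖deriv (c i) s‖ := by
  have h1 := hP.bdryIntegral_eq (u := fun _ => 1) fun i => continuous_const
  simp only [mul_one] at h1
  rw [← h1, bdryIntegral, perimeter, setIntegral_const, smul_eq_mul, mul_one]
  rfl

/-- Each of the closed curves is locally onto the boundary. -/
theorem nhdsWithin_le_map [Fintype ι] (hP : IsBoundaryParam F L c) (i : ι) (s : ℝ) :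
    𝓝[frontier F] (c i s) ≤ map (c i) (𝓝 s) := by
  classical
  intro V hV
  rw [mem_map] at hV
  obtain ⟨ε, hε, hball⟩ := Metric.mem_nhds_iff.1 hV
  have hL := hP.period_pos i
  set δ := min ε (L i / 3) with hδ
  have hδ0 : 0 < δ := by positivity
  have hδε : δ ≤ ε := min_le_left _ _
  have hδL : δ ≤ L i / 3 := min_le_right _ _
  -- The part of the boundary to be avoided: all other curves, and the points of this curve whose
  -- parameter stays at least δ away from `s` modulo the period. It is compact and omits the given
  -- point.
  set K : Set Plane := (⋃ j ∈ (Finset.univ.erase i : Finset ι), range (c j)) ∪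
    c i '' Icc (s + δ) (s + L i - δ) with hK
  have hKc : IsClosed K := by
    apply IsClosed.union
    · exact (Finset.univ.erase i).finite_toSet.isClosed_biUnion fun j _ =>
        ((hP.periodic j).compact_of_continuous (hP.period_pos j).ne' (hP.continuous j)).isClosed
    · exact (isCompact_Icc.image (hP.continuous i)).isClosed
  have hsK : c i s ∉ K := by
    rintro (h | ⟨u, hu, hus⟩)
    · simp only [mem_iUnion] at h
      obtain ⟨j, hj, u, hu⟩ := h
      exact (Finset.ne_of_mem_erase hj) (hP.index_eq hu)
    · obtain ⟨n, hn⟩ := hP.exists_zsmul_of_eq hus.symm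
      have h1 : (0 : ℝ) < n * L i := by linarith [hu.1]
      have h2 : (n : ℝ) * L i < 1 * L i := by linarith [hu.2]
      have h3 : (0 : ℝ) < n := pos_of_mul_pos_left h1 hL.le
      have h4 : (n : ℝ) < 1 := lt_of_mul_lt_mul_right h2 hL.le
      norm_cast at h3 h4
      omega
  rw [mem_nhdsWithin_iff_exists_mem_nhds_inter]
  refine ⟨Kᶜ, hKc.isOpen_compl.mem_nhds hsK, ?_⟩
  rintro x ⟨hxK, hxF⟩
  obtain ⟨j, u, rfl⟩ := hP.exists_eq hxF
  have hji : j = i := by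
    by_contra hne
    exact hxK (Or.inl (mem_biUnion (Finset.mem_coe.2 (Finset.mem_erase.2 ⟨hne, Finset.mem_univ j⟩))
      ⟨u, rfl⟩))
  subst hji
  have h1 := toIocMod_mem_Ioc hL (s - δ) u
  have h2 : c j (toIocMod hL (s - δ) u) = c j u := by
    conv_rhs => rw [← toIocMod_add_toIocDiv_zsmul hL (s - δ) u]
    exact (((hP.periodic j).zsmul _) _).symm
  rw [← h2] at hxK ⊢
  apply hball
  rw [mem_ball, Real.dist_eq, abs_lt]
  have h3 : toIocMod hL (s - δ) u < s + δ := by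
    by_contra! h
    exact hxK (Or.inr ⟨_, ⟨h, by linarith [h1.2]⟩, rfl⟩)
  constructor <;> linarith [h1.1]

variable {V : Type*} [NormedAddCommGroup V] [NormedSpace ℝ V]

/-- A function on the boundary is differentiable along the boundary if it is differentiable along
the closed curves. -/
theorem differentiableWithinAt [Fintype ι] (hP : IsBoundaryParam F L c) {u : Plane → V} {i : ι}
    {s : ℝ} (hu : DifferentiableAt ℝ (fun s => u (c i s)) s) :
    DifferentiableWithinAt ℝ u (frontier F) (c i s) := by
  set e := deriv (c i) s with he
  -- The linear function ⟨e, ·⟩ is invertible along the curve near this point, so the parameter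
  -- extends to a differentiable function in the plane, and `u` agrees on the boundary with a
  -- function differentiable in the plane.
  set φ : ℝ → ℝ := fun v => inner ℝ e (c i v) with hφ
  have hst : HasStrictDerivAt (c i) e s :=
    (hP.smooth i).contDiffAt.hasStrictDerivAt (by simp)
  have hφd : HasStrictDerivAt φ (inner ℝ e e) s :=
    (innerSL ℝ e).hasStrictFDerivAt.comp_hasStrictDerivAt s hst
  have hne : inner ℝ e e ≠ 0 := by
    rw [real_inner_self_eq_norm_sq]; exact pow_ne_zero 2 (hP.speed_pos i s).ne'
  set g := hφd.localInverse φ _ s hne with hg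
  have hgd : HasDerivAt g (inner ℝ e e)⁻¹ (φ s) := (hφd.to_localInverse hne).hasDerivAt
  have hleft : ∀ᶠ v in 𝓝 s, g (φ v) = v := hφd.eventually_left_inverse hne
  have hσ : DifferentiableAt ℝ (fun x => g (inner ℝ e x)) (c i s) :=
    DifferentiableAt.comp (c i s) hgd.differentiableAt
      ((innerSL ℝ e).differentiableAt (x := c i s))
  have hgs : g (inner ℝ e (c i s)) = s := hleft.self_of_nhds
  have h1 : DifferentiableAt ℝ (fun x => u (c i (g (inner ℝ e x)))) (c i s) :=
    DifferentiableAt.comp (g := fun v => u (c i v)) (c i s) (by rw [hgs]; exact hu) hσ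
  have hev : (fun x => u (c i (g (inner ℝ e x)))) =ᶠ[𝓝[frontier F] (c i s)] u := by
    apply hP.nhdsWithin_le_map i s
    rw [mem_map]
    filter_upwards [hleft] with v hv
    change u (c i (g (φ v))) = u (c i v)
    rw [hv]
  exact h1.differentiableWithinAt.congr_of_eventuallyEq hev.symm (by rw [hgs])

/-- Chain rule along the curve. Whichever derivative within the boundary `fderivWithin` selects, its
value on the velocity of the curve is the derivative of the composition. -/
theorem tderiv_eq [Fintype ι] (hP : IsBoundaryParam F L c) {u : Plane → V} {i : ι}
    {s : ℝ} (hu : DifferentiableAt ℝ (fun s => u (c i s)) s) :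
    tderiv F u (c i s) = ‖deriv (c i) s‖⁻¹ • deriv (fun s => u (c i s)) s := by
  have h1 := (hP.differentiableWithinAt hu).hasFDerivWithinAt.comp_hasDerivAt s
    ((hP.differentiable i s).hasDerivAt) (Eventually.of_forall fun v => hP.mem_frontier i v)
  have h2 := hu.hasDerivAt.unique h1
  rw [h2, tderiv, congrArg (fderivWithin ℝ u (frontier F) (c i s)) (hP.deriv_eq i s), map_smul,
    smul_smul, inv_mul_cancel₀ (hP.speed_pos i s).ne', one_smul]

theorem unitTangent_eq (hP : IsBoundaryParam F L c) (i : ι) (s : ℝ) :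
    unitTangent F (c i s) = ‖deriv (c i) s‖⁻¹ • deriv (c i) s := by
  conv_rhs => rw [hP.deriv_eq i s]
  rw [norm_smul, norm_norm, smul_smul]
  have h1 : ‖unitTangent F (c i s)‖ = 1 := by
    have h2 := congrArg norm (hP.deriv_eq i s)
    rw [norm_smul, norm_norm] at h2
    exact (mul_eq_left₀ (hP.speed_pos i s).ne').1 h2.symm
  rw [h1, mul_one, inv_mul_cancel₀ (hP.speed_pos i s).ne', one_smul]

end IsBoundaryParam

end Param

/-! ### Fermi coordinates -/

/-- The curvature of `∂G` along a unit speed parametrization `γ`. -/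
def curvatureAlong (G : Set Plane) (γ : ℝ → Plane) (s : ℝ) : ℝ :=
  inner ℝ (deriv (fun s => outerNormal G (γ s)) s) (deriv γ s)

section Fermi

variable {G : Set Plane} {η : ℝ} {ι : Type} {L : ι → ℝ} {γ : ι → ℝ → Plane}

theorem IsBoundaryParam.contDiff_normal (hη : IsTubularRadius G η) (hP : IsBoundaryParam G L γ)
    (i : ι) : ContDiff ℝ ∞ fun s => outerNormal G (γ i s) :=
  contDiff_iff_contDiffAt.2 fun s => ContDiffAt.comp s (hη.contDiffAt_outerNormal
    (mem_thickening_of_mem_frontier hη.pos (hP.mem_frontier i s))) (hP.smooth i).contDiffAt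

theorem IsBoundaryParam.contDiff_curvatureAlong (hη : IsTubularRadius G η)
    (hP : IsBoundaryParam G L γ) (i : ι) : ContDiff ℝ ∞ (curvatureAlong G (γ i)) :=
  ((contDiff_infty_iff_deriv.1 (hP.contDiff_normal hη i)).2).inner ℝ
    (contDiff_infty_iff_deriv.1 (hP.smooth i)).2

theorem IsBoundaryParam.rot_normal (hP : IsBoundaryParam G L γ) (hγ : ∀ i s, ‖deriv (γ i) s‖ = 1)
    (i : ι) (s : ℝ) : rot (outerNormal G (γ i s)) = deriv (γ i) s := by
  have := hP.deriv_eq i s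
  rw [hγ, one_smul] at this
  exact this.symm

theorem IsBoundaryParam.norm_normal (hG : IsSmoothSet G) (hP : IsBoundaryParam G L γ)
    (i : ι) (s : ℝ) : ‖outerNormal G (γ i s)‖ = 1 :=
  hG.norm_outerNormal (hP.mem_frontier i s)

theorem IsBoundaryParam.hasDerivAt_normal (hG : IsSmoothSet G) (hη : IsTubularRadius G η)
    (hP : IsBoundaryParam G L γ) (hγ : ∀ i s, ‖deriv (γ i) s‖ = 1) (i : ι) (s : ℝ) :
    HasDerivAt (fun s => outerNormal G (γ i s)) (curvatureAlong G (γ i) s • deriv (γ i) s) s := by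
  have h1 := (((hP.contDiff_normal hη i).differentiable (by simp)) s).hasDerivAt
  refine h1.congr_deriv ?_
  set ν := outerNormal G (γ i s) with hν
  set w := deriv (fun s => outerNormal G (γ i s)) s with hw
  have h2 : inner ℝ w ν = 0 := by
    have h3 := h1.norm_sq
    have h4 : (fun s => ‖outerNormal G (γ i s)‖ ^ 2) = fun _ => (1 : ℝ) := by
      funext v; rw [hP.norm_normal hG]; norm_num
    rw [h4] at h3
    have h5 := h3.unique (hasDerivAt_const s (1 : ℝ))
    rw [real_inner_comm]; linarith
  have h6 := frame_expansion (hP.norm_normal hG i s) w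
  rw [h2, zero_smul, zero_add, hP.rot_normal hγ] at h6
  exact h6

/-- The point with Fermi coordinates `(s, r)`. -/
def fermi (G : Set Plane) (γ : ℝ → Plane) (s r : ℝ) : Plane := γ s + r • outerNormal G (γ s)

theorem fermi_mem (hG : IsSmoothSet G) (hP : IsBoundaryParam G L γ)
    {i : ι} {s r : ℝ} (hr : |r| < η) : fermi G (γ i) s r ∈ thickening η (frontier G) :=
  ray_mem_thickening hG (hP.mem_frontier i s) hr

theorem nearestPt_fermi (hG : IsSmoothSet G) (hη : IsTubularRadius G η)
    (hP : IsBoundaryParam G L γ) {i : ι} {s r : ℝ} (hr : |r| < η) :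
    nearestPt (frontier G) (fermi G (γ i) s r) = γ i s :=
  hη.nearestPt_ray hG (hP.mem_frontier i s) hr

theorem signedDistFrom_fermi (hG : IsSmoothSet G) (hη : IsTubularRadius G η)
    (hP : IsBoundaryParam G L γ) {i : ι} {s r : ℝ} (hr : |r| < η) :
    signedDistFrom G (fermi G (γ i) s r) = r :=
  (hη.ray hG (hP.mem_frontier i s) hr).2

theorem hasDerivAt_fermi (hG : IsSmoothSet G) (hη : IsTubularRadius G η)
    (hP : IsBoundaryParam G L γ) (hγ : ∀ i s, ‖deriv (γ i) s‖ = 1) (i : ι) (s : ℝ)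
    {r : ℝ → ℝ} {r' : ℝ} (hr : HasDerivAt r r' s) :
    HasDerivAt (fun s => fermi G (γ i) s (r s))
      ((1 + r s * curvatureAlong G (γ i) s) • deriv (γ i) s + r' • outerNormal G (γ i s)) s := by
  have h1 := ((hP.differentiable i s).hasDerivAt).add (hr.smul (hP.hasDerivAt_normal hG hη hγ i s))
  refine h1.congr_deriv ?_
  rw [smul_smul, add_smul, one_smul]; abel

/-- The parallel curve at height r has velocity (1 + rκ)γ', and the smooth projection π_G maps it
back onto γ, whose velocity is nonzero; so the factor does not vanish for |r| < η. It is affine in r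
and equals 1 at r = 0, hence it keeps its sign. -/
theorem one_add_mul_curvatureAlong_pos (hG : IsSmoothSet G) (hη : IsTubularRadius G η)
    (hP : IsBoundaryParam G L γ) (hγ : ∀ i s, ‖deriv (γ i) s‖ = 1) (i : ι) (s : ℝ) {r : ℝ}
    (hr : |r| < η) : 0 < 1 + r * curvatureAlong G (γ i) s := by
  set k := curvatureAlong G (γ i) s with hk
  have hne : ∀ r, |r| < η → 1 + r * k ≠ 0 := by
    intro r hr h0
    have h1 := hasDerivAt_fermi hG hη hP hγ i s (hasDerivAt_const s r)
    rw [← hk, h0, zero_smul, zero_smul, add_zero] at h1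
    have h2 := ((hη.contDiffAt_proj (fermi_mem hG hP hr)).differentiableAt
      (by simp)).hasFDerivAt.comp_hasDerivAt s h1
    rw [map_zero] at h2
    have h3 : (nearestPt (frontier G) ∘ fun s => fermi G (γ i) s r) = γ i :=
      funext fun v => nearestPt_fermi hG hη hP hr
    rw [h3] at h2
    exact hP.deriv_ne_zero i s h2.deriv
  by_contra! hneg
  have hk0 : k ≠ 0 := by rintro h; rw [h] at hneg; simp at hneg; linarith
  have h1 : |-1 / k| ≤ |r| := by
    rw [abs_div, abs_neg, abs_one, div_le_iff₀ (abs_pos.2 hk0), ← abs_mul]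
    exact le_trans (by linarith) (neg_le_abs _)
  exact hne (-1 / k) (h1.trans_lt hr) (by field_simp; ring)

/-- Minimality of the distance along the boundary curve makes x - π_G(x) orthogonal to the tangent,
so it is a multiple of the normal, and the ray lemma identifies the coefficient with the signed
distance. -/
theorem IsTubularRadius.eq_ray (hG : IsSmoothSet G) (hη : IsTubularRadius G η)
    (hP : IsBoundaryParam G L γ) (hγ : ∀ i s, ‖deriv (γ i) s‖ = 1) {x : Plane}
    (hx : x ∈ thickening η (frontier G)) :
    x = nearestPt (frontier G) x +
      signedDistFrom G x • outerNormal G (nearestPt (frontier G) x) := by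
  obtain ⟨hq, hxq⟩ := hη.nearestPt_spec hx
  set q := nearestPt (frontier G) x with hqdef
  obtain ⟨i, s, hs⟩ := hP.exists_eq hq
  have hperp : inner ℝ (x - q) (deriv (γ i) s) = 0 := by
    have h1 : HasDerivAt (fun v => ‖x - γ i v‖ ^ 2) (2 * inner ℝ (x - γ i s) (-deriv (γ i) s)) s :=
      ((hP.differentiable i s).hasDerivAt.const_sub x).norm_sq
    have h2 : IsLocalMin (fun v => ‖x - γ i v‖ ^ 2) s := by
      refine Eventually.of_forall fun v => ?_
      have h3 := infDist_le_dist_of_mem (x := x) (hP.mem_frontier i v)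
      rw [← hxq, ← hs, dist_eq_norm, dist_eq_norm] at h3
      change ‖x - γ i s‖ ^ 2 ≤ ‖x - γ i v‖ ^ 2
      gcongr
    have h3 := h2.hasDerivAt_eq_zero h1
    rw [inner_neg_right, hs] at h3
    linarith
  have h4 := frame_expansion (hG.norm_outerNormal hq) (x - q)
  have h5 : rot (outerNormal G q) = deriv (γ i) s := by rw [← hs]; exact hP.rot_normal hγ i s
  rw [h5, hperp, zero_smul, add_zero] at h4
  set r := inner ℝ (x - q) (outerNormal G q) with hr
  have hrη : |r| < η := by
    have : dist x q = |r| := by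
      rw [dist_eq_norm, h4, norm_smul, hG.norm_outerNormal hq, mul_one, Real.norm_eq_abs]
    rw [← this, hxq]
    exact infDist_lt_of_mem_thickening hx
  have h6 : x = q + r • outerNormal G q := by rw [← h4]; abel
  have h7 := (hη.ray hG hq hrη).2
  rw [← h6] at h7
  rw [h7]; exact h6

end Fermi

/-! ### The sets of a smooth flow -/

/-- Two bounded sets which have a common boundary, and which near each boundary point
either coincide or are complementary, coincide. -/
theorem eq_of_locally_eq_or_compl {A B Γ : Set Plane} (hA : IsOpen A) (hΓ : frontier A = Γ)
    (hAb : Bornology.IsBounded A) (hBb : Bornology.IsBounded B)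
    (hB : ∀ x ∉ Γ, ∀ᶠ y in 𝓝 x, (y ∈ B ↔ x ∈ B)) (hBΓ : ∀ x ∈ Γ, x ∉ B)
    (h : ∀ p ∈ Γ, (∀ᶠ x in 𝓝 p, x ∉ Γ → (x ∈ A ↔ x ∈ B)) ∨
      ∀ᶠ x in 𝓝 p, x ∉ Γ → (x ∈ A ↔ x ∉ B)) : A = B := by
  have hAloc : ∀ x ∉ Γ, ∀ᶠ y in 𝓝 x, (y ∈ A ↔ x ∈ A) := by
    intro x hx
    by_cases hxA : x ∈ A
    · filter_upwards [hA.mem_nhds hxA] with y hy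
      simp [hy, hxA]
    · have : x ∉ closure A := fun hc => hx (by rw [← hΓ, hA.frontier_eq]; exact ⟨hc, hxA⟩)
      filter_upwards [isClosed_closure.isOpen_compl.mem_nhds this] with y hy
      have : y ∉ A := fun h => hy (subset_closure h)
      simp [this, hxA]
  -- Off Γ, the sets `A` and `B` agree near points of `U₁` and are complementary near points of
  -- `U₀`. Both are open, they cover the plane, and they are disjoint because the boundary of an
  -- open set has empty interior. Far away both sets are empty, so by connectedness `U₁` is
  -- everything.
  set U₁ : Set Plane := {x | ∀ᶠ y in 𝓝 x, y ∉ Γ → (y ∈ A ↔ y ∈ B)} with hU₁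
  set U₀ : Set Plane := {x | ∀ᶠ y in 𝓝 x, y ∉ Γ → (y ∈ A ↔ y ∉ B)} with hU₀
  have ho₁ : IsOpen U₁ := isOpen_iff_mem_nhds.2 fun x hx => eventually_eventually_nhds.2 hx
  have ho₀ : IsOpen U₀ := isOpen_iff_mem_nhds.2 fun x hx => eventually_eventually_nhds.2 hx
  have hdisj : ∀ x, x ∈ U₁ → x ∉ U₀ := by
    intro x h1 h0
    have h2 : ∀ᶠ y in 𝓝 x, y ∈ Γ := by
      filter_upwards [h1, h0] with y hy1 hy0
      by_contra hy
      have h3 := hy1 hy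
      have h4 := hy0 hy
      tauto
    have h3 : x ∈ interior (frontier A) := by rw [hΓ]; exact mem_interior_iff_mem_nhds.2 h2
    rw [← frontier_compl, interior_frontier hA.isClosed_compl] at h3
    exact h3
  have hcov : ∀ x, x ∈ U₁ ∨ x ∈ U₀ := by
    intro x
    by_cases hx : x ∈ Γ
    · exact h x hx
    · by_cases hx2 : x ∈ A ↔ x ∈ B
      · left
        filter_upwards [hAloc x hx, hB x hx] with y h1 h2 _
        rw [h1, h2, hx2]
      · right
        filter_upwards [hAloc x hx, hB x hx] with y h1 h2 _
        rw [h1, h2]; tauto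
  have hclopen : IsClopen U₁ := by
    refine ⟨⟨?_⟩, ho₁⟩
    have : U₁ᶜ = U₀ := by
      ext x; exact ⟨fun h1 => (hcov x).resolve_left h1, fun h0 h1 => hdisj x h1 h0⟩
    rw [this]; exact ho₀
  have hne : U₁.Nonempty := by
    obtain ⟨R, hR⟩ := (hAb.union hBb).subset_closedBall 0
    obtain ⟨x, hx⟩ := NormedSpace.exists_lt_norm ℝ Plane R
    refine ⟨x, ?_⟩
    filter_upwards [isClosed_closedBall.isOpen_compl.mem_nhds
      (show x ∉ closedBall 0 R by simpa using hx)] with y hy _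
    have h1 : y ∉ A := fun h => hy (hR (Or.inl h))
    have h2 : y ∉ B := fun h => hy (hR (Or.inr h))
    simp [h1, h2]
  have huniv := hclopen.eq_univ hne
  ext x
  by_cases hx : x ∈ Γ
  · have h1 : x ∉ A := by rw [← hΓ, hA.frontier_eq] at hx; exact hx.2
    simp [h1, hBΓ x hx]
  · have h1 : x ∈ U₁ := by rw [huniv]; trivial
    exact h1.self_of_nhds hx


section Flow

variable {G : Set Plane} {η T : ℝ} {ι : Type} {L : ι → ℝ} {γ : ι → ℝ → Plane}
  {F : ℝ → Set Plane} {h : ℝ → Plane → ℝ}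

/-- The boundary is closed, so some nearest point exists for every x; this covers points outside the
tube, where it need not be unique. -/
theorem nearestPt_mem (hne : (frontier G).Nonempty) (x : Plane) :
    nearestPt (frontier G) x ∈ frontier G := by
  obtain ⟨q, hq, hxq⟩ := (isClosed_frontier (s := G)).exists_infDist_eq_dist hne x
  exact (Classical.epsilon_spec (p := fun y => y ∈ frontier G ∧ dist x y = infDist x (frontier G))
    ⟨q, hq, hxq.symm⟩).1

theorem IsSmoothFlow.contDiffOn_height (hf : IsSmoothFlow G η T F h) (hP : IsBoundaryParam G L γ)
    (i : ι) : ContDiffOn ℝ ∞ (fun q : ℝ × ℝ => h q.2 (γ i q.1)) (univ ×ˢ Ioo 0 T) :=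
  hf.smooth.comp (((hP.smooth i).comp contDiff_fst).prodMk contDiff_snd).contDiffOn
    fun q hq => ⟨hP.mem_frontier i q.1, hq.2⟩

theorem IsSmoothFlow.contDiff_height (hf : IsSmoothFlow G η T F h) (hP : IsBoundaryParam G L γ)
    (i : ι) {t : ℝ} (ht : t ∈ Ioo 0 T) : ContDiff ℝ ∞ fun s => h t (γ i s) := by
  rw [← contDiffOn_univ]
  exact (hf.contDiffOn_height hP i).comp (contDiff_id.prodMk contDiff_const).contDiffOn
    fun s _ => ⟨trivial, ht⟩

theorem IsSmoothFlow.abs_height_lt (hf : IsSmoothFlow G η T F h) (hη : 0 < η) {t : ℝ}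
    (ht : t ∈ Ioo 0 T) {q : Plane} (hq : q ∈ frontier G) : |h t q| < η :=
  (hf.height_le t ⟨ht.1.le, ht.2⟩ q hq).trans_lt (by linarith)

theorem IsSmoothFlow.contDiffAt_height_nearestPt (hf : IsSmoothFlow G η T F h)
    (hη : IsTubularRadius G η) {t : ℝ} (ht : t ∈ Ioo 0 T) {x : Plane}
    (hx : x ∈ thickening η (frontier G)) :
    ContDiffAt ℝ ∞ (fun x => h t (nearestPt (frontier G) x)) x := by
  refine ContDiffOn.contDiffAt (s := thickening η (frontier G)) ?_ (isOpen_thickening.mem_nhds hx)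
  exact hf.smooth.comp (hη.smooth_proj.prodMk contDiffOn_const)
    fun y hy => ⟨(hη.nearestPt_spec hy).1, ht⟩

theorem IsSmoothFlow.mem_frontier_iff (hf : IsSmoothFlow G η T F h) (hG : IsSmoothSet G)
    (hη : IsTubularRadius G η) (hP : IsBoundaryParam G L γ) (hγ : ∀ i s, ‖deriv (γ i) s‖ = 1)
    {t : ℝ} (ht : t ∈ Ioo 0 T) {x : Plane} :
    x ∈ frontier (F t) ↔ x ∈ thickening η (frontier G) ∧
      signedDistFrom G x = h t (nearestPt (frontier G) x) := by
  rw [hf.boundary t ⟨ht.1.le, ht.2⟩]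
  constructor
  · rintro ⟨q, hq, rfl⟩
    have h1 := hf.abs_height_lt hη.pos ht hq
    refine ⟨ray_mem_thickening hG hq h1, ?_⟩
    rw [graphMap, (hη.ray hG hq h1).2, hη.nearestPt_ray hG hq h1]
  · rintro ⟨hx, hd⟩
    refine ⟨nearestPt (frontier G) x, (hη.nearestPt_spec hx).1, ?_⟩
    conv_rhs => rw [hη.eq_ray hG hP hγ hx, hd]
    rfl

theorem IsSmoothFlow.hasDerivAt_graph (hf : IsSmoothFlow G η T F h) (hG : IsSmoothSet G)
    (hη : IsTubularRadius G η) (hP : IsBoundaryParam G L γ) (hγ : ∀ i s, ‖deriv (γ i) s‖ = 1)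
    {t : ℝ} (ht : t ∈ Ioo 0 T) (i : ι) (s : ℝ) :
    HasDerivAt (fun s => graphMap G (h t) (γ i s))
      ((1 + h t (γ i s) * curvatureAlong G (γ i) s) • deriv (γ i) s +
        deriv (fun s => h t (γ i s)) s • outerNormal G (γ i s)) s :=
  hasDerivAt_fermi hG hη hP hγ i s
    (((hf.contDiff_height hP i ht).differentiable (by simp) s).hasDerivAt)

/-- A local defining function ψ of F_t vanishes on the graph and has nonzero derivative in the
direction ν_G. By the mean value theorem along normal segments, ψ = (d_G - h ∘ π_G) m with m of
constant sign; this sign decides the alternative. -/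
theorem IsSmoothFlow.locally_eq_or_compl (hf : IsSmoothFlow G η T F h) (hG : IsSmoothSet G)
    (hη : IsTubularRadius G η) (hP : IsBoundaryParam G L γ) (hγ : ∀ i s, ‖deriv (γ i) s‖ = 1)
    {t : ℝ} (ht : t ∈ Ioo 0 T) {p : Plane} (hp : p ∈ frontier (F t)) :
    (∀ᶠ x in 𝓝 p, x ∉ frontier (F t) →
        (x ∈ F t ↔ signedDistFrom G x < h t (nearestPt (frontier G) x))) ∨
      ∀ᶠ x in 𝓝 p, x ∉ frontier (F t) →
        (x ∈ F t ↔ ¬ signedDistFrom G x < h t (nearestPt (frontier G) x)) := by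
  have hset := hf.smooth_set t ⟨ht.1.le, ht.2⟩
  obtain ⟨ψ, hψ, hdψ, hψF⟩ := hset.smooth p hp
  have hzero : ∀ᶠ y in 𝓝 p, y ∈ frontier (F t) → ψ y = 0 := by
    filter_upwards [eventually_eventually_nhds.2 hψF] with y hy hyF
    exact IsSmoothSet.zero_of_mem_frontier hset.isOpen hyF hψ.continuous.continuousAt hy
  have hpt := (hf.mem_frontier_iff hG hη hP hγ ht).1 hp
  have hq := (hη.nearestPt_spec hpt.1).1
  set q := nearestPt (frontier G) p with hqdef
  set ν := outerNormal G q with hν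
  have hpq : p = q + h t q • ν := by
    have := hη.eq_ray hG hP hγ hpt.1
    rwa [hpt.2] at this
  obtain ⟨i, s, hs⟩ := hP.exists_eq hq
  have hφd : Differentiable ℝ ψ := hψ.differentiable (by simp)
  set κ := fderiv ℝ ψ p ν with hκ
  -- Otherwise dψ would kill both ν_G and the tangent of the graph, which are independent since 1 +
  -- hκ > 0 with κ the curvature of ∂G.
  have hκ0 : κ ≠ 0 := by
    intro h0
    have hcs : graphMap G (h t) (γ i s) = p := by rw [hs, graphMap, ← hν, ← hpq]
    have h1 := hf.hasDerivAt_graph hG hη hP hγ ht i s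
    have h2 : HasFDerivAt ψ (fderiv ℝ ψ p) (graphMap G (h t) (γ i s)) := by
      rw [hcs]; exact (hφd p).hasFDerivAt
    have h3 := h2.comp_hasDerivAt s h1
    have h4 : (ψ ∘ fun s => graphMap G (h t) (γ i s)) =ᶠ[𝓝 s] fun _ => 0 := by
      have h5 := h1.continuousAt.tendsto
      rw [hcs] at h5
      filter_upwards [h5.eventually hzero] with v hv
      apply hv
      rw [hf.boundary t ⟨ht.1.le, ht.2⟩]
      exact ⟨_, hP.mem_frontier i v, rfl⟩
    have h5 := (h3.congr_of_eventuallyEq h4.symm).unique (hasDerivAt_const s (0 : ℝ))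
    rw [map_add, map_smul, map_smul, hs, ← hν, ← hκ, h0, smul_zero, add_zero, smul_eq_mul] at h5
    have h6 := (one_add_mul_curvatureAlong_pos hG hη hP hγ i s
      (by rw [hs]; exact hf.abs_height_lt hη.pos ht hq) : 0 < 1 + h t (γ i s) * _)
    rw [hs] at h6
    have h7 := (mul_eq_zero.1 h5).resolve_left h6.ne'
    apply hdψ
    ext w
    rw [frame_expansion (hG.norm_outerNormal hq) w, map_add, map_smul, map_smul, ← hs,
      hP.rot_normal hγ, h7, hs, ← hν, ← hκ, h0]
    simp
  -- The point of the graph on the same normal ray as x.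
  set z : Plane → Plane := fun x => graphMap G (h t) (nearestPt (frontier G) x) with hz
  have hpc := (hη.contDiffAt_proj hpt.1).continuousAt
  have hνc : ContinuousAt (fun x => outerNormal G (nearestPt (frontier G) x)) p :=
    ContinuousAt.comp (f := nearestPt (frontier G)) (x := p)
      (hη.contDiffAt_outerNormal (mem_thickening_of_mem_frontier hη.pos hq)).continuousAt hpc
  have hzc : ContinuousAt z p :=
    hpc.add ((hf.contDiffAt_height_nearestPt hη ht hpt.1).continuousAt.smul hνc)
  have hzp : z p = p := by rw [hz]; exact hpq.symm
  have hM : Continuous fun yw : Plane × Plane => fderiv ℝ ψ yw.1 yw.2 * κ := by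
    have : Continuous fun yw : Plane × Plane => fderiv ℝ ψ yw.1 := 
      (hψ.continuous_fderiv (by simp)).comp continuous_fst
    exact (this.clm_apply continuous_snd).mul continuous_const
  have hMpos : ∀ᶠ yw in 𝓝 (p, ν), 0 < fderiv ℝ ψ yw.1 yw.2 * κ :=
    hM.continuousAt.eventually (lt_mem_nhds (show 0 < fderiv ℝ ψ p ν * κ from mul_self_pos.2 hκ0))
  obtain ⟨δ, hδ, hball⟩ := Metric.mem_nhds_iff.1 hMpos
  have hev : ∀ᶠ x in 𝓝 p, ∃ m : ℝ, 0 < m * κ ∧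
      ψ x = (signedDistFrom G x - h t (nearestPt (frontier G) x)) * m := by
    have hzt := hzc.tendsto
    rw [hzp] at hzt
    filter_upwards [ball_mem_nhds p hδ, hzt.eventually (ball_mem_nhds p hδ),
      hνc.eventually (ball_mem_nhds ν hδ), isOpen_thickening.mem_nhds hpt.1,
      hzt.eventually hzero] with x h1 h2 h3 h4 h5
    have h6 : ψ (z x) = 0 := by
      apply h5
      rw [hf.boundary t ⟨ht.1.le, ht.2⟩]
      exact ⟨_, (hη.nearestPt_spec h4).1, rfl⟩
    obtain ⟨y, hy, hyeq⟩ := domain_mvt (fun w (_ : w ∈ ball p δ) =>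
      (hφd w).hasFDerivAt.hasFDerivWithinAt) (convex_ball p δ) h2 h1
    have h7 : x - z x = (signedDistFrom G x - h t (nearestPt (frontier G) x)) •
        outerNormal G (nearestPt (frontier G) x) := by
      have h8 := sub_eq_iff_eq_add'.2 (hη.eq_ray hG hP hγ h4)
      rw [sub_smul, ← h8]
      exact sub_add_eq_sub_sub _ _ _
    rw [h6, sub_zero, h7, map_smul, smul_eq_mul] at hyeq
    refine ⟨_, ?_, hyeq⟩
    have hyb : y ∈ ball p δ := (convex_ball p δ).segment_subset h2 h1 hy
    apply hball (show (y, outerNormal G (nearestPt (frontier G) x)) ∈ ball (p, ν) δ from _)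
    rw [mem_ball, Prod.dist_eq, max_lt_iff]
    exact ⟨hyb, h3⟩
  rcases lt_or_gt_of_ne hκ0 with hneg | hpos
  · right
    filter_upwards [hev, hψF, isOpen_thickening.mem_nhds hpt.1] with x ⟨m, hm, hx⟩ hxF hxt hxΓ
    have hm' : m < 0 := by nlinarith
    rw [hxF, hx, not_lt]
    have hne : signedDistFrom G x ≠ h t (nearestPt (frontier G) x) := fun he =>
      hxΓ ((hf.mem_frontier_iff hG hη hP hγ ht).2 ⟨hxt, he⟩)
    constructor
    · intro h1; by_contra! h2; nlinarith
    · intro h1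
      exact mul_neg_of_pos_of_neg (sub_pos.2 (lt_of_le_of_ne h1 hne.symm)) hm'
  · left
    filter_upwards [hev, hψF] with x ⟨m, hm, hx⟩ hxF _
    have hm' : 0 < m := by nlinarith
    rw [hxF, hx]
    constructor
    · intro h1; by_contra! h2; nlinarith
    · intro h1; exact mul_neg_of_neg_of_pos (sub_neg.2 h1) hm'

/-- The local alternative leaves only a choice between the subgraph and its complement, and
boundedness of F_t settles it globally. -/
theorem IsSmoothFlow.set_eq (hf : IsSmoothFlow G η T F h) (hG : IsSmoothSet G)
    (hη : IsTubularRadius G η) (hP : IsBoundaryParam G L γ) (hγ : ∀ i s, ‖deriv (γ i) s‖ = 1)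
    (hne : (frontier G).Nonempty) {t : ℝ} (ht : t ∈ Ioo 0 T) :
    F t = {x | signedDistFrom G x < h t (nearestPt (frontier G) x)} := by
  have hset := hf.smooth_set t ⟨ht.1.le, ht.2⟩
  have hH : ∀ x, |h t (nearestPt (frontier G) x)| ≤ η / 2 := fun x =>
    hf.height_le t ⟨ht.1.le, ht.2⟩ _ (nearestPt_mem hne x)
  have hη0 := hη.pos
  apply eq_of_locally_eq_or_compl hset.isOpen rfl hset.bounded
  · refine (hG.bounded.union (hG.isCompact_frontier.isBounded.thickening (δ := η))).subset ?_
    intro x hx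
    by_cases hxG : x ∈ G
    · exact Or.inl hxG
    · right
      apply mem_thickening_of_infDist_lt hne
      rw [← signedDistFrom_of_notMem hxG]
      have h1 := (abs_le.1 (hH x)).2
      have h2 : signedDistFrom G x < h t (nearestPt (frontier G) x) := hx
      linarith
  · intro x hx
    by_cases hxt : x ∈ thickening η (frontier G)
    · have hc : ContinuousAt (fun x => signedDistFrom G x - h t (nearestPt (frontier G) x)) x :=
        (continuous_signedDistFrom G).continuousAt.sub
          (hf.contDiffAt_height_nearestPt hη ht hxt).continuousAt
      have hx0 : signedDistFrom G x - h t (nearestPt (frontier G) x) ≠ 0 := fun h0 =>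
        hx ((hf.mem_frontier_iff hG hη hP hγ ht).2 ⟨hxt, sub_eq_zero.1 h0⟩)
      rcases lt_or_gt_of_ne hx0 with h1 | h1
      · filter_upwards [hc.eventually (gt_mem_nhds h1)] with y hy
        exact iff_of_true (sub_neg.1 hy) (sub_neg.1 h1)
      · filter_upwards [hc.eventually (lt_mem_nhds h1)] with y hy
        exact iff_of_false (not_lt.2 (sub_pos.1 hy).le) (not_lt.2 (sub_pos.1 h1).le)
    -- Outside the tube |d_G| ≥ η exceeds η/2 ≥ |h|, so the sign of d_G alone decides membership,
    -- also nearby.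
    · have h1 : η ≤ |signedDistFrom G x| := by
        rw [abs_signedDistFrom]
        by_contra! h2
        exact hxt (mem_thickening_of_infDist_lt hne h2)
      have hc : ContinuousAt (signedDistFrom G) x := (continuous_signedDistFrom G).continuousAt
      have hH' : ∀ y, -(η / 2) ≤ h t (nearestPt (frontier G) y) ∧
        h t (nearestPt (frontier G) y) ≤ η / 2 := fun y => abs_le.1 (hH y)
      rcases le_abs.1 h1 with h2 | h2
      · filter_upwards [hc.eventually (lt_mem_nhds (show η / 2 < signedDistFrom G x by linarith))]
          with y hy
        refine iff_of_false (not_lt.2 ?_) (not_lt.2 ?_)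
        · linarith [(hH' y).2]
        · linarith [(hH' x).2]
      · filter_upwards [hc.eventually (gt_mem_nhds (show signedDistFrom G x < -(η / 2) by linarith))]
          with y hy
        refine iff_of_true ?_ ?_
        · exact lt_of_lt_of_le hy (hH' y).1
        · exact lt_of_lt_of_le (by linarith) (hH' x).1
  · intro x hx
    exact not_lt.2 ((hf.mem_frontier_iff hG hη hP hγ ht).1 hx).2.ge
  · intro p hp
    exact hf.locally_eq_or_compl hG hη hP hγ ht hp

/-- The gradient of d_G - h ∘ π_G is orthogonal to the tangent `e` of the graph, hence a multiple of
-rot e; the multiple is positive because the derivative in direction ν_G is 1. Normalised, this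
function defines F_t globally. -/
theorem IsSmoothFlow.outerNormal_eq (hf : IsSmoothFlow G η T F h) (hG : IsSmoothSet G)
    (hη : IsTubularRadius G η) (hP : IsBoundaryParam G L γ) (hγ : ∀ i s, ‖deriv (γ i) s‖ = 1)
    {t : ℝ} (ht : t ∈ Ioo 0 T) (i : ι) (s : ℝ) {e : Plane}
    (he : e = deriv (fun s => graphMap G (h t) (γ i s)) s) :
    0 < ‖e‖ ∧ outerNormal (F t) (graphMap G (h t) (γ i s)) = -(‖e‖⁻¹ • rot e) := by
  have hne : (frontier G).Nonempty := ⟨_, hP.mem_frontier i s⟩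
  set p := graphMap G (h t) (γ i s) with hp
  set ν := outerNormal G (γ i s) with hν
  set τ := deriv (γ i) s with hτ
  have hq := hP.mem_frontier i s
  have hpF : p ∈ frontier (F t) := by
    rw [hf.boundary t ⟨ht.1.le, ht.2⟩]; exact ⟨_, hq, rfl⟩
  have hpt := (hf.mem_frontier_iff hG hη hP hγ ht).1 hpF
  have hder := hf.hasDerivAt_graph hG hη hP hγ ht i s
  rw [← hν, ← hτ] at hder
  set a := 1 + h t (γ i s) * curvatureAlong G (γ i) s with ha
  set b := deriv (fun s => h t (γ i s)) s with hb
  have hr := hf.abs_height_lt hη.pos ht hq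
  have hapos : 0 < a := one_add_mul_curvatureAlong_pos hG hη hP hγ i s hr
  have heab : e = a • τ + b • ν := by rw [he, hder.deriv]
  have hrotν : rot ν = τ := hP.rot_normal hγ i s
  have hrotτ : rot τ = -ν := by rw [← hrotν, rot_rot]
  have hνn : ‖ν‖ = 1 := hG.norm_outerNormal hq
  have hτν : inner ℝ τ ν = 0 := by rw [← hrotν, real_inner_comm, inner_rot_self]
  have hrote : rot e = -(a • ν) + b • τ := by
    rw [heab, rot_add, rot_smul, rot_smul, hrotν, hrotτ, smul_neg]
  have heν : inner ℝ (rot e) ν = -a := by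
    rw [hrote, inner_add_left, inner_neg_left, inner_smul_left, inner_smul_left, hτν,
      real_inner_self_eq_norm_sq, hνn]; simp
  have hepos : 0 < ‖e‖ := by
    rw [norm_pos_iff]; rintro h0
    rw [h0, show rot (0 : Plane) = 0 from rotCLM.map_zero, inner_zero_left] at heν
    linarith
  refine ⟨hepos, ?_⟩
  set ψ : Plane → ℝ := fun x => signedDistFrom G x - h t (nearestPt (frontier G) x) with hψ
  have hψc : ContDiffAt ℝ ∞ ψ p :=
    (hη.contDiffAt_signedDist hpt.1).sub (hf.contDiffAt_height_nearestPt hη ht hpt.1)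
  set g := gradient ψ p with hg
  have hψd : DifferentiableAt ℝ ψ p := hψc.differentiableAt (by simp)
  have hgd : InnerProductSpace.toDual ℝ Plane g = fderiv ℝ ψ p := by rw [hg, toDual_gradient]
  have hgν : inner ℝ g ν = 1 := by
    have h1 : HasDerivAt (fun r : ℝ => γ i s + r • ν) ν (h t (γ i s)) := by
      have := ((hasDerivAt_id (h t (γ i s))).smul_const ν).const_add (γ i s)
      rw [one_smul] at this
      exact this
    have h2 : HasFDerivAt ψ (fderiv ℝ ψ p) (γ i s + h t (γ i s) • ν) := hψd.hasFDerivAt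
    have h3 := h2.comp_hasDerivAt _ h1
    have h4 : (ψ ∘ fun r : ℝ => γ i s + r • ν) =ᶠ[𝓝 (h t (γ i s))]
        fun r => r - h t (γ i s) := by
      filter_upwards [(continuous_abs.continuousAt.eventually (gt_mem_nhds hr))] with r hr'
      have h5 := (hη.ray hG hq hr').2
      have h6 := hη.nearestPt_ray hG hq hr'
      simp only [hψ, Function.comp, hν, h5, h6]
    have h5 := (h3.congr_of_eventuallyEq h4.symm).unique
      ((hasDerivAt_id (h t (γ i s))).sub_const (h t (γ i s)))
    rw [← hgd] at h5
    exact h5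
  have hge : inner ℝ g e = 0 := by
    have h2 : HasFDerivAt ψ (fderiv ℝ ψ p) (graphMap G (h t) (γ i s)) := hψd.hasFDerivAt
    have h3 := h2.comp_hasDerivAt s hder
    have h4 : (ψ ∘ fun s => graphMap G (h t) (γ i s)) = fun _ => 0 := by
      funext v
      have h6 := ((hf.mem_frontier_iff hG hη hP hγ ht (x := graphMap G (h t) (γ i v))).1
        (by rw [hf.boundary t ⟨ht.1.le, ht.2⟩]; exact ⟨_, hP.mem_frontier i v, rfl⟩)).2
      simp only [hψ, Function.comp, h6, sub_self]
    rw [h4, ← heab, ← hgd] at h3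
    exact h3.unique (hasDerivAt_const s (0 : ℝ))
  set e₀ := -(‖e‖⁻¹ • rot e) with he₀
  have he₀n : ‖e₀‖ = 1 := by
    rw [he₀, norm_neg, norm_smul, norm_rot, norm_inv, norm_norm, inv_mul_cancel₀ hepos.ne']
  have hrote₀ : rot e₀ = ‖e‖⁻¹ • e := by
    rw [he₀, rot_neg, rot_smul, rot_rot, smul_neg, neg_neg]
  set lam := inner ℝ g e₀ with hlam
  have hgl : g = lam • e₀ := by
    have h1 := frame_expansion he₀n g
    rw [hrote₀, inner_smul_right, hge, mul_zero, zero_smul, add_zero] at h1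
    exact h1
  have hlpos : 0 < lam := by
    have h1 : lam * (‖e‖⁻¹ * a) = 1 := by
      rw [← hgν]
      conv_rhs => rw [hgl]
      rw [inner_smul_left, he₀, inner_neg_left, inner_smul_left, heν]
      simp
    have h2 : 0 < ‖e‖⁻¹ * a := by positivity
    by_contra! h3
    nlinarith
  have hst : HasStrictFDerivAt (fun x => lam⁻¹ * ψ x) (innerSL ℝ e₀) p := by
    have h3 : innerSL ℝ e₀ = lam⁻¹ • fderiv ℝ ψ p := by
      rw [← hgd, hgl]
      ext w
      simp [hlpos.ne']
    rw [h3]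
    exact (hψc.hasStrictFDerivAt (by simp)).const_mul lam⁻¹
  have hfin := hasGradientAt_signedDistFrom (F := F t) hst he₀n (by simp [hψ, hpt.2])
    (Eventually.of_forall fun x => by
      rw [hf.set_eq hG hη hP hγ hne ht]
      change signedDistFrom G x < _ ↔ _
      rw [← sub_neg]
      constructor
      · intro h1; exact mul_neg_of_pos_of_neg (by positivity) h1
      · intro h1
        by_contra h2
        exact absurd h1 (not_lt.2 (mul_nonneg (by positivity) (not_lt.1 h2))))
  rw [outerNormal, hfin.gradient]

/-- The projection π_G recovers the base point from a point of the graph, so injectivity and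
disjointness are inherited from the curves of ∂G. -/
theorem IsSmoothFlow.isBoundaryParam (hf : IsSmoothFlow G η T F h) (hG : IsSmoothSet G)
    (hη : IsTubularRadius G η) (hP : IsBoundaryParam G L γ) (hγ : ∀ i s, ‖deriv (γ i) s‖ = 1)
    {t : ℝ} (ht : t ∈ Ioo 0 T) :
    IsBoundaryParam (F t) L fun i s => graphMap G (h t) (γ i s) := by
  have hnear : ∀ i s, nearestPt (frontier G) (graphMap G (h t) (γ i s)) = γ i s := fun i s =>
    hη.nearestPt_ray hG (hP.mem_frontier i s) (hf.abs_height_lt hη.pos ht (hP.mem_frontier i s))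
  refine ⟨hP.period_pos, ?_, ?_, ?_, ?_, ?_, ?_, ?_⟩
  · exact fun i => (hP.smooth i).add ((hf.contDiff_height hP i ht).smul (hP.contDiff_normal hη i))
  · intro i s
    simp only [hP.periodic i s]
  · intro i s hs u hu hsu
    have := congrArg (nearestPt (frontier G)) hsu
    simp only [hnear] at this
    exact hP.injOn i hs hu this
  · intro i j hij
    rw [Set.disjoint_left]
    rintro _ ⟨s, rfl⟩ ⟨u, hu⟩
    have := congrArg (nearestPt (frontier G)) hu
    simp only [hnear] at this
    exact hij (hP.index_eq this).symm
  · rw [hf.boundary t ⟨ht.1.le, ht.2⟩, ← hP.iUnion_range, image_iUnion]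
    congr 1
    funext i
    rw [← range_comp]; rfl
  · intro i s
    obtain ⟨h1, h2⟩ := hf.outerNormal_eq hG hη hP hγ ht i s rfl
    rw [unitTangent, h2, rot_neg, rot_smul, rot_rot, smul_neg, smul_neg, smul_neg, neg_neg, smul_smul,
      mul_inv_cancel₀ h1.ne', one_smul]
  · exact fun i s => (hf.outerNormal_eq hG hη hP hγ ht i s rfl).1

end Flow

/-! ### Functions of arc parameter and time -/

section TwoVariables

variable {E : Type*} [NormedAddCommGroup E] [NormedSpace ℝ E] {I : Set ℝ}

/-- Joint smoothness of `(s, t) ↦ a s t` for `s ∈ ℝ` and `t ∈ I`. -/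
def SmoothFor (I : Set ℝ) (a : ℝ → ℝ → E) : Prop :=
  ContDiffOn ℝ ∞ (fun q : ℝ × ℝ => a q.1 q.2) (univ ×ˢ I)

/-- The partial derivative in the first variable. -/
def ds (a : ℝ → ℝ → E) (s t : ℝ) : E := deriv (fun s => a s t) s

/-- The partial derivative in the second variable. -/
def dt (a : ℝ → ℝ → E) (s t : ℝ) : E := deriv (fun t => a s t) t

namespace SmoothFor

theorem contDiffAt {a : ℝ → ℝ → E} (ha : SmoothFor I a) (hI : IsOpen I) {s t : ℝ} (ht : t ∈ I) :
    ContDiffAt ℝ ∞ (fun q : ℝ × ℝ => a q.1 q.2) (s, t) :=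
  ContDiffOn.contDiffAt ha ((isOpen_univ.prod hI).mem_nhds ⟨trivial, ht⟩)

theorem hasFDerivAt {a : ℝ → ℝ → E} (ha : SmoothFor I a) (hI : IsOpen I) {s t : ℝ} (ht : t ∈ I) :
    HasFDerivAt (fun q : ℝ × ℝ => a q.1 q.2) (fderiv ℝ (fun q : ℝ × ℝ => a q.1 q.2) (s, t)) (s, t) :=
  ((ha.contDiffAt hI ht).differentiableAt (by simp)).hasFDerivAt

theorem ds_eq {a : ℝ → ℝ → E} (ha : SmoothFor I a) (hI : IsOpen I) {s t : ℝ} (ht : t ∈ I) :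
    HasDerivAt (fun s => a s t) (fderiv ℝ (fun q : ℝ × ℝ => a q.1 q.2) (s, t) (1, 0)) s :=
  HasFDerivAt.comp_hasDerivAt (f := fun s => (s, t)) s (ha.hasFDerivAt hI ht)
    ((hasDerivAt_id s).prodMk (hasDerivAt_const s t))

theorem dt_eq {a : ℝ → ℝ → E} (ha : SmoothFor I a) (hI : IsOpen I) {s t : ℝ} (ht : t ∈ I) :
    HasDerivAt (fun t => a s t) (fderiv ℝ (fun q : ℝ × ℝ => a q.1 q.2) (s, t) (0, 1)) t :=
  HasFDerivAt.comp_hasDerivAt (f := fun t => (s, t)) t (ha.hasFDerivAt hI ht)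
    ((hasDerivAt_const t s).prodMk (hasDerivAt_id t))

theorem hasDerivAt_s {a : ℝ → ℝ → E} (ha : SmoothFor I a) (hI : IsOpen I) {t : ℝ} (ht : t ∈ I)
    (s : ℝ) : HasDerivAt (fun s => a s t) (ds a s t) s :=
  (ha.ds_eq hI ht).differentiableAt.hasDerivAt

theorem hasDerivAt_t {a : ℝ → ℝ → E} (ha : SmoothFor I a) (hI : IsOpen I) {t : ℝ} (ht : t ∈ I)
    (s : ℝ) : HasDerivAt (fun t => a s t) (dt a s t) t :=
  (ha.dt_eq hI ht).differentiableAt.hasDerivAt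

theorem fderiv_apply {a : ℝ → ℝ → E} (ha : SmoothFor I a) (hI : IsOpen I) (v : ℝ × ℝ) :
    ContDiffOn ℝ ∞ (fun q => fderiv ℝ (fun q : ℝ × ℝ => a q.1 q.2) q v) (univ ×ˢ I) :=
  (ContDiffOn.fderiv_of_isOpen ha (isOpen_univ.prod hI) (by simp)).clm_apply contDiffOn_const

theorem ds {a : ℝ → ℝ → E} (ha : SmoothFor I a) (hI : IsOpen I) : SmoothFor I (ds a) :=
  (ha.fderiv_apply hI (1, 0)).congr fun _ hq => (ha.ds_eq hI hq.2).deriv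

theorem dt {a : ℝ → ℝ → E} (ha : SmoothFor I a) (hI : IsOpen I) : SmoothFor I (dt a) :=
  (ha.fderiv_apply hI (0, 1)).congr fun _ hq => (ha.dt_eq hI hq.2).deriv

theorem ds_dt_comm {a : ℝ → ℝ → E} (ha : SmoothFor I a) (hI : IsOpen I) {s t : ℝ} (ht : t ∈ I) :
    _root_.ds (_root_.dt a) s t = _root_.dt (_root_.ds a) s t := by
  set A := fun q : ℝ × ℝ => a q.1 q.2 with hA
  have hd : HasFDerivAt (fderiv ℝ A) (fderiv ℝ (fderiv ℝ A) (s, t)) (s, t) :=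
    (((ha.contDiffAt hI ht).fderiv_right (m := 1) (by norm_cast)).differentiableAt
      (by simp)).hasFDerivAt
  have h1 : HasDerivAt (fun s => _root_.dt a s t) (fderiv ℝ (fderiv ℝ A) (s, t) (1, 0) (0, 1)) s := by
    have h2 : (fun s => _root_.dt a s t) = fun s => fderiv ℝ A (s, t) (0, 1) :=
      funext fun v => (ha.dt_eq hI ht).deriv
    rw [h2]
    have h3 := HasFDerivAt.comp_hasDerivAt (f := fun s => (s, t)) s hd
      ((hasDerivAt_id s).prodMk (hasDerivAt_const s t))
    have h4 := h3.clm_apply (hasDerivAt_const s ((0, 1) : ℝ × ℝ))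
    rw [map_zero, add_zero] at h4
    exact h4
  have h1' : HasDerivAt (fun t => _root_.ds a s t) (fderiv ℝ (fderiv ℝ A) (s, t) (0, 1) (1, 0)) t := by
    have h2 : (fun t => fderiv ℝ A (s, t) (1, 0)) =ᶠ[𝓝 t] fun t => _root_.ds a s t := by
      filter_upwards [hI.mem_nhds ht] with v hv
      exact (ha.ds_eq hI hv).deriv.symm
    have h3 := HasFDerivAt.comp_hasDerivAt (f := fun t => (s, t)) t hd
      ((hasDerivAt_const t s).prodMk (hasDerivAt_id t))
    have h4 := h3.clm_apply (hasDerivAt_const t ((1, 0) : ℝ × ℝ))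
    rw [map_zero, add_zero] at h4
    exact h4.congr_of_eventuallyEq h2.symm
  have hsymm := (ha.contDiffAt hI ht (s := s)).isSymmSndFDerivAt (by simp; norm_cast)
  change deriv (fun s => _root_.dt a s t) s = deriv (fun t => _root_.ds a s t) t
  rw [h1.deriv, h1'.deriv]
  exact hsymm _ _

theorem contDiff_s {a : ℝ → ℝ → E} (ha : SmoothFor I a) {t : ℝ} (ht : t ∈ I) :
    ContDiff ℝ ∞ fun s => a s t := by
  rw [← contDiffOn_univ]
  exact ContDiffOn.comp ha (contDiff_id.prodMk contDiff_const).contDiffOn fun s _ => ⟨trivial, ht⟩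

theorem continuous_s {a : ℝ → ℝ → E} (ha : SmoothFor I a) {t : ℝ} (ht : t ∈ I) :
    Continuous fun s => a s t := (ha.contDiff_s ht).continuous

theorem add {a b : ℝ → ℝ → E} (ha : SmoothFor I a) (hb : SmoothFor I b) :
    SmoothFor I fun s t => a s t + b s t := ContDiffOn.add ha hb

theorem sub {a b : ℝ → ℝ → E} (ha : SmoothFor I a) (hb : SmoothFor I b) :
    SmoothFor I fun s t => a s t - b s t := ContDiffOn.sub ha hb

theorem neg {a : ℝ → ℝ → E} (ha : SmoothFor I a) : SmoothFor I fun s t => -a s t :=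
  ContDiffOn.neg ha

theorem mul {a b : ℝ → ℝ → ℝ} (ha : SmoothFor I a) (hb : SmoothFor I b) :
    SmoothFor I fun s t => a s t * b s t := ContDiffOn.mul ha hb

theorem smul {a : ℝ → ℝ → ℝ} {b : ℝ → ℝ → E} (ha : SmoothFor I a) (hb : SmoothFor I b) :
    SmoothFor I fun s t => a s t • b s t := ContDiffOn.smul ha hb

theorem inv {a : ℝ → ℝ → ℝ} (ha : SmoothFor I a) (h : ∀ s, ∀ t ∈ I, a s t ≠ 0) :
    SmoothFor I fun s t => (a s t)⁻¹ := ContDiffOn.inv ha fun q hq => h q.1 q.2 hq.2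

theorem pow {a : ℝ → ℝ → ℝ} (ha : SmoothFor I a) (n : ℕ) :
    SmoothFor I fun s t => a s t ^ n := ContDiffOn.pow ha n

theorem inner {a b : ℝ → ℝ → Plane} (ha : SmoothFor I a) (hb : SmoothFor I b) :
    SmoothFor I fun s t => (Inner.inner ℝ (a s t) (b s t) : ℝ) := ContDiffOn.inner ℝ ha hb

theorem norm {a : ℝ → ℝ → Plane} (ha : SmoothFor I a) (h : ∀ s, ∀ t ∈ I, a s t ≠ 0) :
    SmoothFor I fun s t => ‖a s t‖ := ContDiffOn.norm ℝ ha fun q hq => h q.1 q.2 hq.2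

theorem rot {a : ℝ → ℝ → Plane} (ha : SmoothFor I a) : SmoothFor I fun s t => rot (a s t) :=
  rotCLM.contDiff.comp_contDiffOn ha

theorem comp_contDiffOn {V : Type*} [NormedAddCommGroup V] [NormedSpace ℝ V] {g : E → V}
    {S : Set E} (hg : ContDiffOn ℝ ∞ g S) {a : ℝ → ℝ → E} (ha : SmoothFor I a)
    (h : ∀ s, ∀ t ∈ I, a s t ∈ S) : SmoothFor I fun s t => g (a s t) :=
  ContDiffOn.comp hg ha fun q hq => h q.1 q.2 hq.2

theorem of_contDiff {a : ℝ → E} (ha : ContDiff ℝ ∞ a) : SmoothFor I fun s _ => a s :=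
  (ha.comp contDiff_fst).contDiffOn

/-- Differentiation under the integral sign. -/
theorem hasDerivAt_integral {a : ℝ → ℝ → ℝ} (ha : SmoothFor I a) (hI : IsOpen I) {t : ℝ}
    (ht : t ∈ I) (L : ℝ) :
    HasDerivAt (fun t => ∫ s in (0)..L, a s t) (∫ s in (0)..L, _root_.dt a s t) t := by
  obtain ⟨ε, hε, hball⟩ := Metric.isOpen_iff.1 hI t ht
  have hε2 : 0 < ε / 2 := half_pos hε
  have hcb : closedBall t (ε / 2) ⊆ I := (closedBall_subset_ball (by linarith)).trans hball
  have hc : ContinuousOn (fun q : ℝ × ℝ => _root_.dt a q.1 q.2) (uIcc 0 L ×ˢ closedBall t (ε / 2)) :=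
    (ha.dt hI).continuousOn.mono (prod_mono (subset_univ _) hcb)
  obtain ⟨C, hC⟩ := (isCompact_uIcc.prod (isCompact_closedBall t (ε / 2))).exists_bound_of_continuousOn
    hc
  refine (intervalIntegral.hasDerivAt_integral_of_dominated_loc_of_deriv_le
    (F := fun t s => a s t) (F' := fun t s => _root_.dt a s t) (bound := fun _ => C)
    (ball_mem_nhds t hε2) ?_ ?_ ?_ ?_ ?_ ?_).2
  · filter_upwards [hI.mem_nhds ht] with v hv
    exact (ha.continuous_s hv).aestronglyMeasurable
  · exact (ha.continuous_s ht).intervalIntegrable _ _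
  · exact ((ha.dt hI).continuous_s ht).aestronglyMeasurable
  · refine ae_of_all _ fun s hs x hx => hC (s, x) ⟨uIoc_subset_uIcc hs, ball_subset_closedBall hx⟩
  · exact intervalIntegrable_const
  · exact ae_of_all _ fun s _ x hx => ha.hasDerivAt_t hI (hcb (ball_subset_closedBall hx)) s

end SmoothFor

theorem periodic_ds {a : ℝ → ℝ → E} {t L : ℝ} (ha : Function.Periodic (fun s => a s t) L) :
    Function.Periodic (fun s => ds a s t) L := by
  intro s
  change deriv (fun s => a s t) (s + L) = deriv (fun s => a s t) s
  rw [← deriv_comp_add_const]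
  congr 1
  exact funext fun v => ha v

theorem integral_deriv_periodic {a a' : ℝ → ℝ} {L : ℝ} (ha : Function.Periodic a L)
    (hd : ∀ s, HasDerivAt a (a' s) s) (hc : Continuous a') : ∫ s in (0)..L, a' s = 0 := by
  rw [intervalIntegral.integral_eq_sub_of_hasDerivAt (fun s _ => hd s)
    (hc.intervalIntegrable _ _)]
  have := ha 0
  rw [zero_add] at this
  rw [this, sub_self]

end TwoVariables

/-! ### Evolution of a closed curve -/

/-- The data of a smooth family of closed regular curves `c · t` with parameter period `L`, and of a
smooth periodic function `f` along them, for `t ∈ I`. -/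
structure IsCurveFlow (I : Set ℝ) (L : ℝ) (c : ℝ → ℝ → Plane) (f : ℝ → ℝ → ℝ) : Prop where
  isOpen : IsOpen I
  smooth : SmoothFor I c
  smooth_forcing : SmoothFor I f
  regular : ∀ s, ∀ t ∈ I, ds c s t ≠ 0
  periodic : ∀ t ∈ I, Function.Periodic (fun s => c s t) L
  periodic_forcing : ∀ t ∈ I, Function.Periodic (fun s => f s t) L

namespace CurveFlow

/-- The speed of the parametrisation. -/
def speed (c : ℝ → ℝ → Plane) (s t : ℝ) : ℝ := ‖ds c s t‖

/-- The unit tangent. -/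
def tangent (c : ℝ → ℝ → Plane) (s t : ℝ) : Plane := (speed c s t)⁻¹ • ds c s t

/-- The unit normal. -/
def normal (c : ℝ → ℝ → Plane) (s t : ℝ) : Plane := -rot (tangent c s t)

/-- The derivative with respect to arc length. -/
def arcDeriv (c : ℝ → ℝ → Plane) (a : ℝ → ℝ → ℝ) (s t : ℝ) : ℝ := (speed c s t)⁻¹ * ds a s t

/-- The curvature. -/
def curv (c : ℝ → ℝ → Plane) (s t : ℝ) : ℝ :=
  (speed c s t)⁻¹ * inner ℝ (ds (normal c) s t) (tangent c s t)

/-- The potential `g(ν) k + f`. -/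
def pot (g : Plane → ℝ) (c : ℝ → ℝ → Plane) (f : ℝ → ℝ → ℝ) (s t : ℝ) : ℝ :=
  g (normal c s t) * curv c s t + f s t

/-- The tangential component of the velocity of the parametrisation. -/
def tangVel (c : ℝ → ℝ → Plane) (s t : ℝ) : ℝ := inner ℝ (dt c s t) (tangent c s t)

/-- The rate of rotation of the frame. -/
def angVel (c : ℝ → ℝ → Plane) (s t : ℝ) : ℝ := -inner ℝ (dt (normal c) s t) (tangent c s t)

end CurveFlow

open CurveFlow

theorem periodic_dt {E : Type*} [NormedAddCommGroup E] [NormedSpace ℝ E] {I : Set ℝ}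
    (hI : IsOpen I) {a : ℝ → ℝ → E} {L : ℝ}
    (ha : ∀ t ∈ I, Function.Periodic (fun s => a s t) L) :
    ∀ t ∈ I, Function.Periodic (fun s => dt a s t) L := by
  intro t ht s
  refine Filter.EventuallyEq.deriv_eq ?_
  filter_upwards [hI.mem_nhds ht] with v hv
  exact ha v hv s

namespace IsCurveFlow

variable {I : Set ℝ} {L : ℝ} {c : ℝ → ℝ → Plane} {f : ℝ → ℝ → ℝ} {g : Plane → ℝ}

theorem smooth_ds (H : IsCurveFlow I L c f) : SmoothFor I (ds c) := H.smooth.ds H.isOpen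

theorem speed_pos (H : IsCurveFlow I L c f) (s : ℝ) {t : ℝ} (ht : t ∈ I) : 0 < speed c s t :=
  norm_pos_iff.2 (H.regular s t ht)

theorem smooth_speed (H : IsCurveFlow I L c f) : SmoothFor I (speed c) := H.smooth_ds.norm H.regular

theorem smooth_speed_inv (H : IsCurveFlow I L c f) : SmoothFor I fun s t => (speed c s t)⁻¹ :=
  H.smooth_speed.inv fun s _ ht => (H.speed_pos s ht).ne'

theorem smooth_tangent (H : IsCurveFlow I L c f) : SmoothFor I (tangent c) :=
  H.smooth_speed_inv.smul H.smooth_ds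

theorem smooth_normal (H : IsCurveFlow I L c f) : SmoothFor I (normal c) := H.smooth_tangent.rot.neg

theorem smooth_arcDeriv (H : IsCurveFlow I L c f) {a : ℝ → ℝ → ℝ} (ha : SmoothFor I a) :
    SmoothFor I (arcDeriv c a) := H.smooth_speed_inv.mul (ha.ds H.isOpen)

theorem smooth_curv (H : IsCurveFlow I L c f) : SmoothFor I (curv c) :=
  H.smooth_speed_inv.mul ((H.smooth_normal.ds H.isOpen).inner H.smooth_tangent)

theorem norm_tangent (H : IsCurveFlow I L c f) (s : ℝ) {t : ℝ} (ht : t ∈ I) :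
    ‖tangent c s t‖ = 1 := by
  rw [tangent, norm_smul, norm_inv, speed, norm_norm, inv_mul_cancel₀]
  exact (H.speed_pos s ht).ne'

theorem norm_normal (H : IsCurveFlow I L c f) (s : ℝ) {t : ℝ} (ht : t ∈ I) :
    ‖normal c s t‖ = 1 := by
  rw [normal, norm_neg, norm_rot, H.norm_tangent s ht]

theorem rot_normal (c : ℝ → ℝ → Plane) (s t : ℝ) : rot (normal c s t) = tangent c s t := by
  rw [normal, rot_neg, rot_rot, neg_neg]

theorem inner_tangent_normal (c : ℝ → ℝ → Plane) (s t : ℝ) :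
    (inner ℝ (tangent c s t) (normal c s t) : ℝ) = 0 := by
  rw [← rot_normal, real_inner_comm, inner_rot_self]

theorem smooth_aniso (H : IsCurveFlow I L c f) (hg : ContDiffOn ℝ ∞ g {0}ᶜ) :
    SmoothFor I fun s t => g (normal c s t) :=
  H.smooth_normal.comp_contDiffOn hg fun s t ht h0 => by
    have := H.norm_normal s ht
    rw [mem_singleton_iff.1 h0, norm_zero] at this
    exact zero_ne_one this

theorem smooth_pot (H : IsCurveFlow I L c f) (hg : ContDiffOn ℝ ∞ g {0}ᶜ) :
    SmoothFor I (pot g c f) :=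
  ((H.smooth_aniso hg).mul H.smooth_curv).add H.smooth_forcing

theorem smooth_tangVel (H : IsCurveFlow I L c f) : SmoothFor I (tangVel c) :=
  (H.smooth.dt H.isOpen).inner H.smooth_tangent

theorem smooth_angVel (H : IsCurveFlow I L c f) : SmoothFor I (angVel c) :=
  ((H.smooth_normal.dt H.isOpen).inner H.smooth_tangent).neg

theorem ds_eq_smul (H : IsCurveFlow I L c f) (s : ℝ) {t : ℝ} (ht : t ∈ I) :
    ds c s t = speed c s t • tangent c s t := by
  rw [tangent, smul_smul, mul_inv_cancel₀ (H.speed_pos s ht).ne', one_smul]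

theorem ds_eq_speed_mul (H : IsCurveFlow I L c f) (a : ℝ → ℝ → ℝ) (s : ℝ) {t : ℝ} (ht : t ∈ I) :
    ds a s t = speed c s t * arcDeriv c a s t := by
  rw [arcDeriv, mul_inv_cancel_left₀ (H.speed_pos s ht).ne']

/-! #### Periodicity -/

theorem periodic_speed (H : IsCurveFlow I L c f) {t : ℝ} (ht : t ∈ I) :
    Function.Periodic (fun s => speed c s t) L := fun s =>
  congrArg norm (periodic_ds (H.periodic t ht) s)

theorem periodic_tangent (H : IsCurveFlow I L c f) {t : ℝ} (ht : t ∈ I) :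
    Function.Periodic (fun s => tangent c s t) L := fun s =>
  congrArg₂ (fun (x : ℝ) (y : Plane) => x⁻¹ • y) (H.periodic_speed ht s)
    (periodic_ds (H.periodic t ht) s)

theorem periodic_normal (H : IsCurveFlow I L c f) {t : ℝ} (ht : t ∈ I) :
    Function.Periodic (fun s => normal c s t) L := fun s =>
  congrArg (fun x => -rot x) (H.periodic_tangent ht s)

theorem periodic_arcDeriv (H : IsCurveFlow I L c f) {a : ℝ → ℝ → ℝ} {t : ℝ} (ht : t ∈ I)
    (ha : Function.Periodic (fun s => a s t) L) :
    Function.Periodic (fun s => arcDeriv c a s t) L := fun s =>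
  congrArg₂ (fun (x y : ℝ) => x⁻¹ * y) (H.periodic_speed ht s) (periodic_ds ha s)

theorem periodic_curv (H : IsCurveFlow I L c f) {t : ℝ} (ht : t ∈ I) :
    Function.Periodic (fun s => curv c s t) L := fun s => by
  have h1 := H.periodic_speed ht s
  have h2 := H.periodic_tangent ht s
  have h3 := periodic_ds (H.periodic_normal ht) s
  simp only at h1 h2 h3
  simp only [curv, h1, h2, h3]

theorem periodic_pot (H : IsCurveFlow I L c f) (g : Plane → ℝ) {t : ℝ} (ht : t ∈ I) :
    Function.Periodic (fun s => pot g c f s t) L := fun s => by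
  have h1 := H.periodic_normal ht s
  have h2 := H.periodic_curv ht s
  have h3 := H.periodic_forcing t ht s
  simp only at h1 h2 h3
  simp only [pot, h1, h2, h3]

theorem periodic_tangVel (H : IsCurveFlow I L c f) {t : ℝ} (ht : t ∈ I) :
    Function.Periodic (fun s => tangVel c s t) L := fun s =>
  congrArg₂ (fun x y : Plane => (inner ℝ x y : ℝ)) (periodic_dt H.isOpen H.periodic t ht s)
    (H.periodic_tangent ht s)

/-! #### Frame equations -/

theorem inner_deriv_normal {u : ℝ → Plane} {u' : Plane} {s : ℝ} (hu : HasDerivAt u u' s)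
    (h1 : ∀ᶠ v in 𝓝 s, ‖u v‖ = 1) : (inner ℝ u' (u s) : ℝ) = 0 := by
  have h2 := hu.inner ℝ hu
  have h3 : HasDerivAt (fun v => (inner ℝ (u v) (u v) : ℝ)) 0 s := by
    refine (hasDerivAt_const s (1 : ℝ)).congr_of_eventuallyEq ?_
    filter_upwards [h1] with v hv
    rw [real_inner_self_eq_norm_sq, hv, one_pow]
  have h4 := h2.unique h3
  rw [real_inner_comm] at h4
  linarith

theorem ds_normal (H : IsCurveFlow I L c f) (s : ℝ) {t : ℝ} (ht : t ∈ I) :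
    ds (normal c) s t = (speed c s t * curv c s t) • tangent c s t := by
  have h1 := inner_deriv_normal (H.smooth_normal.hasDerivAt_s H.isOpen ht s)
    (Eventually.of_forall fun v => H.norm_normal v ht)
  have h2 := frame_expansion (H.norm_normal s ht) (ds (normal c) s t)
  rw [h1, zero_smul, zero_add, rot_normal] at h2
  rw [curv, mul_inv_cancel_left₀ (H.speed_pos s ht).ne']
  exact h2

theorem dt_normal (H : IsCurveFlow I L c f) (s : ℝ) {t : ℝ} (ht : t ∈ I) :
    dt (normal c) s t = (-angVel c s t) • tangent c s t := by
  have h1 := inner_deriv_normal (H.smooth_normal.hasDerivAt_t H.isOpen ht s)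
    (by filter_upwards [H.isOpen.mem_nhds ht] with v hv using H.norm_normal s hv)
  have h2 := frame_expansion (H.norm_normal s ht) (dt (normal c) s t)
  rw [h1, zero_smul, zero_add, rot_normal] at h2
  rw [angVel, neg_neg]
  exact h2

theorem rot_tangent (c : ℝ → ℝ → Plane) (s t : ℝ) : rot (tangent c s t) = -normal c s t := by
  rw [normal, neg_neg]

theorem hasDerivAt_rot {u : ℝ → Plane} {u' : Plane} {s : ℝ} (hu : HasDerivAt u u' s) :
    HasDerivAt (fun v => rot (u v)) (rot u') s := rotCLM.hasFDerivAt.comp_hasDerivAt s hu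

theorem ds_tangent (H : IsCurveFlow I L c f) (s : ℝ) {t : ℝ} (ht : t ∈ I) :
    ds (tangent c) s t = (-(speed c s t * curv c s t)) • normal c s t := by
  have h1 := hasDerivAt_rot (H.smooth_normal.hasDerivAt_s H.isOpen ht s)
  simp only [rot_normal] at h1
  rw [ds, h1.deriv, H.ds_normal s ht, rot_smul, rot_tangent, smul_neg, neg_smul]

theorem dt_tangent (H : IsCurveFlow I L c f) (s : ℝ) {t : ℝ} (ht : t ∈ I) :
    dt (tangent c) s t = angVel c s t • normal c s t := by
  have h1 := hasDerivAt_rot (H.smooth_normal.hasDerivAt_t H.isOpen ht s)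
  simp only [rot_normal] at h1
  rw [dt, h1.deriv, H.dt_normal s ht, rot_smul, rot_tangent, smul_neg, neg_smul, neg_neg]

theorem frame_ext {c : ℝ → ℝ → Plane} {s t a b a' b' : ℝ} (h1 : ‖normal c s t‖ = 1)
    (h : a • tangent c s t + b • normal c s t = a' • tangent c s t + b' • normal c s t) :
    a = a' ∧ b = b' := by
  have ht : ‖tangent c s t‖ = 1 := by rw [← rot_normal, norm_rot, h1]
  have e1 := congrArg (fun v : Plane => (inner ℝ v (tangent c s t) : ℝ)) h
  have e2 := congrArg (fun v : Plane => (inner ℝ v (normal c s t) : ℝ)) h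
  have h0 := inner_tangent_normal c s t
  have h0' : (inner ℝ (normal c s t) (tangent c s t) : ℝ) = 0 := by rw [real_inner_comm]; exact h0
  simp only [inner_add_left, real_inner_smul_left, real_inner_self_eq_norm_sq, h0, h0', h1, ht] at e1 e2
  exact ⟨by linarith, by linarith⟩

/-- The evolution of the speed and of the frame. -/
theorem dt_speed (H : IsCurveFlow I L c f) {V : ℝ → ℝ → ℝ} (hV : SmoothFor I V) {t : ℝ}
    (ht : t ∈ I) (hvel : ∀ s, inner ℝ (dt c s t) (normal c s t) = V s t) (s : ℝ) :
    dt (speed c) s t = V s t * speed c s t * curv c s t + ds (tangVel c) s t ∧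
      speed c s t * angVel c s t = ds V s t - tangVel c s t * (speed c s t * curv c s t) := by
  have hc : ∀ s, dt c s t = V s t • normal c s t + tangVel c s t • tangent c s t := fun s => by
    have := frame_expansion (H.norm_normal s ht) (dt c s t)
    rwa [hvel, rot_normal] at this
  have h1 : ds (dt c) s t = _ := ((((hV.hasDerivAt_s H.isOpen ht s).smul
    (H.smooth_normal.hasDerivAt_s H.isOpen ht s)).add
    ((H.smooth_tangVel.hasDerivAt_s H.isOpen ht s).smul
      (H.smooth_tangent.hasDerivAt_s H.isOpen ht s))).congr_of_eventuallyEq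
        (Eventually.of_forall fun v => hc v)).deriv
  have h2 : dt (ds c) s t = _ := (((H.smooth_speed.hasDerivAt_t H.isOpen ht s).smul
    (H.smooth_tangent.hasDerivAt_t H.isOpen ht s)).congr_of_eventuallyEq
      (f₁ := fun v => ds c s v) (by
        filter_upwards [H.isOpen.mem_nhds ht] with v hv using H.ds_eq_smul s hv)).deriv
  -- The tangential and normal components of ∂_s∂_t c = ∂_t∂_s c are the two asserted equations.
  have h3 := H.smooth.ds_dt_comm H.isOpen ht (s := s)
  rw [h1, h2, H.ds_normal s ht, H.ds_tangent s ht, H.dt_tangent s ht] at h3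
  have h4 := frame_ext (a := V s t * speed c s t * curv c s t + ds (tangVel c) s t)
    (b := ds V s t - tangVel c s t * (speed c s t * curv c s t))
    (a' := dt (speed c) s t) (b' := speed c s t * angVel c s t) (H.norm_normal s ht) (by
      linear_combination (norm := module) h3)
  exact ⟨h4.1.symm, h4.2.symm⟩

/-- The tangential component of ∂_s∂_t ν = ∂_t∂_s ν. -/
theorem dt_speed_mul_curv (H : IsCurveFlow I L c f) {t : ℝ} (ht : t ∈ I) (s : ℝ) :
    dt (speed c) s t * curv c s t + speed c s t * dt (curv c) s t = -ds (angVel c) s t := by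
  have h1 : ds (dt (normal c)) s t = _ := (((H.smooth_angVel.hasDerivAt_s H.isOpen ht s).neg.smul
    (H.smooth_tangent.hasDerivAt_s H.isOpen ht s)).congr_of_eventuallyEq
        (Eventually.of_forall fun v => H.dt_normal v ht)).deriv
  have h2 : dt (ds (normal c)) s t = _ := ((((H.smooth_speed.hasDerivAt_t H.isOpen ht s).mul
    (H.smooth_curv.hasDerivAt_t H.isOpen ht s)).smul
    (H.smooth_tangent.hasDerivAt_t H.isOpen ht s)).congr_of_eventuallyEq
      (f₁ := fun v => ds (normal c) s v) (by
        filter_upwards [H.isOpen.mem_nhds ht] with v hv using H.ds_normal s hv)).deriv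
  have h3 := H.smooth_normal.ds_dt_comm H.isOpen ht (s := s)
  rw [h1, h2, H.ds_tangent s ht, H.dt_tangent s ht] at h3
  refine (frame_ext (a := -ds (angVel c) s t)
    (b := angVel c s t * (speed c s t * curv c s t))
    (a' := dt (speed c) s t * curv c s t + speed c s t * dt (curv c) s t)
    (b' := speed c s t * curv c s t * angVel c s t) (H.norm_normal s ht) ?_).1.symm
  simp only [Pi.neg_apply, Pi.mul_apply] at h3
  linear_combination (norm := module) h3

/-- The derivative of the anisotropy in the direction of the tangent. -/
def anisoDeriv (g : Plane → ℝ) (c : ℝ → ℝ → Plane) (s t : ℝ) : ℝ :=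
  fderiv ℝ g (normal c s t) (tangent c s t)

theorem hasDerivAt_aniso (H : IsCurveFlow I L c f) (hg : ContDiffOn ℝ ∞ g {0}ᶜ) {t : ℝ} (ht : t ∈ I)
    (s : ℝ) : HasDerivAt (fun s => g (normal c s t))
        (speed c s t * curv c s t * anisoDeriv g c s t) s ∧
      HasDerivAt (fun t => g (normal c s t)) (-angVel c s t * anisoDeriv g c s t) t := by
  have h0 : normal c s t ∈ ({0}ᶜ : Set Plane) := fun h0 => by
    have := H.norm_normal s ht
    rw [mem_singleton_iff.1 h0, norm_zero] at this
    exact zero_ne_one this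
  have h1 : HasFDerivAt g (fderiv ℝ g (normal c s t)) (normal c s t) :=
    ((hg.contDiffAt (isOpen_compl_singleton.mem_nhds h0)).differentiableAt (by simp)).hasFDerivAt
  constructor
  · have := h1.comp_hasDerivAt s (H.smooth_normal.hasDerivAt_s H.isOpen ht s)
    rw [H.ds_normal s ht, map_smul] at this
    exact this
  · have := h1.comp_hasDerivAt t (H.smooth_normal.hasDerivAt_t H.isOpen ht s)
    rw [H.dt_normal s ht, map_smul] at this
    exact this

end IsCurveFlow

open CurveFlow

/-! ### The energy identity for one closed curve -/

namespace CurveFlow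

/-- The first derivative of the potential with respect to arc length. -/
def potD (g : Plane → ℝ) (c : ℝ → ℝ → Plane) (f : ℝ → ℝ → ℝ) : ℝ → ℝ → ℝ := arcDeriv c (pot g c f)

/-- The second derivative of the potential with respect to arc length. -/
def potDD (g : Plane → ℝ) (c : ℝ → ℝ → Plane) (f : ℝ → ℝ → ℝ) : ℝ → ℝ → ℝ :=
  arcDeriv c (potD g c f)

/-- The third derivative of the potential with respect to arc length. -/
def potDDD (g : Plane → ℝ) (c : ℝ → ℝ → Plane) (f : ℝ → ℝ → ℝ) : ℝ → ℝ → ℝ :=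
  arcDeriv c (potDD g c f)

/-- The integrand in the rate of change of the energy `∫ (∂_σ R)²` along the flow `V = ∂_σσ R`. -/
def energyRate (g : Plane → ℝ) (c : ℝ → ℝ → Plane) (f : ℝ → ℝ → ℝ) (s t : ℝ) : ℝ :=
  -2 * (speed c s t * g (normal c s t) * potDDD g c f s t ^ 2) +
    2 * (potDD g c f s t * tangVel c s t * ds f s t) +
    2 * (g (normal c s t) * curv c s t ^ 2 * potDD g c f s t ^ 2 * speed c s t) -
    2 * (potDD g c f s t * speed c s t * dt f s t) -
    potD g c f s t ^ 2 * curv c s t * potDD g c f s t * speed c s t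

end CurveFlow

namespace IsCurveFlow

variable {I : Set ℝ} {L : ℝ} {c : ℝ → ℝ → Plane} {f : ℝ → ℝ → ℝ} {g : Plane → ℝ}

theorem smooth_potD (H : IsCurveFlow I L c f) (hg : ContDiffOn ℝ ∞ g {0}ᶜ) :
    SmoothFor I (potD g c f) := H.smooth_arcDeriv (H.smooth_pot hg)

theorem smooth_potDD (H : IsCurveFlow I L c f) (hg : ContDiffOn ℝ ∞ g {0}ᶜ) :
    SmoothFor I (potDD g c f) := H.smooth_arcDeriv (H.smooth_potD hg)

theorem smooth_potDDD (H : IsCurveFlow I L c f) (hg : ContDiffOn ℝ ∞ g {0}ᶜ) :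
    SmoothFor I (potDDD g c f) := H.smooth_arcDeriv (H.smooth_potDD hg)

theorem periodic_potD (H : IsCurveFlow I L c f) (g : Plane → ℝ) {t : ℝ} (ht : t ∈ I) :
    Function.Periodic (fun s => potD g c f s t) L := H.periodic_arcDeriv ht (H.periodic_pot g ht)

theorem periodic_potDD (H : IsCurveFlow I L c f) (g : Plane → ℝ) {t : ℝ} (ht : t ∈ I) :
    Function.Periodic (fun s => potDD g c f s t) L := H.periodic_arcDeriv ht (H.periodic_potD g ht)

theorem periodic_potDDD (H : IsCurveFlow I L c f) (g : Plane → ℝ) {t : ℝ} (ht : t ∈ I) :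
    Function.Periodic (fun s => potDDD g c f s t) L :=
  H.periodic_arcDeriv ht (H.periodic_potDD g ht)

theorem ds_pot (H : IsCurveFlow I L c f) (g : Plane → ℝ) (s : ℝ) {t : ℝ} (ht : t ∈ I) :
    ds (pot g c f) s t = speed c s t * potD g c f s t := H.ds_eq_speed_mul _ s ht

theorem ds_potD (H : IsCurveFlow I L c f) (g : Plane → ℝ) (s : ℝ) {t : ℝ} (ht : t ∈ I) :
    ds (potD g c f) s t = speed c s t * potDD g c f s t := H.ds_eq_speed_mul _ s ht

theorem ds_potDD (H : IsCurveFlow I L c f) (g : Plane → ℝ) (s : ℝ) {t : ℝ} (ht : t ∈ I) :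
    ds (potDD g c f) s t = speed c s t * potDDD g c f s t := H.ds_eq_speed_mul _ s ht

/-- Evolution of R = g(ν)k + f when V is its second arc length derivative. The bracket is ∂_s(gZ).
The tangential velocity W only transports the geometric part gk, whose s-derivative is ρr - ∂_s f.
-/
theorem speed_mul_dt_pot (H : IsCurveFlow I L c f) (hg : ContDiffOn ℝ ∞ g {0}ᶜ) {t : ℝ}
    (ht : t ∈ I) (hvel : ∀ s, inner ℝ (dt c s t) (normal c s t) = potDD g c f s t) (s : ℝ) :
    speed c s t * dt (pot g c f) s t =
      -(speed c s t * curv c s t * anisoDeriv g c s t * potDDD g c f s t +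
          g (normal c s t) * ds (potDDD g c f) s t) +
        (speed c s t * potD g c f s t - ds f s t) * tangVel c s t -
        g (normal c s t) * curv c s t ^ 2 * speed c s t * potDD g c f s t +
        speed c s t * dt f s t := by
  -- The frame equation ρ · angVel = ∂_s V - Wρk, with ∂_s V = ρZ.
  have ha : ∀ s, angVel c s t = potDDD g c f s t - tangVel c s t * curv c s t := fun s => by
    have h1 := (H.dt_speed (H.smooth_potDD hg) ht hvel s).2
    rw [H.ds_potDD g s ht] at h1
    have hρ := (H.speed_pos s ht).ne'
    apply mul_left_cancel₀ hρ
    linear_combination h1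
  have has : ds (angVel c) s t = _ := ((((H.smooth_potDDD hg).hasDerivAt_s H.isOpen ht s).sub
    ((H.smooth_tangVel.hasDerivAt_s H.isOpen ht s).mul
      (H.smooth_curv.hasDerivAt_s H.isOpen ht s))).congr_of_eventuallyEq
        (f₁ := fun v => angVel c v t) (Eventually.of_forall fun v => ha v)).deriv
  have hρt := (H.dt_speed (H.smooth_potDD hg) ht hvel s).1
  have hkt := H.dt_speed_mul_curv ht s
  obtain ⟨hGs, hGt⟩ := H.hasDerivAt_aniso hg ht s
  have hRs : ds (pot g c f) s t = _ := ((hGs.mul (H.smooth_curv.hasDerivAt_s H.isOpen ht s)).add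
    (H.smooth_forcing.hasDerivAt_s H.isOpen ht s)).deriv
  have hRt : dt (pot g c f) s t = _ := ((hGt.mul (H.smooth_curv.hasDerivAt_t H.isOpen ht s)).add
    (H.smooth_forcing.hasDerivAt_t H.isOpen ht s)).deriv
  rw [H.ds_pot g s ht] at hRs
  rw [has, hρt] at hkt
  rw [hRt, ha s]
  linear_combination g (normal c s t) * hkt - tangVel c s t * hRs

/-- Since ρr = ∂_s R, one has ∂_t(ρr²) = 2r ∂_s∂_t R - r² ∂_t ρ. Three total derivatives are split
off: ∂_s(2r ∂_t R), then -∂_s(r²W), which removes the terms in W without forcing because ∂_s r = ρV,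
and ∂_s(2VgZ), which produces the dissipation -2ρgZ². The rest is `energyRate`, and all boundary
terms vanish by periodicity. -/
theorem dt_energy_density (H : IsCurveFlow I L c f) (hg : ContDiffOn ℝ ∞ g {0}ᶜ) {t : ℝ}
    (ht : t ∈ I) (hvel : ∀ s, inner ℝ (dt c s t) (normal c s t) = potDD g c f s t) (s : ℝ) :
    HasDerivAt (fun s => 2 * potD g c f s t * dt (pot g c f) s t -
        potD g c f s t ^ 2 * tangVel c s t +
        2 * potDD g c f s t * (g (normal c s t) * potDDD g c f s t))
      (dt (fun s t => speed c s t * potD g c f s t ^ 2) s t - energyRate g c f s t) s := by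
  have hr := (H.smooth_potD hg).hasDerivAt_s H.isOpen ht s
  have hV := (H.smooth_potDD hg).hasDerivAt_s H.isOpen ht s
  have hZ := (H.smooth_potDDD hg).hasDerivAt_s H.isOpen ht s
  have hR := ((H.smooth_pot hg).dt H.isOpen).hasDerivAt_s H.isOpen ht s
  have hW := H.smooth_tangVel.hasDerivAt_s H.isOpen ht s
  obtain ⟨hGs, -⟩ := H.hasDerivAt_aniso hg ht s
  have hQ := (((hr.const_mul 2).mul hR).sub ((hr.pow 2).mul hW)).add
    ((hV.const_mul 2).mul (hGs.mul hZ))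
  refine HasDerivAt.congr_deriv hQ ?_
  have hE : dt (fun s t => speed c s t * potD g c f s t ^ 2) s t = _ :=
    ((H.smooth_speed.hasDerivAt_t H.isOpen ht s).mul
      (((H.smooth_potD hg).hasDerivAt_t H.isOpen ht s).pow 2)).deriv
  have hρR : dt (ds (pot g c f)) s t = _ := (((H.smooth_speed.hasDerivAt_t H.isOpen ht s).mul
      ((H.smooth_potD hg).hasDerivAt_t H.isOpen ht s)).congr_of_eventuallyEq
      (f₁ := fun v => ds (pot g c f) s v) (by
        filter_upwards [H.isOpen.mem_nhds ht] with v hv using H.ds_pot g s hv)).deriv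
  rw [← (H.smooth_pot hg).ds_dt_comm H.isOpen ht] at hρR
  have hρt := (H.dt_speed (H.smooth_potDD hg) ht hvel s).1
  have hRt := H.speed_mul_dt_pot hg ht hvel s
  rw [hE, hρR, H.ds_potD g s ht, H.ds_potDD g s ht, energyRate]
  simp only [Pi.pow_apply, Pi.mul_apply, Nat.cast_ofNat, Nat.add_one_sub_one, pow_one]
  linear_combination 2 * potDD g c f s t * hRt + potD g c f s t ^ 2 * hρt

theorem smooth_energyRate (H : IsCurveFlow I L c f) (hg : ContDiffOn ℝ ∞ g {0}ᶜ) :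
    SmoothFor I (energyRate g c f) := by
  have hG := H.smooth_aniso hg
  have hr := H.smooth_potD hg
  have hV := H.smooth_potDD hg
  have hZ := H.smooth_potDDD hg
  have hW := H.smooth_tangVel
  have hk := H.smooth_curv
  have hρ := H.smooth_speed
  have h2 : ∀ x : ℝ, SmoothFor I fun _ _ => x := fun x => SmoothFor.of_contDiff contDiff_const
  exact ((((((h2 (-2)).mul ((hρ.mul hG).mul (hZ.pow 2))).add
    ((h2 2).mul ((hV.mul hW).mul (H.smooth_forcing.ds H.isOpen)))).add
    ((h2 2).mul (((hG.mul (hk.pow 2)).mul (hV.pow 2)).mul hρ))).sub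
    ((h2 2).mul ((hV.mul hρ).mul (H.smooth_forcing.dt H.isOpen)))).sub
    ((((hr.pow 2).mul hk).mul hV).mul hρ))

/-- The rate of change of the energy `∫ (∂_σ R)²` along the flow `V = ∂_σσ R`. -/
theorem hasDerivAt_energy (H : IsCurveFlow I L c f) (hg : ContDiffOn ℝ ∞ g {0}ᶜ) {t : ℝ}
    (ht : t ∈ I) (hvel : ∀ s, inner ℝ (dt c s t) (normal c s t) = potDD g c f s t) :
    HasDerivAt (fun t => ∫ s in (0)..L, speed c s t * potD g c f s t ^ 2)
      (∫ s in (0)..L, energyRate g c f s t) t := by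
  have hs : SmoothFor I fun s t => speed c s t * potD g c f s t ^ 2 :=
    H.smooth_speed.mul ((H.smooth_potD hg).pow 2)
  refine (hs.hasDerivAt_integral H.isOpen ht L).congr_deriv ?_
  have hd := (hs.dt H.isOpen).continuous_s ht
  have he := (H.smooth_energyRate hg).continuous_s ht
  have h0 := integral_deriv_periodic (L := L) (fun s => ?_) (H.dt_energy_density hg ht hvel) (hd.sub he)
  · rw [intervalIntegral.integral_sub (hd.intervalIntegrable _ _) (he.intervalIntegrable _ _)] at h0
    linarith
  · have h1 := H.periodic_potD g ht s
    have h2 := H.periodic_potDD g ht s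
    have h3 := H.periodic_potDDD g ht s
    have h4 := H.periodic_tangVel ht s
    have h5 := H.periodic_normal ht s
    have h6 := periodic_dt H.isOpen (fun t ht => H.periodic_pot g ht) t ht s
    simp only at h1 h2 h3 h4 h5 h6
    simp only [h1, h2, h3, h4, h5, h6]

end IsCurveFlow

open CurveFlow

/-! ### The boundary curves of a smooth flow -/

/-- The coefficient `g(ν) = D²φ(ν) τ · τ`, as a function of `ν`. -/
def anisoWeight (φ : Plane → ℝ) (v : Plane) : ℝ := hess φ v (rot v)

theorem IsAnisotropy.contDiffOn_anisoWeight {φ : Plane → ℝ} (hφ : IsAnisotropy φ) :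
    ContDiffOn ℝ ∞ (anisoWeight φ) {0}ᶜ := by
  have hr : ContDiffOn ℝ ∞ rot ({0}ᶜ : Set Plane) := rotCLM.contDiff.contDiffOn
  have h1 : ContDiffOn ℝ ∞ (fderiv ℝ φ) {0}ᶜ :=
    hφ.smooth.fderiv_of_isOpen isOpen_compl_singleton (by simp)
  have h2 : ContDiffOn ℝ ∞ (fderiv ℝ (fderiv ℝ φ)) {0}ᶜ :=
    h1.fderiv_of_isOpen isOpen_compl_singleton (by simp)
  exact (h2.clm_apply hr).clm_apply hr

/-- The curve `s ↦ γ s + h_t(γ s) ν_G(γ s)`, as a function of `s` and `t`. -/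
def graphCurve (G : Set Plane) (h : ℝ → Plane → ℝ) (γ : ℝ → Plane) (s t : ℝ) : Plane :=
  graphMap G (h t) (γ s)

/-- A time-dependent function along a curve. -/
def alongCurve (f : ℝ → Plane → ℝ) (γ : ℝ → Plane) (s t : ℝ) : ℝ := f t (γ s)

section Flow

variable {φ : Plane → ℝ} {G : Set Plane} {η T : ℝ} {ι : Type} {L : ι → ℝ} {γ : ι → ℝ → Plane}
  {f : ℝ → Plane → ℝ} {F : ℝ → Set Plane} {h : ℝ → Plane → ℝ}

theorem IsSmoothForcing.smoothFor (hF : IsSmoothForcing G f) (hP : IsBoundaryParam G L γ) (i : ι) :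
    SmoothFor (Ioo 0 T) (alongCurve f (γ i)) :=
  ContDiffOn.comp (g := fun p : Plane × ℝ => f p.2 p.1) hF
    (((hP.smooth i).comp contDiff_fst).prodMk contDiff_snd).contDiffOn
    fun q hq => ⟨hP.mem_frontier i q.1, hq.2.1.le⟩

theorem IsSmoothFlow.isCurveFlow (hf : IsSmoothFlow G η T F h) (hF : IsSmoothForcing G f)
    (hG : IsSmoothSet G) (hη : IsTubularRadius G η) (hP : IsBoundaryParam G L γ)
    (hγ : ∀ i s, ‖deriv (γ i) s‖ = 1) (i : ι) :
    IsCurveFlow (Ioo 0 T) (L i) (graphCurve G h (γ i)) (alongCurve f (γ i)) where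
  isOpen := isOpen_Ioo
  smooth := (SmoothFor.of_contDiff (hP.smooth i)).add
    (SmoothFor.smul (a := fun s t => h t (γ i s)) (hf.contDiffOn_height hP i)
      (SmoothFor.of_contDiff (hP.contDiff_normal hη i)))
  smooth_forcing := hF.smoothFor hP i
  regular s _ ht := (hf.isBoundaryParam hG hη hP hγ ht).deriv_ne_zero i s
  periodic _ ht := (hf.isBoundaryParam hG hη hP hγ ht).periodic i
  periodic_forcing t _ s := congrArg (f t) (hP.periodic i s)

theorem IsSmoothFlow.nearestPt_graphCurve (hf : IsSmoothFlow G η T F h) (hG : IsSmoothSet G)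
    (hη : IsTubularRadius G η) (hP : IsBoundaryParam G L γ) (i : ι) (s : ℝ) {t : ℝ}
    (ht : t ∈ Ioo 0 T) : nearestPt (frontier G) (graphCurve G h (γ i) s t) = γ i s :=
  hη.nearestPt_ray hG (hP.mem_frontier i s) (hf.abs_height_lt hη.pos ht (hP.mem_frontier i s))

theorem IsSmoothFlow.signedDistFrom_graphCurve (hf : IsSmoothFlow G η T F h) (hG : IsSmoothSet G)
    (hη : IsTubularRadius G η) (hP : IsBoundaryParam G L γ) (i : ι) (s : ℝ) {t : ℝ}
    (ht : t ∈ Ioo 0 T) : signedDistFrom G (graphCurve G h (γ i) s t) = h t (γ i s) :=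
  (hη.ray hG (hP.mem_frontier i s) (hf.abs_height_lt hη.pos ht (hP.mem_frontier i s))).2

theorem IsSmoothFlow.unitTangent_graphCurve (hf : IsSmoothFlow G η T F h) (hG : IsSmoothSet G)
    (hη : IsTubularRadius G η) (hP : IsBoundaryParam G L γ) (hγ : ∀ i s, ‖deriv (γ i) s‖ = 1)
    (i : ι) (s : ℝ) {t : ℝ} (ht : t ∈ Ioo 0 T) :
    unitTangent (F t) (graphCurve G h (γ i) s t) = tangent (graphCurve G h (γ i)) s t :=
  (hf.isBoundaryParam hG hη hP hγ ht).unitTangent_eq i s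

theorem IsSmoothFlow.outerNormal_graphCurve (hf : IsSmoothFlow G η T F h) (hG : IsSmoothSet G)
    (hη : IsTubularRadius G η) (hP : IsBoundaryParam G L γ) (hγ : ∀ i s, ‖deriv (γ i) s‖ = 1)
    (i : ι) (s : ℝ) {t : ℝ} (ht : t ∈ Ioo 0 T) :
    outerNormal (F t) (graphCurve G h (γ i) s t) = normal (graphCurve G h (γ i)) s t := by
  rw [outerNormal_eq_neg_rot, hf.unitTangent_graphCurve hG hη hP hγ i s ht, normal]

/-- The tangential derivative in terms of the parametrisation. -/
theorem IsSmoothFlow.tderiv_graphCurve [Fintype ι] {V : Type*} [NormedAddCommGroup V]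
    [NormedSpace ℝ V] (hf : IsSmoothFlow G η T F h) (hG : IsSmoothSet G) (hη : IsTubularRadius G η)
    (hP : IsBoundaryParam G L γ) (hγ : ∀ i s, ‖deriv (γ i) s‖ = 1) {u : Plane → V} {i : ι}
    {a : ℝ → ℝ → V} (ha : SmoothFor (Ioo 0 T) a) {t : ℝ} (ht : t ∈ Ioo 0 T)
    (hu : ∀ s, u (graphCurve G h (γ i) s t) = a s t) (s : ℝ) :
    tderiv (F t) u (graphCurve G h (γ i) s t) =
      (speed (graphCurve G h (γ i)) s t)⁻¹ • ds a s t := by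
  have h1 : (fun s => u (graphMap G (h t) (γ i s))) = fun s => a s t := funext hu
  have h2 := (hf.isBoundaryParam hG hη hP hγ ht).tderiv_eq (u := u) (i := i) (s := s)
    (by rw [h1]; exact (ha.contDiff_s ht).differentiable (by simp) s)
  rw [h1] at h2
  exact h2

theorem IsSmoothFlow.curvature_graphCurve [Fintype ι] (hf : IsSmoothFlow G η T F h)
    (hF : IsSmoothForcing G f) (hG : IsSmoothSet G) (hη : IsTubularRadius G η)
    (hP : IsBoundaryParam G L γ) (hγ : ∀ i s, ‖deriv (γ i) s‖ = 1)
    (i : ι) (s : ℝ) {t : ℝ} (ht : t ∈ Ioo 0 T) :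
    curvature (F t) (graphCurve G h (γ i) s t) = curv (graphCurve G h (γ i)) s t := by
  have H := hf.isCurveFlow hF hG hη hP hγ i
  rw [curvature, hf.unitTangent_graphCurve hG hη hP hγ i s ht,
    hf.tderiv_graphCurve hG hη hP hγ H.smooth_normal ht
      (fun s => hf.outerNormal_graphCurve hG hη hP hγ i s ht), real_inner_smul_left, curv]

theorem IsSmoothFlow.potential_graphCurve [Fintype ι] (hf : IsSmoothFlow G η T F h)
    (hF : IsSmoothForcing G f) (hG : IsSmoothSet G) (hη : IsTubularRadius G η)
    (hP : IsBoundaryParam G L γ) (hγ : ∀ i s, ‖deriv (γ i) s‖ = 1) (φ : Plane → ℝ)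
    (i : ι) (s : ℝ) {t : ℝ} (ht : t ∈ Ioo 0 T) :
    potential φ G (f t) (F t) (graphCurve G h (γ i) s t) =
      pot (anisoWeight φ) (graphCurve G h (γ i)) (alongCurve f (γ i)) s t := by
  rw [potential, anisoCurvature, hf.nearestPt_graphCurve hG hη hP i s ht,
    hf.curvature_graphCurve hF hG hη hP hγ i s ht, hf.outerNormal_graphCurve hG hη hP hγ i s ht,
    hf.unitTangent_graphCurve hG hη hP hγ i s ht, pot, anisoWeight, IsCurveFlow.rot_normal]
  rfl

theorem IsSmoothFlow.tderiv_potential [Fintype ι] (hf : IsSmoothFlow G η T F h)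
    (hF : IsSmoothForcing G f) (hG : IsSmoothSet G) (hη : IsTubularRadius G η)
    (hP : IsBoundaryParam G L γ) (hγ : ∀ i s, ‖deriv (γ i) s‖ = 1) (hφ : IsAnisotropy φ)
    (i : ι) (s : ℝ) {t : ℝ} (ht : t ∈ Ioo 0 T) :
    tderiv (F t) (potential φ G (f t) (F t)) (graphCurve G h (γ i) s t) =
      potD (anisoWeight φ) (graphCurve G h (γ i)) (alongCurve f (γ i)) s t := by
  have H := hf.isCurveFlow hF hG hη hP hγ i
  exact hf.tderiv_graphCurve hG hη hP hγ (H.smooth_pot hφ.contDiffOn_anisoWeight) ht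
    (fun s => hf.potential_graphCurve hF hG hη hP hγ φ i s ht) s

theorem IsSmoothFlow.tderiv_tderiv_potential [Fintype ι] (hf : IsSmoothFlow G η T F h)
    (hF : IsSmoothForcing G f) (hG : IsSmoothSet G) (hη : IsTubularRadius G η)
    (hP : IsBoundaryParam G L γ) (hγ : ∀ i s, ‖deriv (γ i) s‖ = 1) (hφ : IsAnisotropy φ)
    (i : ι) (s : ℝ) {t : ℝ} (ht : t ∈ Ioo 0 T) :
    tderiv (F t) (tderiv (F t) (potential φ G (f t) (F t))) (graphCurve G h (γ i) s t) =
      potDD (anisoWeight φ) (graphCurve G h (γ i)) (alongCurve f (γ i)) s t := by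
  have H := hf.isCurveFlow hF hG hη hP hγ i
  exact hf.tderiv_graphCurve hG hη hP hγ (H.smooth_potD hφ.contDiffOn_anisoWeight) ht
    (fun s => hf.tderiv_potential hF hG hη hP hγ hφ i s ht) s

theorem IsSmoothFlow.tderiv_tderiv_tderiv_potential [Fintype ι] (hf : IsSmoothFlow G η T F h)
    (hF : IsSmoothForcing G f) (hG : IsSmoothSet G) (hη : IsTubularRadius G η)
    (hP : IsBoundaryParam G L γ) (hγ : ∀ i s, ‖deriv (γ i) s‖ = 1) (hφ : IsAnisotropy φ)
    (i : ι) (s : ℝ) {t : ℝ} (ht : t ∈ Ioo 0 T) :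
    tderiv (F t) (tderiv (F t) (tderiv (F t) (potential φ G (f t) (F t))))
        (graphCurve G h (γ i) s t) =
      potDDD (anisoWeight φ) (graphCurve G h (γ i)) (alongCurve f (γ i)) s t := by
  have H := hf.isCurveFlow hF hG hη hP hγ i
  exact hf.tderiv_graphCurve hG hη hP hγ (H.smooth_potDD hφ.contDiffOn_anisoWeight) ht
    (fun s => hf.tderiv_tderiv_potential hF hG hη hP hγ hφ i s ht) s

theorem IsSmoothFlow.bdryIntegral_graphCurve [Fintype ι] (hf : IsSmoothFlow G η T F h)
    (hG : IsSmoothSet G) (hη : IsTubularRadius G η)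
    (hP : IsBoundaryParam G L γ) (hγ : ∀ i s, ‖deriv (γ i) s‖ = 1) {u : Plane → ℝ}
    {a : ι → ℝ → ℝ → ℝ} (ha : ∀ i, SmoothFor (Ioo 0 T) (a i)) {t : ℝ} (ht : t ∈ Ioo 0 T)
    (hu : ∀ i s, u (graphCurve G h (γ i) s t) = a i s t) :
    bdryIntegral (F t) u = ∑ i, ∫ s in (0)..(L i), speed (graphCurve G h (γ i)) s t * a i s t := by
  have h1 : ∀ i, (fun s => u (graphMap G (h t) (γ i s))) = fun s => a i s t := fun i =>
    funext (hu i)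
  rw [(hf.isBoundaryParam hG hη hP hγ ht).bdryIntegral_eq (u := u)
    (fun i => by rw [h1 i]; exact (ha i).continuous_s ht)]
  refine Finset.sum_congr rfl fun i _ => ?_
  congr 1
  funext s
  exact congrArg _ (hu i s)

/-- At fixed s the moving point always projects to γ(s), so the velocity of the parametrisation is
exactly the vector in the definition of the normal velocity. -/
theorem IsForcedFlow.inner_velocity [Fintype ι] (hf : IsForcedFlow φ G η T f F h)
    (hF : IsSmoothForcing G f) (hG : IsSmoothSet G) (hη : IsTubularRadius G η)
    (hP : IsBoundaryParam G L γ) (hγ : ∀ i s, ‖deriv (γ i) s‖ = 1) (hφ : IsAnisotropy φ)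
    (i : ι) (s : ℝ) {t : ℝ} (ht : t ∈ Ioo 0 T) :
    (inner ℝ (dt (graphCurve G h (γ i)) s t) (normal (graphCurve G h (γ i)) s t) : ℝ) =
      potDD (anisoWeight φ) (graphCurve G h (γ i)) (alongCurve f (γ i)) s t := by
  have h1 := hf.equation t ht _ ((hf.flow.isBoundaryParam hG hη hP hγ ht).mem_frontier i s)
  change normalVelocity G h (F t) t (graphCurve G h (γ i) s t) =
    tderiv (F t) (tderiv (F t) (potential φ G (f t) (F t))) (graphCurve G h (γ i) s t) at h1
  rw [hf.flow.tderiv_tderiv_potential hF hG hη hP hγ hφ i s ht, normalVelocity,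
    hf.flow.nearestPt_graphCurve hG hη hP i s ht,
    hf.flow.outerNormal_graphCurve hG hη hP hγ i s ht] at h1
  exact h1

/-- The rate of change of `∫ (∂_σ R)²` along the flow. -/
theorem IsForcedFlow.hasDerivAt_energy [Fintype ι] (hf : IsForcedFlow φ G η T f F h)
    (hF : IsSmoothForcing G f) (hG : IsSmoothSet G) (hη : IsTubularRadius G η)
    (hP : IsBoundaryParam G L γ) (hγ : ∀ i s, ‖deriv (γ i) s‖ = 1) (hφ : IsAnisotropy φ)
    {t : ℝ} (ht : t ∈ Ioo 0 T) :
    HasDerivAt (fun s => bdryIntegral (F s) fun x =>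
        tderiv (F s) (potential φ G (f s) (F s)) x ^ 2)
      (∑ i, ∫ s in (0)..(L i),
        energyRate (anisoWeight φ) (graphCurve G h (γ i)) (alongCurve f (γ i)) s t) t := by
  have h1 := HasDerivAt.fun_sum (u := Finset.univ) fun i _ =>
    (hf.flow.isCurveFlow hF hG hη hP hγ i).hasDerivAt_energy hφ.contDiffOn_anisoWeight ht
      fun s => hf.inner_velocity hF hG hη hP hγ hφ i s ht
  refine h1.congr_of_eventuallyEq ?_
  filter_upwards [isOpen_Ioo.mem_nhds ht] with v hv
  exact hf.flow.bdryIntegral_graphCurve hG hη hP hγ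
    (a := fun i s t =>
      potD (anisoWeight φ) (graphCurve G h (γ i)) (alongCurve f (γ i)) s t ^ 2)
    (fun i => ((hf.flow.isCurveFlow hF hG hη hP hγ i).smooth_potD
      hφ.contDiffOn_anisoWeight).pow 2) hv
    fun i s => congrArg (· ^ 2) (hf.flow.tderiv_potential hF hG hη hP hγ hφ i s hv)

end Flow

open CurveFlow

/-! ### The weighted area between two boundaries -/

/-- The Jacobian formula is applied to a map from `Plane` to itself; this identification carries the
resulting integral to ℝ × ℝ, where Fubini is used. -/
theorem measurePreserving_coords :
    MeasurePreserving (fun y : Plane => ((y 0, y 1) : ℝ × ℝ)) :=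
  (volume_preserving_finTwoArrow ℝ).comp
    (EuclideanSpace.volume_preserving_symm_measurableEquiv_toLp (Fin 2))

theorem measurableEmbedding_coords :
    MeasurableEmbedding (fun y : Plane => ((y 0, y 1) : ℝ × ℝ)) :=
  MeasurableEquiv.finTwoArrow.measurableEmbedding.comp
    (MeasurableEquiv.toLp 2 (Fin 2 → ℝ)).symm.measurableEmbedding

theorem det_plane (A : Plane →L[ℝ] Plane) {a b : Plane}
    (hA : ∀ v : Plane, A v = v 0 • a + v 1 • b) : A.det = a 0 * b 1 - a 1 * b 0 := by
  have h1 := LinearMap.det_toMatrix (EuclideanSpace.basisFun (Fin 2) ℝ).toBasis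
    (A : Plane →ₗ[ℝ] Plane)
  rw [Matrix.det_fin_two] at h1
  simp only [LinearMap.toMatrix_apply, OrthonormalBasis.coe_toBasis,
    OrthonormalBasis.coe_toBasis_repr_apply, EuclideanSpace.basisFun_repr,
    EuclideanSpace.basisFun_apply, ContinuousLinearMap.coe_coe, hA] at h1
  rw [ContinuousLinearMap.det, ← h1]
  simp
  ring

section Fermi

variable {G : Set Plane} {η : ℝ} {ι : Type} {L : ι → ℝ} {γ : ι → ℝ → Plane}

theorem hasFDerivAt_fermi (hG : IsSmoothSet G) (hη : IsTubularRadius G η)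
    (hP : IsBoundaryParam G L γ) (hγ : ∀ i s, ‖deriv (γ i) s‖ = 1) (i : ι) (y : Plane) :
    ∃ A : Plane →L[ℝ] Plane, HasFDerivAt (fun y : Plane => fermi G (γ i) (y 0) (y 1)) A y ∧
      (∀ v : Plane, A v = v 0 • ((1 + y 1 * curvatureAlong G (γ i) (y 0)) • deriv (γ i) (y 0)) +
        v 1 • outerNormal G (γ i (y 0))) := by
  have h0 : HasFDerivAt (fun y : Plane => y 0) (EuclideanSpace.proj (0 : Fin 2) : Plane →L[ℝ] ℝ) y :=
    (EuclideanSpace.proj (0 : Fin 2) : Plane →L[ℝ] ℝ).hasFDerivAt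
  have h1 : HasFDerivAt (fun y : Plane => y 1) (EuclideanSpace.proj (1 : Fin 2) : Plane →L[ℝ] ℝ) y :=
    (EuclideanSpace.proj (1 : Fin 2) : Plane →L[ℝ] ℝ).hasFDerivAt
  have hc := (((hP.differentiable i (y 0)).hasDerivAt).hasFDerivAt).comp y h0
  have hn := ((hP.hasDerivAt_normal hG hη hγ i (y 0)).hasFDerivAt).comp y h0
  refine ⟨_, hc.add (h1.smul hn), fun v => ?_⟩
  have hp : ∀ j : Fin 2, (EuclideanSpace.proj j : Plane →L[ℝ] ℝ) v = v j := fun _ => rfl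
  simp only [_root_.add_apply, ContinuousLinearMap.comp_apply, _root_.smul_apply,
    ContinuousLinearMap.smulRight_apply, ContinuousLinearMap.toSpanSingleton_apply, hp]
  module

theorem setIntegral_fermi_image (hG : IsSmoothSet G) (hη : IsTubularRadius G η)
    (hP : IsBoundaryParam G L γ) (hγ : ∀ i s, ‖deriv (γ i) s‖ = 1) (i : ι) {S : Set (ℝ × ℝ)}
    (hS : MeasurableSet S) (hSη : ∀ q ∈ S, |q.2| < η)
    (hinj : InjOn (fun q : ℝ × ℝ => fermi G (γ i) q.1 q.2) S) (u : Plane → ℝ) :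
    ∫ x in (fun q : ℝ × ℝ => fermi G (γ i) q.1 q.2) '' S, u x =
      ∫ q in S, (1 + q.2 * curvatureAlong G (γ i) q.1) * u (fermi G (γ i) q.1 q.2) := by
  set π : Plane → ℝ × ℝ := fun y => (y 0, y 1) with hπ
  choose A hA hAv using fun y => hasFDerivAt_fermi hG hη hP hγ i y
  have hsurj : π '' (π ⁻¹' S) = S := image_preimage_eq _ fun q => ⟨!₂[q.1, q.2], by simp [hπ]⟩
  have him : (fun q : ℝ × ℝ => fermi G (γ i) q.1 q.2) '' S =
      (fun y : Plane => fermi G (γ i) (y 0) (y 1)) '' (π ⁻¹' S) := by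
    conv_lhs => rw [← hsurj]
    rw [image_image]
  have hmeas : MeasurableSet (π ⁻¹' S) := measurePreserving_coords.measurable hS
  rw [him, integral_image_eq_integral_abs_det_fderiv_smul volume hmeas
    (fun y _ => (hA y).hasFDerivWithinAt),
    ← measurePreserving_coords.setIntegral_preimage_emb measurableEmbedding_coords]
  · refine setIntegral_congr_fun hmeas fun y hy => ?_
    have hpos : 0 < 1 + y 1 * curvatureAlong G (γ i) (y 0) := one_add_mul_curvatureAlong_pos hG hη hP hγ i (y 0) (hSη _ hy)
    -- The columns are (1 + rκ)τ and ν; since τ = rot ν, the pair (τ, ν) is negatively oriented,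
    -- whence the sign.
    have hdet : (A y).det = -(1 + y 1 * curvatureAlong G (γ i) (y 0)) := by
      rw [det_plane (A y) (hAv y), ← hP.rot_normal hγ]
      have hn := hP.norm_normal hG i (y 0)
      have h2 : outerNormal G (γ i (y 0)) 0 ^ 2 + outerNormal G (γ i (y 0)) 1 ^ 2 = 1 := by
        rw [← norm_sq_plane, hn, one_pow]
      simp only [PiLp.smul_apply, smul_eq_mul, rot_apply_zero, rot_apply_one]
      linear_combination (-(1 + y 1 * curvatureAlong G (γ i) (y 0))) * h2
    simp only [hdet, abs_neg, abs_of_pos hpos, smul_eq_mul]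
  · intro y hy z hz hyz
    have h1 : π y = π z := hinj hy hz hyz
    exact plane_ext (congrArg Prod.fst h1) (congrArg Prod.snd h1)

end Fermi

theorem Iio_symmDiff_Iio_zero (b : ℝ) : Iio b ∆ Iio 0 = Ico (min 0 b) (max 0 b) := by
  ext r
  simp only [mem_symmDiff, mem_Iio, mem_Ico, min_le_iff, lt_max_iff, not_lt]
  constructor
  · rintro (⟨h1, h2⟩ | ⟨h1, h2⟩)
    · exact ⟨Or.inl h2, Or.inr h1⟩
    · exact ⟨Or.inr h2, Or.inl h1⟩
  · rintro ⟨h1 | h1, h2 | h2⟩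
    · linarith
    · exact Or.inl ⟨h2, h1⟩
    · exact Or.inr ⟨h2, h1⟩
    · linarith

/-- For b < 0 the sign of |r| and the orientation of the interval change together, so the value is
one polynomial in b. This is why the weighted area is smooth in time even where h changes sign. -/
theorem setIntegral_weighted_abs (κ b : ℝ) :
    ∫ r in Ico (min 0 b) (max 0 b), (1 + r * κ) * |r| = b ^ 2 / 2 + κ * b ^ 3 / 3 := by
  have hF : ∀ x : ℝ, HasDerivAt (fun r : ℝ => r ^ 2 / 2 + κ * r ^ 3 / 3) ((1 + x * κ) * x) x := by
    intro x
    refine ((((hasDerivAt_id x).pow 2).div_const 2).add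
      ((((hasDerivAt_id x).pow 3).const_mul κ).div_const 3)).congr_deriv ?_
    simp
    ring
  have hc : Continuous fun x : ℝ => (1 + x * κ) * x := by fun_prop
  rw [integral_Ico_eq_integral_Ioc]
  rcases le_total 0 b with hb | hb
  · rw [min_eq_left hb, max_eq_right hb, ← intervalIntegral.integral_of_le hb]
    rw [intervalIntegral.integral_congr (g := fun x => (1 + x * κ) * x),
      intervalIntegral.integral_eq_sub_of_hasDerivAt (fun x _ => hF x) (hc.intervalIntegrable _ _)]
    · ring
    · intro x hx
      rw [uIcc_of_le hb] at hx
      simp only [abs_of_nonneg hx.1]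
  · rw [min_eq_right hb, max_eq_left hb, ← intervalIntegral.integral_of_le hb]
    rw [intervalIntegral.integral_congr (g := fun x => -((1 + x * κ) * x)),
      intervalIntegral.integral_neg,
      intervalIntegral.integral_eq_sub_of_hasDerivAt (fun x _ => hF x) (hc.intervalIntegrable _ _)]
    · ring
    · intro x hx
      rw [uIcc_of_le hb] at hx
      simp only [abs_of_nonpos hx.2, mul_neg]

/-- The part of the strip over `[0, L)` between `0` and the graph of `b`. -/
def betweenGraph (L : ℝ) (b : ℝ → ℝ) : Set (ℝ × ℝ) :=
  {q | q.1 ∈ Ico 0 L ∧ q.2 ∈ Iio (b q.1) ∆ Iio 0}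

theorem measurableSet_betweenGraph (L : ℝ) {b : ℝ → ℝ} (hb : Continuous b) :
    MeasurableSet (betweenGraph L b) := by
  have h1 : MeasurableSet {q : ℝ × ℝ | q.2 < b q.1} :=
    measurableSet_lt measurable_snd (hb.measurable.comp measurable_fst)
  have h2 : MeasurableSet {q : ℝ × ℝ | q.2 < 0} := measurableSet_lt measurable_snd measurable_const
  exact (measurable_fst measurableSet_Ico).inter (h1.symmDiff h2)

theorem abs_le_of_mem_symmDiff {b r : ℝ} (h : r ∈ Iio b ∆ Iio 0) : |r| ≤ |b| := by
  rw [Iio_symmDiff_Iio_zero, mem_Ico, min_le_iff, lt_max_iff] at h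
  rw [abs_le]
  have h1 := neg_abs_le b
  have h2 := le_abs_self b
  have h3 := abs_nonneg b
  constructor
  · rcases h.1 with h | h <;> linarith
  · rcases h.2 with h | h <;> linarith

theorem setIntegral_betweenGraph {L M : ℝ} (hL : 0 ≤ L) {b κ : ℝ → ℝ} (hb : Continuous b)
    (hκ : Continuous κ) (hM : ∀ s, |b s| ≤ M) :
    ∫ q in betweenGraph L b, (1 + q.2 * κ q.1) * |q.2| =
      ∫ s in (0)..L, b s ^ 2 / 2 + κ s * b s ^ 3 / 3 := by
  have hmeas := measurableSet_betweenGraph L hb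
  have hsub : betweenGraph L b ⊆ Icc 0 L ×ˢ Icc (-M) M := fun q hq =>
    ⟨Ico_subset_Icc_self hq.1, abs_le.1 ((abs_le_of_mem_symmDiff hq.2).trans (hM _))⟩
  have hint : IntegrableOn (fun q : ℝ × ℝ => (1 + q.2 * κ q.1) * |q.2|) (betweenGraph L b) := by
    have hc : Continuous fun q : ℝ × ℝ => (1 + q.2 * κ q.1) * |q.2| := by fun_prop
    exact (hc.continuousOn.integrableOn_compact (isCompact_Icc.prod isCompact_Icc)).mono_set hsub
  rw [← integral_indicator hmeas, Measure.volume_eq_prod, integral_prod _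
    ((integrable_indicator_iff hmeas).2 hint), intervalIntegral.integral_of_le hL,
    ← integral_Ico_eq_integral_Ioc, ← integral_indicator measurableSet_Ico]
  congr 1
  funext s
  by_cases hs : s ∈ Ico 0 L
  · rw [indicator_of_mem hs, ← setIntegral_weighted_abs, ← integral_indicator measurableSet_Ico]
    congr 1
    funext r
    by_cases hr : r ∈ Ico (min 0 (b s)) (max 0 (b s))
    · rw [indicator_of_mem hr, indicator_of_mem]
      exact ⟨hs, by rw [Iio_symmDiff_Iio_zero]; exact hr⟩
    · rw [indicator_of_notMem hr, indicator_of_notMem]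
      exact fun h => hr (by rw [← Iio_symmDiff_Iio_zero]; exact h.2)
  · rw [indicator_of_notMem hs]
    have : ∀ r : ℝ, (betweenGraph L b).indicator (fun q : ℝ × ℝ => (1 + q.2 * κ q.1) * |q.2|) (s, r)
        = 0 := fun r => indicator_of_notMem (fun h => hs h.1) _
    simp only [this, integral_zero]

open CurveFlow

/-! ### The weighted area of the symmetric difference -/

/-- A set without boundary is clopen, and the plane is connected and unbounded. -/
theorem eq_empty_of_frontier_eq_empty {A : Set Plane} (hA : Bornology.IsBounded A)
    (h : frontier A = ∅) : A = ∅ := by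
  rcases isClopen_iff.1 (isClopen_iff_frontier_eq_empty.2 h) with h | h
  · exact h
  · exact absurd (h ▸ hA) (NormedSpace.unbounded_univ ℝ Plane)

section Flow

variable {φ : Plane → ℝ} {G : Set Plane} {η T : ℝ} {ι : Type} {L : ι → ℝ} {γ : ι → ℝ → Plane}
  {f : ℝ → Plane → ℝ} {F : ℝ → Set Plane} {h : ℝ → Plane → ℝ}

/-- In Fermi coordinates F_t is {r < h} and `G` is {r < 0}, and every point between the two graphs
lies in the tube. -/
theorem IsSmoothFlow.symmDiff_eq (hf : IsSmoothFlow G η T F h) (hG : IsSmoothSet G)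
    (hη : IsTubularRadius G η) (hP : IsBoundaryParam G L γ) (hγ : ∀ i s, ‖deriv (γ i) s‖ = 1)
    (hne : (frontier G).Nonempty) {t : ℝ} (ht : t ∈ Ioo 0 T) :
    F t ∆ G = ⋃ i, (fun q : ℝ × ℝ => fermi G (γ i) q.1 q.2) ''
      betweenGraph (L i) fun s => h t (γ i s) := by
  have hb : ∀ x ∈ frontier G, |h t x| < η := fun x hx => hf.abs_height_lt hη.pos ht hx
  have hmem : ∀ x, x ∈ F t ∆ G ↔
      signedDistFrom G x ∈ Iio (h t (nearestPt (frontier G) x)) ∆ Iio 0 := by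
    intro x
    rw [hf.set_eq hG hη hP hγ hne ht, mem_symmDiff, mem_symmDiff, mem_Iio, mem_Iio,
      signedDistFrom_neg_iff hG.isOpen hne]
    rfl
  ext x
  rw [hmem, mem_iUnion]
  constructor
  · intro hx
    have hxt : x ∈ thickening η (frontier G) := by
      apply mem_thickening_of_infDist_lt hne
      rw [← abs_signedDistFrom]
      exact (abs_le_of_mem_symmDiff hx).trans_lt (hb _ (nearestPt_mem hne x))
    obtain ⟨i, s, hs, hsq⟩ := mem_iUnion.1 (hP.frontier_eq ▸ (hη.nearestPt_spec hxt).1 :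
      nearestPt (frontier G) x ∈ ⋃ i, γ i '' Ico 0 (L i))
    refine ⟨i, (s, signedDistFrom G x), ⟨hs, ?_⟩, ?_⟩
    · simp only [hsq]
      exact hx
    · simp only [fermi, hsq]
      exact (hη.eq_ray hG hP hγ hxt).symm
  · rintro ⟨i, ⟨s, r⟩, ⟨-, hr⟩, rfl⟩
    have hrη : |r| < η := (abs_le_of_mem_symmDiff hr).trans_lt (hb _ (hP.mem_frontier i s))
    simp only [signedDistFrom_fermi hG hη hP hrη, nearestPt_fermi hG hη hP hrη]
    exact hr

theorem IsSmoothFlow.integral_symmDiff [Fintype ι] (hf : IsSmoothFlow G η T F h)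
    (hG : IsSmoothSet G) (hη : IsTubularRadius G η) (hP : IsBoundaryParam G L γ)
    (hγ : ∀ i s, ‖deriv (γ i) s‖ = 1) {t : ℝ} (ht : t ∈ Ioo 0 T) :
    ∫ x in F t ∆ G, infDist x (frontier G) = ∑ i, ∫ s in (0)..(L i),
      (h t (γ i s) ^ 2 / 2 + curvatureAlong G (γ i) s * h t (γ i s) ^ 3 / 3) := by
  -- With empty boundary there are no curves and F_t and `G` are both empty, so both sides are 0.
  rcases (frontier G).eq_empty_or_nonempty with h0 | hne
  · have h1 : IsEmpty ι := ⟨fun i => by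
      have := hP.mem_frontier i 0
      rw [h0] at this
      exact this⟩
    have h2 : F t = ∅ := by
      refine eq_empty_of_frontier_eq_empty (hf.smooth_set t ⟨ht.1.le, ht.2⟩).bounded ?_
      rw [hf.boundary t ⟨ht.1.le, ht.2⟩, h0, image_empty]
    rw [h2, eq_empty_of_frontier_eq_empty hG.bounded h0]
    simp
  have hb : ∀ i s, |h t (γ i s)| ≤ η / 2 := fun i s =>
    hf.height_le t ⟨ht.1.le, ht.2⟩ _ (hP.mem_frontier i s)
  have hbc : ∀ i, Continuous fun s => h t (γ i s) := fun i => (hf.contDiff_height hP i ht).continuous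
  have hη0 := hη.pos
  have hr : ∀ i, ∀ q ∈ betweenGraph (L i) (fun s => h t (γ i s)), |q.2| < η := fun i q hq =>
    ((abs_le_of_mem_symmDiff hq.2).trans (hb i _)).trans_lt (by linarith)
  have hinj : ∀ i, InjOn (fun q : ℝ × ℝ => fermi G (γ i) q.1 q.2)
      (betweenGraph (L i) fun s => h t (γ i s)) := by
    intro i p hp q hq hpq
    have h1 := congrArg (nearestPt (frontier G)) hpq
    have h2 := congrArg (signedDistFrom G) hpq
    simp only [nearestPt_fermi hG hη hP (hr i p hp), nearestPt_fermi hG hη hP (hr i q hq)] at h1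
    simp only [signedDistFrom_fermi hG hη hP (hr i p hp),
      signedDistFrom_fermi hG hη hP (hr i q hq)] at h2
    exact Prod.ext (hP.injOn i hp.1 hq.1 h1) h2
  have hcont : ∀ i, Continuous fun q : ℝ × ℝ => fermi G (γ i) q.1 q.2 := fun i =>
    ((hP.continuous i).comp continuous_fst).add
      (continuous_snd.smul ((hP.contDiff_normal hη i).continuous.comp continuous_fst))
  have hmeas := fun i => measurableSet_betweenGraph (L i) (hbc i)
  have hint : IntegrableOn (fun x => infDist x (frontier G)) (F t ∆ G) := by
    obtain ⟨R, hR⟩ := ((hf.smooth_set t ⟨ht.1.le, ht.2⟩).bounded.union hG.bounded).subset_closedBall 0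
    refine IntegrableOn.mono_set ?_ (symmDiff_subset_union.trans hR)
    exact (continuous_infDist_pt _).continuousOn.integrableOn_compact (isCompact_closedBall 0 R)
  rw [hf.symmDiff_eq hG hη hP hγ hne ht] at hint ⊢
  rw [integral_iUnion_fintype]
  · refine Finset.sum_congr rfl fun i _ => ?_
    rw [setIntegral_fermi_image hG hη hP hγ i (hmeas i) (hr i) (hinj i),
      ← setIntegral_betweenGraph (hP.period_pos i).le (hbc i)
        (hP.contDiff_curvatureAlong hη i).continuous (hb i)]
    refine setIntegral_congr_fun (hmeas i) fun q hq => ?_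
    rw [← abs_signedDistFrom, signedDistFrom_fermi hG hη hP (hr i q hq)]
  · exact fun i => (hmeas i).image_of_continuousOn_injOn (hcont i).continuousOn (hinj i)
  · intro i j hij
    rw [Function.onFun, Set.disjoint_left]
    rintro _ ⟨p, hp, rfl⟩ ⟨q, hq, hqp⟩
    have h1 := congrArg (nearestPt (frontier G)) hqp
    simp only [nearestPt_fermi hG hη hP (hr i p hp), nearestPt_fermi hG hη hP (hr j q hq)] at h1
    exact hij (hP.index_eq h1).symm
  · exact fun i => hint.mono_set (subset_iUnion (fun j => (fun q : ℝ × ℝ => fermi G (γ j) q.1 q.2) ''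
      betweenGraph (L j) fun s => h t (γ j s)) i)

/-! ### The graph parametrisation -/

theorem IsSmoothFlow.smoothFor_height (hf : IsSmoothFlow G η T F h) (hP : IsBoundaryParam G L γ)
    (i : ι) : SmoothFor (Ioo 0 T) (alongCurve h (γ i)) := hf.contDiffOn_height hP i

theorem IsSmoothFlow.ds_graphCurve (hf : IsSmoothFlow G η T F h) (hG : IsSmoothSet G)
    (hη : IsTubularRadius G η) (hP : IsBoundaryParam G L γ) (hγ : ∀ i s, ‖deriv (γ i) s‖ = 1)
    (i : ι) (s : ℝ) {t : ℝ} (ht : t ∈ Ioo 0 T) :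
    ds (graphCurve G h (γ i)) s t =
      (1 + h t (γ i s) * curvatureAlong G (γ i) s) • deriv (γ i) s +
        ds (alongCurve h (γ i)) s t • outerNormal G (γ i s) :=
  (hf.hasDerivAt_graph hG hη hP hγ ht i s).deriv

theorem IsSmoothFlow.dt_graphCurve (hf : IsSmoothFlow G η T F h) (hP : IsBoundaryParam G L γ)
    (i : ι) (s : ℝ) {t : ℝ} (ht : t ∈ Ioo 0 T) :
    dt (graphCurve G h (γ i)) s t = dt (alongCurve h (γ i)) s t • outerNormal G (γ i s) :=
  ((((hf.smoothFor_height hP i).hasDerivAt_t isOpen_Ioo ht s).smul_const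
    (outerNormal G (γ i s))).const_add (γ i s)).deriv

theorem IsSmoothFlow.speed_sq (hf : IsSmoothFlow G η T F h) (hG : IsSmoothSet G)
    (hη : IsTubularRadius G η) (hP : IsBoundaryParam G L γ) (hγ : ∀ i s, ‖deriv (γ i) s‖ = 1)
    (i : ι) (s : ℝ) {t : ℝ} (ht : t ∈ Ioo 0 T) :
    speed (graphCurve G h (γ i)) s t ^ 2 =
      (1 + h t (γ i s) * curvatureAlong G (γ i) s) ^ 2 + ds (alongCurve h (γ i)) s t ^ 2 := by
  have hn := hP.norm_normal hG i s
  have h0 : (inner ℝ (outerNormal G (γ i s)) (rot (outerNormal G (γ i s))) : ℝ) = 0 :=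
    inner_rot_self _
  rw [speed, hf.ds_graphCurve hG hη hP hγ i s ht, ← hP.rot_normal hγ, ← real_inner_self_eq_norm_sq]
  simp only [inner_add_left, inner_add_right, real_inner_smul_left, real_inner_smul_right,
    real_inner_self_eq_norm_sq, norm_smul, norm_rot, hn, h0,
    real_inner_comm (outerNormal G (γ i s)) (rot _), mul_pow, Real.norm_eq_abs, sq_abs]
  ring

/-- The velocity is ∂_t h ν_G, and ρν_F = (1 + hκ)ν_G - ∂_s h τ_G. -/
theorem IsForcedFlow.speed_mul_potDD [Fintype ι] (hf : IsForcedFlow φ G η T f F h)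
    (hF : IsSmoothForcing G f) (hG : IsSmoothSet G) (hη : IsTubularRadius G η)
    (hP : IsBoundaryParam G L γ) (hγ : ∀ i s, ‖deriv (γ i) s‖ = 1) (hφ : IsAnisotropy φ)
    (i : ι) (s : ℝ) {t : ℝ} (ht : t ∈ Ioo 0 T) :
    speed (graphCurve G h (γ i)) s t *
        potDD (anisoWeight φ) (graphCurve G h (γ i)) (alongCurve f (γ i)) s t =
      (1 + h t (γ i s) * curvatureAlong G (γ i) s) * dt (alongCurve h (γ i)) s t := by
  have H := hf.flow.isCurveFlow hF hG hη hP hγ i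
  have hρ := (H.speed_pos s ht).ne'
  have hn := hP.norm_normal hG i s
  have h0 : (inner ℝ (outerNormal G (γ i s)) (rot (outerNormal G (γ i s))) : ℝ) = 0 :=
    inner_rot_self _
  rw [← hf.inner_velocity hF hG hη hP hγ hφ i s ht, hf.flow.dt_graphCurve hP i s ht, normal, tangent,
    hf.flow.ds_graphCurve hG hη hP hγ i s ht, ← hP.rot_normal hγ]
  simp only [rot_smul, rot_add, rot_rot, inner_neg_right, inner_add_right, real_inner_smul_left,
    real_inner_smul_right, real_inner_self_eq_norm_sq, hn, h0]
  field_simp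
  ring

/-- The points move along ν_G, so ρW = ∂_t h ∂_s h. Eliminating ∂_t h through the normal velocity
bounds W by V and the slope of the graph, with no estimate on ∂_t h. -/
theorem IsForcedFlow.tangVel_graphCurve [Fintype ι] (hf : IsForcedFlow φ G η T f F h)
    (hF : IsSmoothForcing G f) (hG : IsSmoothSet G) (hη : IsTubularRadius G η)
    (hP : IsBoundaryParam G L γ) (hγ : ∀ i s, ‖deriv (γ i) s‖ = 1) (hφ : IsAnisotropy φ)
    (i : ι) (s : ℝ) {t : ℝ} (ht : t ∈ Ioo 0 T) :
    (1 + h t (γ i s) * curvatureAlong G (γ i) s) * tangVel (graphCurve G h (γ i)) s t =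
      potDD (anisoWeight φ) (graphCurve G h (γ i)) (alongCurve f (γ i)) s t *
        ds (alongCurve h (γ i)) s t := by
  have H := hf.flow.isCurveFlow hF hG hη hP hγ i
  have hρ := (H.speed_pos s ht).ne'
  have hn := hP.norm_normal hG i s
  have h0 : (inner ℝ (outerNormal G (γ i s)) (rot (outerNormal G (γ i s))) : ℝ) = 0 :=
    inner_rot_self _
  have h1 := hf.speed_mul_potDD hF hG hη hP hγ hφ i s ht
  have h2 : speed (graphCurve G h (γ i)) s t * tangVel (graphCurve G h (γ i)) s t =
      dt (alongCurve h (γ i)) s t * ds (alongCurve h (γ i)) s t := by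
    rw [tangVel, hf.flow.dt_graphCurve hP i s ht, tangent, hf.flow.ds_graphCurve hG hη hP hγ i s ht,
      ← hP.rot_normal hγ]
    simp only [inner_add_right, real_inner_smul_left,
      real_inner_smul_right, real_inner_self_eq_norm_sq, hn, h0]
    field_simp
    ring
  apply mul_left_cancel₀ hρ
  linear_combination (1 + h t (γ i s) * curvatureAlong G (γ i) s) * h2 -
    ds (alongCurve h (γ i)) s t * h1

end Flow

/-! ### Cauchy–Schwarz for sums of weighted integrals -/

theorem sq_le_mul_of_quadratic_nonneg {A B C : ℝ} (h : ∀ a : ℝ, 0 ≤ A * (a * a) + 2 * B * a + C) :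
    B ^ 2 ≤ A * C := by
  have := discrim_le_zero h
  rw [discrim] at this
  linarith

/-- The sum of weighted integrals of (au + v)² is a nonnegative quadratic polynomial in a; its
discriminant is at most 0. -/
theorem sum_integral_cauchy_schwarz {ι : Type} [Fintype ι] {L : ι → ℝ} (hL : ∀ i, 0 ≤ L i)
    {ρ u v : ι → ℝ → ℝ} (hρ : ∀ i, Continuous (ρ i)) (hρ0 : ∀ i s, 0 ≤ ρ i s)
    (hu : ∀ i, Continuous (u i)) (hv : ∀ i, Continuous (v i)) :
    (∑ i, ∫ s in (0)..(L i), ρ i s * (u i s * v i s)) ^ 2 ≤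
      (∑ i, ∫ s in (0)..(L i), ρ i s * u i s ^ 2) * ∑ i, ∫ s in (0)..(L i), ρ i s * v i s ^ 2 := by
  apply sq_le_mul_of_quadratic_nonneg
  intro a
  have h1 : 0 ≤ ∑ i, ∫ s in (0)..(L i), ρ i s * (a * u i s + v i s) ^ 2 :=
    Finset.sum_nonneg fun i _ => intervalIntegral.integral_nonneg (hL i) fun s _ =>
      mul_nonneg (hρ0 i s) (sq_nonneg _)
  refine h1.trans_eq ?_
  rw [Finset.sum_mul, Finset.mul_sum, Finset.sum_mul, ← Finset.sum_add_distrib,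
    ← Finset.sum_add_distrib]
  refine Finset.sum_congr rfl fun i _ => ?_
  have hI : ∀ {w : ℝ → ℝ}, Continuous w → IntervalIntegrable w volume 0 (L i) := fun hw =>
    hw.intervalIntegrable _ _
  have c1 : Continuous fun s => ρ i s * u i s ^ 2 := (hρ i).mul ((hu i).pow 2)
  have c2 : Continuous fun s => ρ i s * (u i s * v i s) := (hρ i).mul ((hu i).mul (hv i))
  have c3 : Continuous fun s => ρ i s * v i s ^ 2 := (hρ i).mul ((hv i).pow 2)
  rw [← intervalIntegral.integral_mul_const, ← intervalIntegral.integral_const_mul,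
    ← intervalIntegral.integral_mul_const,
    ← intervalIntegral.integral_add (hI (c1.mul_const _)) (hI ((c2.const_mul _).mul_const _)),
    ← intervalIntegral.integral_add
      ((hI (c1.mul_const _)).add (hI ((c2.const_mul _).mul_const _))) (hI c3)]
  congr 1
  funext s
  ring

open CurveFlow

/-! ### The rate of change of the weighted area -/

theorem integral_mul_deriv_periodic {u v u' v' : ℝ → ℝ} {L : ℝ} (hu : Function.Periodic u L)
    (hv : Function.Periodic v L) (hud : ∀ s, HasDerivAt u (u' s) s)
    (hvd : ∀ s, HasDerivAt v (v' s) s) (hu' : Continuous u') (hv' : Continuous v') :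
    ∫ s in (0)..L, u s * v' s = -∫ s in (0)..L, u' s * v s := by
  have hv0 : v L = v 0 := by simpa using hv 0
  have hu0 : u L = u 0 := by simpa using hu 0
  rw [intervalIntegral.integral_mul_deriv_eq_deriv_mul (fun s _ => hud s) (fun s _ => hvd s)
    (hu'.intervalIntegrable _ _) (hv'.intervalIntegrable _ _), hu0, hv0, sub_self, zero_sub]

section Flow

variable {φ : Plane → ℝ} {G : Set Plane} {η T : ℝ} {ι : Type} {L : ι → ℝ} {γ : ι → ℝ → Plane}
  {f : ℝ → Plane → ℝ} {F : ℝ → Set Plane} {h : ℝ → Plane → ℝ}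

theorem IsForcedFlow.bdryIntegral_dist_mul [Fintype ι] (hf : IsForcedFlow φ G η T f F h)
    (hF : IsSmoothForcing G f) (hG : IsSmoothSet G) (hη : IsTubularRadius G η)
    (hP : IsBoundaryParam G L γ) (hγ : ∀ i s, ‖deriv (γ i) s‖ = 1) (hφ : IsAnisotropy φ)
    {t : ℝ} (ht : t ∈ Ioo 0 T) :
    (bdryIntegral (F t) fun x => signedDistFrom G x *
        tderiv (F t) (tderiv (F t) (potential φ G (f t) (F t))) x) =
      ∑ i, ∫ s in (0)..(L i), speed (graphCurve G h (γ i)) s t * (alongCurve h (γ i) s t *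
        potDD (anisoWeight φ) (graphCurve G h (γ i)) (alongCurve f (γ i)) s t) :=
  hf.flow.bdryIntegral_graphCurve hG hη hP hγ
    (a := fun i s t => alongCurve h (γ i) s t *
      potDD (anisoWeight φ) (graphCurve G h (γ i)) (alongCurve f (γ i)) s t)
    (fun i => (hf.flow.smoothFor_height hP i).mul
      ((hf.flow.isCurveFlow hF hG hη hP hγ i).smooth_potDD hφ.contDiffOn_anisoWeight)) ht
    fun i s => by
      rw [hf.flow.signedDistFrom_graphCurve hG hη hP i s ht,
        hf.flow.tderiv_tderiv_potential hF hG hη hP hγ hφ i s ht, alongCurve]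

/-- The time derivative of h²/2 + κh³/3 is h(1 + κh)∂_t h = ρhV, and d_G = h on ∂F_t. -/
theorem IsForcedFlow.hasDerivAt_integral_symmDiff [Fintype ι] (hf : IsForcedFlow φ G η T f F h)
    (hF : IsSmoothForcing G f) (hG : IsSmoothSet G) (hη : IsTubularRadius G η)
    (hP : IsBoundaryParam G L γ) (hγ : ∀ i s, ‖deriv (γ i) s‖ = 1) (hφ : IsAnisotropy φ)
    {t : ℝ} (ht : t ∈ Ioo 0 T) :
    HasDerivAt (fun s => ∫ x in F s ∆ G, infDist x (frontier G))
      (bdryIntegral (F t) fun x => signedDistFrom G x *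
        tderiv (F t) (tderiv (F t) (potential φ G (f t) (F t))) x) t := by
  have hh : ∀ i, SmoothFor (Ioo 0 T) (alongCurve h (γ i)) := hf.flow.smoothFor_height hP
  have hκ : ∀ i, SmoothFor (Ioo 0 T) fun s _ => curvatureAlong G (γ i) s := fun i =>
    SmoothFor.of_contDiff (hP.contDiff_curvatureAlong hη i)
  have hc : ∀ x : ℝ, SmoothFor (Ioo 0 T) fun _ _ => x := fun x => SmoothFor.of_contDiff contDiff_const
  have ha : ∀ i, SmoothFor (Ioo 0 T) fun s t => alongCurve h (γ i) s t ^ 2 * 2⁻¹ +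
      curvatureAlong G (γ i) s * alongCurve h (γ i) s t ^ 3 * 3⁻¹ := fun i =>
    (((hh i).pow 2).mul (hc _)).add (((hκ i).mul ((hh i).pow 3)).mul (hc _))
  have h1 := HasDerivAt.fun_sum (u := Finset.univ) fun i _ =>
    (ha i).hasDerivAt_integral isOpen_Ioo ht (L i)
  rw [hf.bdryIntegral_dist_mul hF hG hη hP hγ hφ ht]
  refine (h1.congr_deriv ?_).congr_of_eventuallyEq ?_
  · refine Finset.sum_congr rfl fun i _ => ?_
    congr 1
    funext s
    have h2 := (hh i).hasDerivAt_t isOpen_Ioo ht s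
    have h3 : dt (fun s t => alongCurve h (γ i) s t ^ 2 * 2⁻¹ +
      curvatureAlong G (γ i) s * alongCurve h (γ i) s t ^ 3 * 3⁻¹) s t = _ :=
      (((h2.pow 2).mul_const (2⁻¹ : ℝ)).add
        (((h2.pow 3).const_mul (curvatureAlong G (γ i) s)).mul_const (3⁻¹ : ℝ))).deriv
    have h4 := hf.speed_mul_potDD hF hG hη hP hγ hφ i s ht
    rw [h3]
    simp only [Nat.cast_ofNat, Nat.add_one_sub_one, pow_one]
    have h5 : alongCurve h (γ i) s t = h t (γ i s) := rfl
    rw [h5]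
    linear_combination (-h t (γ i s)) * h4
  · filter_upwards [isOpen_Ioo.mem_nhds ht] with v hv
    exact hf.flow.integral_symmDiff hG hη hP hγ hv

/-- As ρV = ∂_s r, integration by parts moves the derivative onto h, with |∂_s h| ≤ ρ;
Cauchy-Schwarz with weight ρ is then applied to 1 and |r|. -/
theorem IsForcedFlow.bdryIntegral_dist_mul_le [Fintype ι] (hf : IsForcedFlow φ G η T f F h)
    (hF : IsSmoothForcing G f) (hG : IsSmoothSet G) (hη : IsTubularRadius G η)
    (hP : IsBoundaryParam G L γ) (hγ : ∀ i s, ‖deriv (γ i) s‖ = 1) (hφ : IsAnisotropy φ)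
    {t : ℝ} (ht : t ∈ Ioo 0 T) :
    (bdryIntegral (F t) fun x => signedDistFrom G x *
        tderiv (F t) (tderiv (F t) (potential φ G (f t) (F t))) x) ≤
      √(perimeter (F t)) *
        √(bdryIntegral (F t) fun x => tderiv (F t) (potential φ G (f t) (F t)) x ^ 2) := by
  set c := fun i => graphCurve G h (γ i) with hc
  set r := fun i => potD (anisoWeight φ) (c i) (alongCurve f (γ i)) with hr
  have H : ∀ i, IsCurveFlow (Ioo 0 T) (L i) (c i) (alongCurve f (γ i)) := fun i =>
    hf.flow.isCurveFlow hF hG hη hP hγ i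
  have hg := hφ.contDiffOn_anisoWeight
  have hL : ∀ i, 0 ≤ L i := fun i => (hP.period_pos i).le
  have hρc : ∀ i, Continuous fun s => speed (c i) s t := fun i => (H i).smooth_speed.continuous_s ht
  have hrc : ∀ i, Continuous fun s => r i s t := fun i => ((H i).smooth_potD hg).continuous_s ht
  have hCS := sum_integral_cauchy_schwarz (ρ := fun i s => speed (c i) s t)
    (u := fun _ _ => 1) (v := fun i s => |r i s t|) hL hρc (fun i s => norm_nonneg _)
    (fun i => continuous_const) (fun i => (hrc i).abs)
  simp only [one_pow, mul_one, one_mul, sq_abs] at hCS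
  have hper : perimeter (F t) = ∑ i, ∫ s in (0)..(L i), speed (c i) s t :=
    (hf.flow.isBoundaryParam hG hη hP hγ ht).perimeter_eq
  have hen : (bdryIntegral (F t) fun x => tderiv (F t) (potential φ G (f t) (F t)) x ^ 2) =
      ∑ i, ∫ s in (0)..(L i), speed (c i) s t * r i s t ^ 2 :=
    hf.flow.bdryIntegral_graphCurve hG hη hP hγ (a := fun i s t => r i s t ^ 2)
      (fun i => ((H i).smooth_potD hg).pow 2) ht
      fun i s => congrArg (· ^ 2) (hf.flow.tderiv_potential hF hG hη hP hγ hφ i s ht)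
  rw [← hper, ← hen] at hCS
  have hX := Real.le_sqrt_of_sq_le hCS
  rw [Real.sqrt_mul (show 0 ≤ perimeter (F t) from ENNReal.toReal_nonneg)] at hX
  refine le_trans ?_ hX
  rw [hf.bdryIntegral_dist_mul hF hG hη hP hγ hφ ht]
  refine Finset.sum_le_sum fun i _ => ?_
  have hh := hf.flow.smoothFor_height hP i
  have hh' := (hh.ds isOpen_Ioo).continuous_s ht
  have hr' := ((((H i).smooth_potD hg).ds isOpen_Ioo)).continuous_s ht
  have h1 : ∫ s in (0)..(L i), speed (c i) s t * (alongCurve h (γ i) s t *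
        potDD (anisoWeight φ) (c i) (alongCurve f (γ i)) s t) =
      ∫ s in (0)..(L i), alongCurve h (γ i) s t * ds (r i) s t := by
    congr 1
    funext s
    rw [(H i).ds_potD _ s ht]
    ring
  rw [h1, integral_mul_deriv_periodic (fun s => congrArg (h t) (hP.periodic i s))
    ((H i).periodic_potD _ ht) (fun s => hh.hasDerivAt_s isOpen_Ioo ht s)
    (fun s => ((H i).smooth_potD hg).hasDerivAt_s isOpen_Ioo ht s) hh' hr',
    ← intervalIntegral.integral_neg]
  refine intervalIntegral.integral_mono_on (hL i) ((hh'.mul (hrc i)).neg.intervalIntegrable _ _)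
    (((hρc i).mul (hrc i).abs).intervalIntegrable _ _) fun s _ => ?_
  have h2 : |ds (alongCurve h (γ i)) s t| ≤ speed (c i) s t := by
    apply abs_le_of_sq_le_sq _ (norm_nonneg _)
    change _ ≤ speed (c i) s t ^ 2
    rw [hf.flow.speed_sq hG hη hP hγ i s ht]
    exact le_add_of_nonneg_left (sq_nonneg _)
  calc -(ds (alongCurve h (γ i)) s t * r i s t)
      ≤ |ds (alongCurve h (γ i)) s t * r i s t| := neg_le_abs _
    _ = |ds (alongCurve h (γ i)) s t| * |r i s t| := abs_mul _ _
    _ ≤ _ := mul_le_mul_of_nonneg_right h2 (abs_nonneg _)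

end Flow

/-! ### The half-order Sobolev norm along the boundary -/

theorem setLIntegral_periodic {q : ℝ → ℝ≥0∞} {L : ℝ} (hL : 0 < L) (hq : Function.Periodic q L)
    (a b : ℝ) : ∫⁻ x in Ioc a (a + L), q x = ∫⁻ x in Ioc b (b + L), q x := by
  refine (isAddFundamentalDomain_Ioc hL a volume).setLIntegral_eq
    (isAddFundamentalDomain_Ioc hL b volume) q fun g x => ?_
  obtain ⟨n, hn⟩ := AddSubgroup.mem_zmultiples_iff.1 g.2
  change q ((g : ℝ) + x) = q x
  rw [← hn, add_comm]
  exact hq.zsmul n x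

theorem setLIntegral_Ioc_add_left (q : ℝ → ℝ≥0∞) (a b s : ℝ) :
    ∫⁻ r in Ioc a b, q (s + r) = ∫⁻ x in Ioc (s + a) (s + b), q x := by
  have h1 := (measurePreserving_add_left volume s).setLIntegral_comp_preimage_emb
    (measurableEmbedding_addLeft s) q (Ioc (s + a) (s + b))
  rw [preimage_const_add_Ioc, add_sub_cancel_left, add_sub_cancel_left] at h1
  exact h1

theorem setLIntegral_periodic_add {q : ℝ → ℝ≥0∞} {L : ℝ} (hL : 0 < L) (hq : Function.Periodic q L)
    (v : ℝ) : ∫⁻ s in Ioc 0 L, q (s + v) = ∫⁻ s in Ioc 0 L, q s := by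
  simp_rw [add_comm _ v]
  rw [setLIntegral_Ioc_add_left, add_zero, setLIntegral_periodic hL hq v 0, zero_add]

/-- The mean of u' over the segment replaces the difference quotient and stays continuous at r = 0.
-/
theorem sub_eq_mul_integral {E : Type*} [NormedAddCommGroup E] [NormedSpace ℝ E] [CompleteSpace E]
    {u u' : ℝ → E} (hu : ∀ s, HasDerivAt u (u' s) s) (hu' : Continuous u') (s r : ℝ) :
    u (s + r) - u s = r • ∫ θ in (0)..1, u' (s + θ * r) := by
  have h1 : ∀ θ : ℝ, HasDerivAt (fun θ : ℝ => u (s + θ * r)) (r • u' (s + θ * r)) θ := by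
    intro θ
    have h2 : HasDerivAt (fun θ : ℝ => s + θ * r) r θ := by
      simpa using ((hasDerivAt_id θ).mul_const r).const_add s
    exact (hu _).scomp θ h2
  have h3 := intervalIntegral.integral_eq_sub_of_hasDerivAt (a := 0) (b := 1) (fun θ _ => h1 θ)
    (Continuous.intervalIntegrable (by fun_prop) _ _)
  rw [intervalIntegral.integral_smul, one_mul, zero_mul, add_zero] at h3
  exact h3.symm

theorem sq_sub_le_mul_integral {u u' : ℝ → ℝ} (hu : ∀ s, HasDerivAt u (u' s) s)
    (hu' : Continuous u') (s r : ℝ) :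
    (u (s + r) - u s) ^ 2 ≤ r ^ 2 * ∫ θ in (0)..1, u' (s + θ * r) ^ 2 := by
  have h1 := sum_integral_cauchy_schwarz (ι := Unit) (L := fun _ => 1) (ρ := fun _ _ => 1)
    (u := fun _ _ => 1) (v := fun _ θ => u' (s + θ * r)) (fun _ => zero_le_one)
    (fun _ => continuous_const) (fun _ _ => zero_le_one) (fun _ => continuous_const)
    (fun _ => by fun_prop)
  simp only [one_mul, Finset.univ_unique, Finset.sum_singleton, one_pow,
    intervalIntegral.integral_const, sub_zero, smul_eq_mul] at h1
  rw [sub_eq_mul_integral hu hu', smul_eq_mul, mul_pow]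
  exact mul_le_mul_of_nonneg_left h1 (sq_nonneg r)

theorem enorm_sq_eq_ofReal (x : ℝ) : ‖x‖ₑ ^ 2 = ENNReal.ofReal (x ^ 2) := by
  rw [Real.enorm_eq_ofReal_abs, ← ENNReal.ofReal_pow (abs_nonneg x), sq_abs]

section Param

variable {G : Set Plane} {ι : Type} {L : ι → ℝ} {γ : ι → ℝ → Plane}

/-- The chord-arc condition for the boundary curves. -/
theorem IsBoundaryParam.exists_chord_arc (hP : IsBoundaryParam G L γ) (i : ι) :
    ∃ c : ℝ, 0 < c ∧ ∀ s ∈ Icc 0 (L i), ∀ r ∈ Icc (-(L i / 2)) (L i / 2),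
      c * |r| ≤ ‖γ i (s + r) - γ i s‖ := by
  have hL := hP.period_pos i
  have hd : Continuous (deriv (γ i)) := (hP.contDiff_one i).continuous_deriv (by simp)
  -- The length of the mean velocity is continuous on a compact rectangle. It is positive: for r = 0
  -- it is the speed, and for 0 < |r| ≤ L/2 a zero would give γ(s + r) = γ(s), so r would be a
  -- multiple of L. Its minimum is the chord-arc constant.
  have hΦ : Continuous fun q : ℝ × ℝ => ‖∫ θ in (0)..1, deriv (γ i) (q.1 + θ * q.2)‖ := by
    refine (intervalIntegral.continuous_parametric_intervalIntegral_of_continuous'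
      (f := fun (q : ℝ × ℝ) (θ : ℝ) => deriv (γ i) (q.1 + θ * q.2)) ?_ 0 1).norm
    exact hd.comp (f := fun p : (ℝ × ℝ) × ℝ => p.1.1 + p.2 * p.1.2) (by fun_prop)
  have heq := sub_eq_mul_integral (fun s => (hP.differentiable i s).hasDerivAt) hd
  obtain ⟨q, hq, hmin⟩ := (isCompact_Icc.prod isCompact_Icc).exists_isMinOn
    (s := Icc 0 (L i) ×ˢ Icc (-(L i / 2)) (L i / 2))
    ⟨(0, 0), ⟨le_rfl, hL.le⟩, ⟨by linarith, by linarith⟩⟩ hΦ.continuousOn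
  refine ⟨‖∫ θ in (0)..1, deriv (γ i) (q.1 + θ * q.2)‖, ?_, fun s hs r hr => ?_⟩
  · rw [norm_pos_iff]
    intro h0
    by_cases hr0 : q.2 = 0
    · rw [hr0] at h0
      simp only [mul_zero, add_zero, intervalIntegral.integral_const, sub_zero, one_smul] at h0
      exact hP.deriv_ne_zero i _ h0
    · have h1 := heq q.1 q.2
      rw [h0, smul_zero, sub_eq_zero] at h1
      obtain ⟨n, hn⟩ := hP.exists_zsmul_of_eq h1
      have h2 : q.2 = -(n * L i) := by linarith
      have h3 : |(n : ℝ)| * L i ≤ L i / 2 := by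
        have := abs_le.2 hq.2
        rwa [h2, abs_neg, abs_mul, abs_of_pos hL] at this
      have h4 : |(n : ℝ)| < 1 := by nlinarith
      have h5 : n = 0 := Int.abs_lt_one_iff.1 (by exact_mod_cast h4)
      rw [h5] at h2
      exact hr0 (by simpa using h2)
  · rw [heq, norm_smul, Real.norm_eq_abs, mul_comm]
    have h1 := isMinOn_iff.1 hmin (s, r) ⟨hs, hr⟩
    exact mul_le_mul_of_nonneg_left h1 (abs_nonneg r)

/-- The contribution of pairs of points on the same curve to the Gagliardo seminorm. -/
theorem IsBoundaryParam.exists_gagliardo_self_le (hP : IsBoundaryParam G L γ) (i : ι) :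
    ∃ C : ℝ≥0, ∀ u u' : ℝ → ℝ, Function.Periodic u (L i) → (∀ s, HasDerivAt u (u' s) s) →
      Continuous u' →
      ∫⁻ s in Ioc 0 (L i), ∫⁻ v in Ioc 0 (L i), ‖u s - u v‖ₑ ^ 2 / edist (γ i s) (γ i v) ^ 2 ≤
        C * ∫⁻ s in Ioc 0 (L i), ‖u' s‖ₑ ^ 2 := by
  obtain ⟨c, hc, hchord⟩ := hP.exists_chord_arc i
  have hL := hP.period_pos i
  refine ⟨Real.toNNReal ((c ^ 2)⁻¹ * L i), fun u u' hper hu hu' => ?_⟩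
  have hper' : Function.Periodic u' (L i) := fun s => by
    have h1 := (hu (s + L i)).comp_add_const s (L i)
    simp only [hper _] at h1
    exact h1.unique (hu s)
  -- The factor r² from Cauchy-Schwarz cancels the squared chord, which is at least c²r².
  have hpt : ∀ s ∈ Ioc 0 (L i), ∀ r ∈ Ioc (-(L i / 2)) (L i / 2),
      ‖u s - u (s + r)‖ₑ ^ 2 / edist (γ i s) (γ i (s + r)) ^ 2 ≤
        ENNReal.ofReal (c ^ 2)⁻¹ * ∫⁻ θ in Ioc (0 : ℝ) 1, ‖u' (s + θ * r)‖ₑ ^ 2 := by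
    intro s hs r hr
    have h1 := sq_sub_le_mul_integral hu hu' s r
    have hcθ : Continuous fun θ : ℝ => u' (s + θ * r) ^ 2 := by fun_prop
    have h2 : ∫⁻ θ in Ioc (0 : ℝ) 1, ‖u' (s + θ * r)‖ₑ ^ 2 =
        ENNReal.ofReal (∫ θ in (0)..1, u' (s + θ * r) ^ 2) := by
      simp_rw [enorm_sq_eq_ofReal]
      rw [intervalIntegral.integral_of_le zero_le_one, ofReal_integral_eq_lintegral_ofReal
        (hcθ.integrableOn_Ioc) (ae_of_all _ fun θ => sq_nonneg _)]
    have h3 : ENNReal.ofReal (c * |r|) ≤ edist (γ i s) (γ i (s + r)) := by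
      rw [edist_dist, dist_comm, dist_eq_norm]
      exact ENNReal.ofReal_le_ofReal
        (hchord s (Ioc_subset_Icc_self hs) r (Ioc_subset_Icc_self hr))
    rw [h2]
    set J := ∫ θ in (0)..1, u' (s + θ * r) ^ 2 with hJ
    apply ENNReal.div_le_of_le_mul
    calc ‖u s - u (s + r)‖ₑ ^ 2 = ENNReal.ofReal ((u (s + r) - u s) ^ 2) := by
          rw [enorm_sq_eq_ofReal, ← neg_sub, neg_sq]
      _ ≤ ENNReal.ofReal (((c ^ 2)⁻¹ * J) * (c * |r|) ^ 2) := by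
          refine ENNReal.ofReal_le_ofReal (h1.trans_eq ?_)
          rw [mul_pow, sq_abs]
          field_simp
      _ = ENNReal.ofReal (c ^ 2)⁻¹ * ENNReal.ofReal J * ENNReal.ofReal (c * |r|) ^ 2 := by
          rw [ENNReal.ofReal_mul' (sq_nonneg _), ENNReal.ofReal_mul (by positivity),
            ENNReal.ofReal_pow (by positivity)]
      _ ≤ _ := by gcongr
  have hmeas : Measurable fun q : (ℝ × ℝ) × ℝ => ‖u' (q.1.1 + q.2 * q.1.2)‖ₑ ^ 2 := by
    have : Continuous fun q : (ℝ × ℝ) × ℝ => u' (q.1.1 + q.2 * q.1.2) := by fun_prop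
    exact (this.measurable.enorm).pow_const 2
  calc ∫⁻ s in Ioc 0 (L i), ∫⁻ v in Ioc 0 (L i), ‖u s - u v‖ₑ ^ 2 / edist (γ i s) (γ i v) ^ 2
      = ∫⁻ s in Ioc 0 (L i), ∫⁻ r in Ioc (-(L i / 2)) (L i / 2),
          ‖u s - u (s + r)‖ₑ ^ 2 / edist (γ i s) (γ i (s + r)) ^ 2 := by
        congr 1
        funext s
        -- By periodicity the inner integral may run over the period centred at s, which is the
        -- range of the chord-arc bound.
        rw [setLIntegral_Ioc_add_left (fun v => ‖u s - u v‖ₑ ^ 2 / edist (γ i s) (γ i v) ^ 2)]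
        have h1 := setLIntegral_periodic hL
          (q := fun v => ‖u s - u v‖ₑ ^ 2 / edist (γ i s) (γ i v) ^ 2)
          (fun v => by simp only [hper v, hP.periodic i v]) 0 (s + -(L i / 2))
        rw [zero_add, show s + -(L i / 2) + L i = s + L i / 2 by ring] at h1
        exact h1
    _ ≤ ∫⁻ s in Ioc 0 (L i), ∫⁻ r in Ioc (-(L i / 2)) (L i / 2),
          ENNReal.ofReal (c ^ 2)⁻¹ * ∫⁻ θ in Ioc (0 : ℝ) 1, ‖u' (s + θ * r)‖ₑ ^ 2 :=
        setLIntegral_mono' measurableSet_Ioc fun s hs =>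
          setLIntegral_mono' measurableSet_Ioc fun r hr => hpt s hs r hr
    -- Tonelli puts the integral over s innermost; over a full period it does not see the shift by
    -- θr.
    _ = ENNReal.ofReal (c ^ 2)⁻¹ * ∫⁻ r in Ioc (-(L i / 2)) (L i / 2), ∫⁻ θ in Ioc (0 : ℝ) 1,
          ∫⁻ s in Ioc 0 (L i), ‖u' (s + θ * r)‖ₑ ^ 2 := by
        have h1 : Measurable fun q : ℝ × ℝ => ∫⁻ θ in Ioc (0 : ℝ) 1, ‖u' (q.1 + θ * q.2)‖ₑ ^ 2 :=
          hmeas.lintegral_prod_right'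
        rw [lintegral_lintegral_swap (h1.const_mul _).aemeasurable]
        simp_rw [lintegral_const_mul' _ _ ENNReal.ofReal_ne_top]
        congr 2
        funext r
        refine lintegral_lintegral_swap (Measurable.aemeasurable ?_)
        exact hmeas.comp (f := fun q : ℝ × ℝ => ((q.1, r), q.2)) (by fun_prop)
    _ = ENNReal.ofReal ((c ^ 2)⁻¹ * L i) * ∫⁻ s in Ioc 0 (L i), ‖u' s‖ₑ ^ 2 := by
        have h1 : ∀ v : ℝ, ∫⁻ s in Ioc 0 (L i), ‖u' (s + v)‖ₑ ^ 2 =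
            ∫⁻ s in Ioc 0 (L i), ‖u' s‖ₑ ^ 2 := fun v =>
          setLIntegral_periodic_add hL (q := fun s => ‖u' s‖ₑ ^ 2)
            (fun s => by simp only [hper' s]) v
        simp_rw [h1, lintegral_const, Measure.restrict_apply MeasurableSet.univ, univ_inter,
          Real.volume_Ioc]
        rw [ENNReal.ofReal_mul (by positivity), show L i / 2 - -(L i / 2) = L i by ring]
        simp only [sub_zero, ENNReal.ofReal_one, mul_one]
        ring

/-- The contribution of pairs of points on different curves to the Gagliardo seminorm. -/
theorem IsBoundaryParam.exists_gagliardo_ne_le (hP : IsBoundaryParam G L γ) {i j : ι} (hij : i ≠ j) :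
    ∃ C : ℝ≥0, ∀ u v : ℝ → ℝ, Continuous u → Continuous v →
      ∫⁻ s in Ioc 0 (L i), ∫⁻ w in Ioc 0 (L j), ‖u s - v w‖ₑ ^ 2 / edist (γ i s) (γ j w) ^ 2 ≤
        C * ((∫⁻ s in Ioc 0 (L i), ‖u s‖ₑ ^ 2) + ∫⁻ s in Ioc 0 (L j), ‖v s‖ₑ ^ 2) := by
  have hcomp : ∀ i, IsCompact (range (γ i)) := fun i => by
    have h1 : γ i '' Icc 0 (L i) = range (γ i) := by
      refine (image_subset_range _ _).antisymm ?_
      rw [← hP.image_Ico]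
      exact image_mono Ico_subset_Icc_self
    rw [← h1]
    exact isCompact_Icc.image (hP.continuous i)
  -- Disjoint compact curves are at positive distance, so the kernel is bounded.
  obtain ⟨δ, hδ, hdist⟩ := Metric.exists_pos_forall_lt_edist (hcomp i) (hcomp j).isClosed
    (hP.disjoint hij)
  refine ⟨(δ ^ 2)⁻¹ * 2 * (Real.toNNReal (L i) + Real.toNNReal (L j)), fun u v hu hv => ?_⟩
  have hδ' : ((δ : ℝ≥0∞) ^ 2)⁻¹ ≠ ⊤ := by simp [hδ.ne']
  have hpt : ∀ s w, ‖u s - v w‖ₑ ^ 2 / edist (γ i s) (γ j w) ^ 2 ≤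
      ((δ : ℝ≥0∞) ^ 2)⁻¹ * 2 * (‖u s‖ₑ ^ 2 + ‖v w‖ₑ ^ 2) := by
    intro s w
    have h1 : ‖u s - v w‖ₑ ^ 2 ≤ 2 * (‖u s‖ₑ ^ 2 + ‖v w‖ₑ ^ 2) := by
      simp_rw [enorm_sq_eq_ofReal]
      rw [← ENNReal.ofReal_add (sq_nonneg _) (sq_nonneg _), ← ENNReal.ofReal_ofNat 2,
        ← ENNReal.ofReal_mul (by norm_num)]
      apply ENNReal.ofReal_le_ofReal
      nlinarith [sq_nonneg (u s + v w)]
    rw [ENNReal.div_eq_inv_mul, mul_assoc]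
    have h2 : (δ : ℝ≥0∞) ≤ edist (γ i s) (γ j w) := (hdist _ ⟨s, rfl⟩ _ ⟨w, rfl⟩).le
    gcongr
  have hmu : Measurable fun s => ‖u s‖ₑ ^ 2 := hu.measurable.enorm.pow_const 2
  have hmv : Measurable fun s => ‖v s‖ₑ ^ 2 := hv.measurable.enorm.pow_const 2
  calc _ ≤ ∫⁻ s in Ioc 0 (L i), ∫⁻ w in Ioc 0 (L j),
        ((δ : ℝ≥0∞) ^ 2)⁻¹ * 2 * (‖u s‖ₑ ^ 2 + ‖v w‖ₑ ^ 2) :=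
        lintegral_mono fun s => lintegral_mono fun w => hpt s w
    _ = ((δ : ℝ≥0∞) ^ 2)⁻¹ * 2 * (ENNReal.ofReal (L j) * (∫⁻ s in Ioc 0 (L i), ‖u s‖ₑ ^ 2) +
          ENNReal.ofReal (L i) * ∫⁻ s in Ioc 0 (L j), ‖v s‖ₑ ^ 2) := by
        have hne : ((δ : ℝ≥0∞) ^ 2)⁻¹ * 2 ≠ ⊤ := ENNReal.mul_ne_top hδ' (by simp)
        simp_rw [lintegral_const_mul' _ _ hne, lintegral_add_right _ hmv, lintegral_const,
          Measure.restrict_apply MeasurableSet.univ, univ_inter, Real.volume_Ioc, sub_zero]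
        rw [lintegral_add_right _ measurable_const, lintegral_mul_const _ hmu, lintegral_const,
          Measure.restrict_apply MeasurableSet.univ, univ_inter, Real.volume_Ioc, sub_zero]
        ring
    _ ≤ ((δ : ℝ≥0∞) ^ 2)⁻¹ * 2 * ((ENNReal.ofReal (L i) + ENNReal.ofReal (L j)) *
          (∫⁻ s in Ioc 0 (L i), ‖u s‖ₑ ^ 2) +
          (ENNReal.ofReal (L i) + ENNReal.ofReal (L j)) * ∫⁻ s in Ioc 0 (L j), ‖v s‖ₑ ^ 2) := by
        gcongr
        · exact le_add_self
        · exact le_self_add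
    _ = _ := by
        rw [← mul_add, ← mul_assoc]
        congr 1
        push_cast [ENNReal.coe_inv (pow_ne_zero 2 hδ.ne')]
        rfl

end Param

section Param

variable {G : Set Plane} {ι : Type} {L : ι → ℝ} {γ : ι → ℝ → Plane}

theorem IsBoundaryParam.lintegral_eq_of_unit_speed [Fintype ι] (hP : IsBoundaryParam G L γ)
    (hγ : ∀ i s, ‖deriv (γ i) s‖ = 1) (u : Plane → ℝ≥0∞) :
    ∫⁻ x in frontier G, u x ∂μH[1] = ∑ i, ∫⁻ s in Ioc 0 (L i), u (γ i s) := by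
  rw [hP.lintegral_eq]
  refine Finset.sum_congr rfl fun i _ => ?_
  rw [setLIntegral_congr Ico_ae_eq_Ioc]
  have h1 : ∀ s, ‖deriv (γ i) s‖ₑ = 1 := fun s => by
    rw [← ofReal_norm, hγ, ENNReal.ofReal_one]
  simp_rw [h1, one_mul]

/-- The square of the first-order Sobolev norm of a function along the boundary curves. -/
def sobolevSq [Fintype ι] (L : ι → ℝ) (u u' : ι → ℝ → ℝ) : ℝ≥0∞ :=
  ∑ i, ((∫⁻ s in Ioc 0 (L i), ‖u i s‖ₑ ^ 2) + ∫⁻ s in Ioc 0 (L i), ‖u' i s‖ₑ ^ 2)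

theorem IsBoundaryParam.exists_gagliardo_le [Fintype ι] (hP : IsBoundaryParam G L γ) (i j : ι) :
    ∃ C : ℝ≥0, ∀ u u' : ι → ℝ → ℝ, (∀ i, Function.Periodic (u i) (L i)) →
      (∀ i s, HasDerivAt (u i) (u' i s) s) → (∀ i, Continuous (u' i)) →
      ∫⁻ s in Ioc 0 (L i), ∫⁻ w in Ioc 0 (L j), ‖u i s - u j w‖ₑ ^ 2 / edist (γ i s) (γ j w) ^ 2 ≤
        C * sobolevSq L u u' := by
  have hle : ∀ (u u' : ι → ℝ → ℝ) (i : ι), ((∫⁻ s in Ioc 0 (L i), ‖u i s‖ₑ ^ 2) +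
      ∫⁻ s in Ioc 0 (L i), ‖u' i s‖ₑ ^ 2) ≤ sobolevSq L u u' := fun u u' i =>
    Finset.single_le_sum (f := fun i => (∫⁻ s in Ioc 0 (L i), ‖u i s‖ₑ ^ 2) +
      ∫⁻ s in Ioc 0 (L i), ‖u' i s‖ₑ ^ 2) (fun _ _ => zero_le) (Finset.mem_univ i)
  by_cases hij : i = j
  · subst hij
    obtain ⟨C, hC⟩ := hP.exists_gagliardo_self_le i
    refine ⟨C, fun u u' hper hu hu' => (hC _ _ (hper i) (hu i) (hu' i)).trans ?_⟩
    gcongr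
    exact le_trans le_add_self (hle u u' i)
  · obtain ⟨C, hC⟩ := hP.exists_gagliardo_ne_le hij
    refine ⟨C * 2, fun u u' hper hu hu' => (hC _ _
      (continuous_iff_continuousAt.2 fun s => (hu i s).continuousAt)
      (continuous_iff_continuousAt.2 fun s => (hu j s).continuousAt)).trans ?_⟩
    rw [ENNReal.coe_mul, mul_assoc]
    gcongr
    rw [ENNReal.coe_ofNat, two_mul]
    exact add_le_add (le_self_add.trans (hle u u' i)) (le_self_add.trans (hle u u' j))

/-- The embedding of H¹ in H^{1/2}, summed over pairs of curves. It suffices here because the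
dissipation controls the first derivative of the normal velocity. -/
theorem IsBoundaryParam.exists_hHalfNormSq_le [Fintype ι] (hP : IsBoundaryParam G L γ)
    (hγ : ∀ i s, ‖deriv (γ i) s‖ = 1) :
    ∃ C : ℝ≥0, ∀ (w : Plane → ℝ) (u u' : ι → ℝ → ℝ), (∀ i s, w (γ i s) = u i s) →
      (∀ i, Function.Periodic (u i) (L i)) → (∀ i s, HasDerivAt (u i) (u' i s) s) →
      (∀ i, Continuous (u' i)) → hHalfNormSq G w ≤ C * sobolevSq L u u' := by
  choose C hC using hP.exists_gagliardo_le
  refine ⟨1 + ∑ i, ∑ j, C i j, fun w u u' hw hper hu hu' => ?_⟩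
  have huc : ∀ i, Continuous (u i) := fun i =>
    continuous_iff_continuousAt.2 fun s => (hu i s).continuousAt
  rw [hHalfNormSq, hP.lintegral_eq_of_unit_speed hγ, hP.lintegral_eq_of_unit_speed hγ,
    ENNReal.coe_add, ENNReal.coe_one, add_mul, one_mul]
  simp_rw [hP.lintegral_eq_of_unit_speed hγ, hw]
  refine add_le_add (Finset.sum_le_sum fun i _ => le_self_add) ?_
  have hmeas : ∀ i j, Measurable fun s =>
      ∫⁻ v in Ioc 0 (L j), ‖u i s - u j v‖ₑ ^ 2 / edist (γ i s) (γ j v) ^ 2 := by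
    intro i j
    have h1 : Measurable fun q : ℝ × ℝ => ‖u i q.1 - u j q.2‖ₑ ^ 2 / edist (γ i q.1) (γ j q.2) ^ 2 := by
      have h2 : Continuous fun q : ℝ × ℝ => u i q.1 - u j q.2 :=
        ((huc i).comp continuous_fst).sub ((huc j).comp continuous_snd)
      have h3 : Continuous fun q : ℝ × ℝ => edist (γ i q.1) (γ j q.2) :=
        ((hP.continuous i).comp continuous_fst).edist ((hP.continuous j).comp continuous_snd)
      exact (h2.measurable.enorm.pow_const 2).div (h3.measurable.pow_const 2)
    exact h1.lintegral_prod_right'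
  simp_rw [lintegral_finsetSum _ fun j _ => hmeas _ j]
  push_cast
  simp_rw [Finset.sum_mul]
  exact Finset.sum_le_sum fun i _ => Finset.sum_le_sum fun j _ => hC i j u u' hper hu hu'

theorem IsBoundaryParam.hausdorffMeasure_lt_top [Fintype ι] (hP : IsBoundaryParam G L γ)
    (hγ : ∀ i s, ‖deriv (γ i) s‖ = 1) : (μH[1] : Measure Plane) (frontier G) < ⊤ := by
  have h1 := hP.lintegral_eq_of_unit_speed hγ fun _ => 1
  simp only [lintegral_const, one_mul, Measure.restrict_apply MeasurableSet.univ, univ_inter,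
    Real.volume_Ioc] at h1
  rw [h1]
  exact ENNReal.sum_lt_top.2 fun i _ => ENNReal.ofReal_lt_top

/-- By |w| ≤ 1 + |w|² and the finite length of ∂G. Finiteness matters because `toReal` would send an
infinite norm to 0. -/
theorem IsBoundaryParam.hNegHalfNorm_lt_top [Fintype ι] (hP : IsBoundaryParam G L γ)
    (hγ : ∀ i s, ‖deriv (γ i) s‖ = 1) {u : Plane → ℝ} {M : ℝ≥0}
    (hu : ∀ x ∈ frontier G, ‖u x‖ₑ ≤ M) : hNegHalfNorm G u < ⊤ := by
  have hfin := hP.hausdorffMeasure_lt_top hγ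
  refine lt_of_le_of_lt (b := (M : ℝ≥0∞) * ((μH[1] : Measure Plane) (frontier G) + 1)) ?_
    (ENNReal.mul_lt_top ENNReal.coe_lt_top (ENNReal.add_lt_top.2 ⟨hfin, ENNReal.one_lt_top⟩))
  refine iSup_le fun w => iSup_le fun hw => iSup_le fun hw1 => ?_
  refine (enorm_integral_le_lintegral_enorm _).trans ?_
  calc ∫⁻ x in frontier G, ‖u x * w x‖ₑ ∂μH[1]
      ≤ ∫⁻ x in frontier G, M * (1 + ‖w x‖ₑ ^ 2) ∂μH[1] := by
        refine setLIntegral_mono' isClosed_frontier.measurableSet fun x hx => ?_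
        rw [enorm_mul]
        refine mul_le_mul' (hu x hx) ?_
        rcases le_total ‖w x‖ₑ 1 with h | h
        · exact h.trans le_self_add
        · exact le_trans (le_self_pow₀ h (by norm_num)) le_add_self
    _ = M * ((μH[1] : Measure Plane) (frontier G) + ∫⁻ x in frontier G, ‖w x‖ₑ ^ 2 ∂μH[1]) := by
        rw [lintegral_const_mul' _ _ ENNReal.coe_ne_top, lintegral_add_left measurable_const,
          lintegral_const, one_mul, Measure.restrict_apply MeasurableSet.univ, univ_inter]
    _ ≤ _ := by
        gcongr
        exact le_self_add.trans hw1

end Param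

/-! ### Scaling and duality for the half-order norm -/

theorem hHalfNormSq_const_mul (G : Set Plane) (a : ℝ) (w : Plane → ℝ) :
    hHalfNormSq G (fun x => a * w x) = ‖a‖ₑ ^ 2 * hHalfNormSq G w := by
  have hne : ‖a‖ₑ ^ 2 ≠ ⊤ := ENNReal.pow_ne_top enorm_ne_top
  rw [hHalfNormSq, hHalfNormSq, mul_add]
  simp_rw [← mul_sub, enorm_mul, mul_pow, mul_div_assoc, lintegral_const_mul' _ _ hne]

/-- The duality between `H^{1/2}` and `H^{-1/2}`. -/
theorem abs_bdryIntegral_mul_le {G : Set Plane} {u w : Plane → ℝ} (hu : hNegHalfNorm G u < ⊤)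
    (hw : AEStronglyMeasurable w (μH[1].restrict (frontier G))) {Q : ℝ} (hQ : 0 < Q)
    (hwQ : hHalfNormSq G w ≤ ENNReal.ofReal Q) :
    |bdryIntegral G fun x => u x * w x| ≤ (hNegHalfNorm G u).toReal * √Q := by
  have hs : 0 < √Q := Real.sqrt_pos.2 hQ
  -- The normalised function is a competitor in the supremum; Q > 0 allows the division.
  have h1 : hHalfNormSq G (fun x => (√Q)⁻¹ * w x) ≤ 1 := by
    rw [hHalfNormSq_const_mul, enorm_sq_eq_ofReal, inv_pow, Real.sq_sqrt hQ.le,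
      ENNReal.ofReal_inv_of_pos hQ]
    calc _ ≤ (ENNReal.ofReal Q)⁻¹ * ENNReal.ofReal Q := by gcongr
      _ ≤ 1 := ENNReal.inv_mul_le_one _
  have h2 : ‖bdryIntegral G fun x => u x * ((√Q)⁻¹ * w x)‖ₑ ≤ hNegHalfNorm G u :=
    le_iSup_of_le (fun x => (√Q)⁻¹ * w x) (le_iSup_of_le (hw.const_mul _) (le_iSup_of_le h1 le_rfl))
  have h3 : (bdryIntegral G fun x => u x * ((√Q)⁻¹ * w x)) =
      (√Q)⁻¹ * bdryIntegral G fun x => u x * w x := by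
    simp_rw [bdryIntegral, mul_left_comm _ (√Q)⁻¹]
    exact integral_const_mul _ _
  have h4 := ENNReal.toReal_mono hu.ne h2
  rw [toReal_enorm, h3, norm_mul, Real.norm_eq_abs, Real.norm_eq_abs, abs_of_pos (inv_pos.2 hs),
    inv_mul_le_iff₀ hs] at h4
  linarith

open CurveFlow

/-! ### Energy estimates for a family of closed curves -/

/-- If `u` has a zero in the interval, then `u² ≤ 2 ∫ |u| |u'|` there. -/
theorem sq_le_two_mul_integral_of_zero {u u' : ℝ → ℝ} {L : ℝ}
    (hu : ∀ s, HasDerivAt u (u' s) s) (hu' : Continuous u') {s₀ : ℝ} (hs₀ : s₀ ∈ Icc 0 L)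
    (h0 : u s₀ = 0) {s : ℝ} (hs : s ∈ Icc 0 L) : u s ^ 2 ≤ 2 * ∫ v in (0)..L, |u v| * |u' v| := by
  have huc : Continuous u := continuous_iff_continuousAt.2 fun s => (hu s).continuousAt
  have hL : 0 ≤ L := hs.1.trans hs.2
  have h1 : ∫ v in s₀..s, 2 * (u v * u' v) = u s ^ 2 := by
    rw [intervalIntegral.integral_eq_sub_of_hasDerivAt (f := fun v => u v ^ 2) (fun v _ => ?_)
      (Continuous.intervalIntegrable (by fun_prop) _ _), h0]
    · ring
    · refine ((hu v).pow 2).congr_deriv ?_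
      simp only [Nat.cast_ofNat, Nat.add_one_sub_one, pow_one]
      ring
  rw [← h1, intervalIntegral.integral_const_mul]
  refine mul_le_mul_of_nonneg_left ?_ zero_le_two
  refine (Real.le_norm_self _).trans ((intervalIntegral.norm_integral_le_integral_norm_uIoc).trans ?_)
  rw [intervalIntegral.integral_of_le hL]
  simp_rw [Real.norm_eq_abs, abs_mul]
  refine setIntegral_mono_set ?_ (ae_of_all _ fun v => by positivity) (ae_of_all _ ?_)
  · exact (huc.abs.mul hu'.abs).integrableOn_Ioc
  · intro v hv
    rcases le_total s₀ s with h | h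
    · rw [uIoc_of_le h] at hv
      exact ⟨hs₀.1.trans_lt hv.1, hv.2.trans hs.2⟩
    · rw [uIoc_of_ge h] at hv
      exact ⟨hs.1.trans_lt hv.1, hv.2.trans hs₀.2⟩

theorem exists_deriv_zero_of_periodic {a a' : ℝ → ℝ} {L : ℝ} (hL : 0 < L)
    (ha : Function.Periodic a L) (hd : ∀ s, HasDerivAt a (a' s) s) : ∃ s ∈ Icc 0 L, a' s = 0 := by
  have h0 : a 0 = a L := by simpa using (ha 0).symm
  obtain ⟨s, hs, h1⟩ := exists_hasDerivAt_eq_zero (f := a) (f' := a') hL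
    (fun s _ => (hd s).continuousAt.continuousWithinAt) h0 fun s _ => hd s
  exact ⟨s, Ioo_subset_Icc_self hs, h1⟩

section Family

variable {ι : Type} [Fintype ι] {I : Set ℝ} {L : ι → ℝ} {c : ι → ℝ → ℝ → Plane}
  {f : ι → ℝ → ℝ → ℝ} {g : Plane → ℝ}

namespace CurveFlow

/-- The total length of the curves. -/
def totalLength (L : ι → ℝ) (c : ι → ℝ → ℝ → Plane) (t : ℝ) : ℝ :=
  ∑ i, ∫ s in (0)..(L i), speed (c i) s t

/-- The integral of `u²` with respect to arc length. -/
def normSq (L : ι → ℝ) (c : ι → ℝ → ℝ → Plane) (u : ι → ℝ → ℝ → ℝ) (t : ℝ) : ℝ :=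
  ∑ i, ∫ s in (0)..(L i), speed (c i) s t * u i s t ^ 2

theorem normSq_nonneg (hL : ∀ i, 0 ≤ L i) (c : ι → ℝ → ℝ → Plane) (u : ι → ℝ → ℝ → ℝ) (t : ℝ) :
    0 ≤ normSq L c u t :=
  Finset.sum_nonneg fun i _ => intervalIntegral.integral_nonneg (hL i) fun _ _ =>
    mul_nonneg (norm_nonneg _) (sq_nonneg _)

end CurveFlow

/-- Interpolation between the first and the third derivative of the potential. -/
theorem normSq_potDD_sq_le (H : ∀ i, IsCurveFlow I (L i) (c i) (f i)) (hL : ∀ i, 0 < L i)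
    (hg : ContDiffOn ℝ ∞ g {0}ᶜ) {t : ℝ} (ht : t ∈ I) :
    normSq L c (fun i => potDD g (c i) (f i)) t ^ 2 ≤
      normSq L c (fun i => potD g (c i) (f i)) t *
        normSq L c (fun i => potDDD g (c i) (f i)) t := by
  -- Integrate by parts in ∫ V ∂_s r, with ∂_s r = ρV and ∂_s V = ρZ.
  have h1 : normSq L c (fun i => potDD g (c i) (f i)) t = -∑ i, ∫ s in (0)..(L i),
      speed (c i) s t * (potD g (c i) (f i) s t * potDDD g (c i) (f i) s t) := by
    rw [normSq, ← Finset.sum_neg_distrib]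
    refine Finset.sum_congr rfl fun i _ => ?_
    have h2 := integral_mul_deriv_periodic ((H i).periodic_potDD g ht) ((H i).periodic_potD g ht)
      (fun s => ((H i).smooth_potDD hg).hasDerivAt_s (H i).isOpen ht s)
      (fun s => ((H i).smooth_potD hg).hasDerivAt_s (H i).isOpen ht s)
      ((((H i).smooth_potDD hg).ds (H i).isOpen).continuous_s ht)
      ((((H i).smooth_potD hg).ds (H i).isOpen).continuous_s ht)
    simp_rw [(H i).ds_potD g _ ht, (H i).ds_potDD g _ ht] at h2
    calc _ = ∫ s in (0)..(L i), potDD g (c i) (f i) s t *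
          (speed (c i) s t * potDD g (c i) (f i) s t) := by
          congr 1; funext s; ring
      _ = _ := by
          rw [h2]
          congr 2
          funext s
          ring
  rw [h1, neg_sq]
  exact sum_integral_cauchy_schwarz (fun i => (hL i).le)
    (fun i => (H i).smooth_speed.continuous_s ht) (fun i s => norm_nonneg _)
    (fun i => ((H i).smooth_potD hg).continuous_s ht)
    (fun i => ((H i).smooth_potDDD hg).continuous_s ht)

/-- The cubic term in the rate of change of the energy. -/
theorem cubic_term_sq_le (H : ∀ i, IsCurveFlow I (L i) (c i) (f i)) (hL : ∀ i, 0 < L i)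
    (hg : ContDiffOn ℝ ∞ g {0}ᶜ) {t : ℝ} (ht : t ∈ I) :
    (∑ i, ∫ s in (0)..(L i), speed (c i) s t *
        (potD g (c i) (f i) s t ^ 2 * |potDD g (c i) (f i) s t|)) ^ 2 ≤
      4 * totalLength L c t * normSq L c (fun i => potD g (c i) (f i)) t ^ 2 *
        normSq L c (fun i => potDDD g (c i) (f i)) t := by
  set E := normSq L c (fun i => potD g (c i) (f i)) t with hE
  set B := normSq L c (fun i => potDD g (c i) (f i)) t with hB
  set D := normSq L c (fun i => potDDD g (c i) (f i)) t with hD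
  have hBE : B ^ 2 ≤ E * D := normSq_potDD_sq_le H hL hg ht
  have hρ : ∀ i, Continuous fun s => speed (c i) s t := fun i => (H i).smooth_speed.continuous_s ht
  have hr : ∀ i, Continuous fun s => potD g (c i) (f i) s t := fun i =>
    ((H i).smooth_potD hg).continuous_s ht
  have hV : ∀ i, Continuous fun s => potDD g (c i) (f i) s t := fun i =>
    ((H i).smooth_potDD hg).continuous_s ht
  have hρ0 : ∀ i s, 0 ≤ speed (c i) s t := fun i s => norm_nonneg _
  set X := ∑ i, ∫ s in (0)..(L i), speed (c i) s t *
    (|potD g (c i) (f i) s t| * |potDD g (c i) (f i) s t|) with hX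
  set N := ∑ i, ∫ s in (0)..(L i), speed (c i) s t * |potDD g (c i) (f i) s t| with hN
  have hXle : X ^ 2 ≤ E * B := by
    have := sum_integral_cauchy_schwarz (fun i => (hL i).le) hρ hρ0 (fun i => (hr i).abs)
      (fun i => (hV i).abs)
    simp only [sq_abs] at this
    exact this
  have hNle : N ^ 2 ≤ totalLength L c t * B := by
    have := sum_integral_cauchy_schwarz (fun i => (hL i).le) hρ hρ0
      (u := fun _ _ => 1) (fun i => continuous_const) (fun i => (hV i).abs)
    simp only [sq_abs, one_mul, one_pow, mul_one] at this
    exact this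
  have hXterm : ∀ i s, 0 ≤ speed (c i) s t *
      (|potD g (c i) (f i) s t| * |potDD g (c i) (f i) s t|) := fun i s =>
    mul_nonneg (hρ0 i s) (by positivity)
  have hX0 : 0 ≤ X := Finset.sum_nonneg fun i _ =>
    intervalIntegral.integral_nonneg (hL i).le fun s _ => hXterm i s
  -- By Rolle the periodic R has a critical point on each curve, where r vanishes; so the sup of r²
  -- needs no lower order term.
  have hsup : ∀ i, ∀ s ∈ Icc 0 (L i), potD g (c i) (f i) s t ^ 2 ≤ 2 * X := by
    intro i s hs
    obtain ⟨s₀, hs₀, h0⟩ := exists_deriv_zero_of_periodic (hL i) ((H i).periodic_pot g ht)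
      (fun s => ((H i).smooth_pot hg).hasDerivAt_s (H i).isOpen ht s)
    rw [(H i).ds_pot g s₀ ht] at h0
    have h1 := (mul_eq_zero.1 h0).resolve_left ((H i).speed_pos s₀ ht).ne'
    refine (sq_le_two_mul_integral_of_zero
      (fun s => ((H i).smooth_potD hg).hasDerivAt_s (H i).isOpen ht s)
      ((((H i).smooth_potD hg).ds (H i).isOpen).continuous_s ht) hs₀ h1 hs).trans ?_
    refine mul_le_mul_of_nonneg_left ?_ zero_le_two
    refine le_trans (le_of_eq ?_) (Finset.single_le_sum (f := fun i => ∫ s in (0)..(L i),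
      speed (c i) s t * (|potD g (c i) (f i) s t| * |potDD g (c i) (f i) s t|)) (fun i _ =>
      intervalIntegral.integral_nonneg (hL i).le fun s _ => hXterm i s) (Finset.mem_univ i))
    congr 1
    funext v
    rw [(H i).ds_potD g v ht, abs_mul, abs_of_nonneg (hρ0 i v)]
    ring
  set Y := ∑ i, ∫ s in (0)..(L i), speed (c i) s t *
    (potD g (c i) (f i) s t ^ 2 * |potDD g (c i) (f i) s t|) with hY
  have hY0 : 0 ≤ Y := Finset.sum_nonneg fun i _ =>
    intervalIntegral.integral_nonneg (hL i).le fun s _ => mul_nonneg (hρ0 i s) (by positivity)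
  have hYle : Y ≤ 2 * X * N := by
    rw [hY, hN, Finset.mul_sum]
    refine Finset.sum_le_sum fun i _ => ?_
    rw [← intervalIntegral.integral_const_mul]
    refine intervalIntegral.integral_mono_on (hL i).le
      (((hρ i).mul (((hr i).pow 2).mul (hV i).abs)).intervalIntegrable _ _)
      (((hρ i).mul (hV i).abs).const_mul _ |>.intervalIntegrable _ _) fun s hs => ?_
    have h1 := mul_le_mul_of_nonneg_right (hsup i s hs)
      (mul_nonneg (hρ0 i s) (abs_nonneg (potDD g (c i) (f i) s t)))
    linarith
  have hE0 : 0 ≤ E := normSq_nonneg (fun i => (hL i).le) _ _ _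
  have hP0 : 0 ≤ totalLength L c t := Finset.sum_nonneg fun i _ =>
    intervalIntegral.integral_nonneg (hL i).le fun s _ => hρ0 i s
  have hB0 : 0 ≤ B := normSq_nonneg (fun i => (hL i).le) _ _ _
  -- From X² ≤ EB and N² ≤ PB with P the total length, the square is at most 4PEB², and B² ≤ ED
  -- finishes.
  calc Y ^ 2 ≤ (2 * X * N) ^ 2 := pow_le_pow_left₀ hY0 hYle 2
    _ = 4 * (X ^ 2 * N ^ 2) := by ring
    _ ≤ 4 * (E * B * (totalLength L c t * B)) := by
        refine mul_le_mul_of_nonneg_left ?_ (by norm_num)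
        exact mul_le_mul hXle hNle (sq_nonneg _) (mul_nonneg hE0 hB0)
    _ = 4 * totalLength L c t * E * B ^ 2 := by ring
    _ ≤ 4 * totalLength L c t * E * (E * D) := by gcongr
    _ = _ := by ring

/-- The rate of change of the energy is controlled by the dissipation, lower order terms and the
time derivative of the forcing. -/
theorem sum_integral_energyRate_le (H : ∀ i, IsCurveFlow I (L i) (c i) (f i)) (hL : ∀ i, 0 < L i)
    (hg : ContDiffOn ℝ ∞ g {0}ᶜ) {t : ℝ} (ht : t ∈ I) {c₀ g₁ K m M : ℝ}
    (hg₀ : ∀ v, ‖v‖ = 1 → c₀ ≤ g v) (hg₁ : ∀ v, ‖v‖ = 1 → |g v| ≤ g₁)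
    (hρ : ∀ i s, 1 / 2 ≤ speed (c i) s t) (hK : ∀ i s, |curv (c i) s t| ≤ K)
    (hm : ∀ i s, |tangVel (c i) s t| ≤ m * |potDD g (c i) (f i) s t|)
    (hM : ∀ i s, |ds (f i) s t| ≤ M) :
    ∑ i, ∫ s in (0)..(L i), energyRate g (c i) (f i) s t ≤
      -2 * c₀ * normSq L c (fun i => potDDD g (c i) (f i)) t +
      (4 * (m * M) + 2 * (g₁ * K ^ 2)) * normSq L c (fun i => potDD g (c i) (f i)) t +
      K * (∑ i, ∫ s in (0)..(L i), speed (c i) s t *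
        (potD g (c i) (f i) s t ^ 2 * |potDD g (c i) (f i) s t|)) +
      2 * |∑ i, ∫ s in (0)..(L i),
        dt (f i) s t * (potDD g (c i) (f i) s t * speed (c i) s t)| := by
  have hρc : ∀ i, Continuous fun s => speed (c i) s t := fun i => (H i).smooth_speed.continuous_s ht
  have hr : ∀ i, Continuous fun s => potD g (c i) (f i) s t := fun i =>
    ((H i).smooth_potD hg).continuous_s ht
  have hV : ∀ i, Continuous fun s => potDD g (c i) (f i) s t := fun i =>
    ((H i).smooth_potDD hg).continuous_s ht
  have hZ : ∀ i, Continuous fun s => potDDD g (c i) (f i) s t := fun i =>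
    ((H i).smooth_potDDD hg).continuous_s ht
  have hft : ∀ i, Continuous fun s => dt (f i) s t := fun i =>
    ((H i).smooth_forcing.dt (H i).isOpen).continuous_s ht
  have hρ0 : ∀ i s, 0 ≤ speed (c i) s t := fun i s => norm_nonneg _
  have hpt : ∀ i s, energyRate g (c i) (f i) s t ≤
      -2 * c₀ * (speed (c i) s t * potDDD g (c i) (f i) s t ^ 2) +
      (4 * (m * M) + 2 * (g₁ * K ^ 2)) * (speed (c i) s t * potDD g (c i) (f i) s t ^ 2) +
      K * (speed (c i) s t * (potD g (c i) (f i) s t ^ 2 * |potDD g (c i) (f i) s t|)) +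
      -2 * (dt (f i) s t * (potDD g (c i) (f i) s t * speed (c i) s t)) := by
    intro i s
    have hn := (H i).norm_normal s ht
    have hK0 : 0 ≤ K := (abs_nonneg _).trans (hK i s)
    have hM0 : 0 ≤ M := (abs_nonneg _).trans (hM i s)
    have hg0 : 0 ≤ g₁ := (abs_nonneg _).trans (hg₁ _ hn)
    set V := potDD g (c i) (f i) s t
    set Z := potDDD g (c i) (f i) s t
    set ρ := speed (c i) s t
    have hρp : 1 / 2 ≤ ρ := hρ i s
    have h1 : c₀ * (ρ * Z ^ 2) ≤ ρ * g (normal (c i) s t) * Z ^ 2 := by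
      have := mul_le_mul_of_nonneg_right (hg₀ _ hn) (mul_nonneg (hρ0 i s) (sq_nonneg Z))
      linarith
    have h2 : V * tangVel (c i) s t * ds (f i) s t ≤ 2 * (m * M) * (ρ * V ^ 2) := by
      calc V * tangVel (c i) s t * ds (f i) s t ≤ |V * tangVel (c i) s t * ds (f i) s t| :=
            le_abs_self _
        _ = |V| * |tangVel (c i) s t| * |ds (f i) s t| := by rw [abs_mul, abs_mul]
        _ ≤ |V| * (m * |V|) * M := by
            have h3 := hm i s
            have h4 : 0 ≤ m * |V| := (abs_nonneg _).trans h3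
            have h5 := hM i s
            gcongr
        _ = m * M * V ^ 2 := by rw [← sq_abs V]; ring
        _ ≤ 2 * (m * M) * (ρ * V ^ 2) := by
            -- The sign of `m` is only forced where V ≠ 0.
            rcases eq_or_ne V 0 with h | h
            · rw [h]; simp
            · have h3 : 0 ≤ m := by
                have h4 := (abs_nonneg _).trans (hm i s)
                exact nonneg_of_mul_nonneg_left h4 (abs_pos.2 h)
              have h4 : 0 ≤ m * M * V ^ 2 := by positivity
              nlinarith
    have h3 : g (normal (c i) s t) * curv (c i) s t ^ 2 * V ^ 2 * ρ ≤
        g₁ * K ^ 2 * (ρ * V ^ 2) := by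
      have h4 : curv (c i) s t ^ 2 ≤ K ^ 2 := sq_le_sq' (abs_le.1 (hK i s)).1 (abs_le.1 (hK i s)).2
      have h5 : g (normal (c i) s t) ≤ g₁ := (le_abs_self _).trans (hg₁ _ hn)
      calc _ ≤ g₁ * K ^ 2 * V ^ 2 * ρ := by
            have := hρ0 i s
            gcongr
        _ = _ := by ring
    have h4 : -(potD g (c i) (f i) s t ^ 2 * curv (c i) s t * V * ρ) ≤
        K * (ρ * (potD g (c i) (f i) s t ^ 2 * |V|)) := by
      calc _ ≤ |potD g (c i) (f i) s t ^ 2 * curv (c i) s t * V * ρ| := neg_le_abs _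
        _ = potD g (c i) (f i) s t ^ 2 * |curv (c i) s t| * |V| * ρ := by
            rw [abs_mul, abs_mul, abs_mul, abs_of_nonneg (hρ0 i s), abs_of_nonneg (sq_nonneg _)]
        _ ≤ potD g (c i) (f i) s t ^ 2 * K * |V| * ρ := by
            have := hρ0 i s
            have h5 := hK i s
            gcongr
        _ = _ := by ring
    rw [energyRate]
    linarith
  have hI : ∀ i {w : ℝ → ℝ}, Continuous w → IntervalIntegrable w volume 0 (L i) := fun i _ hw =>
    hw.intervalIntegrable _ _
  have c1 : ∀ i, Continuous fun s => -2 * c₀ * (speed (c i) s t * potDDD g (c i) (f i) s t ^ 2) :=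
    fun i => ((hρc i).mul ((hZ i).pow 2)).const_mul _
  have c2 : ∀ i, Continuous fun s => (4 * (m * M) + 2 * (g₁ * K ^ 2)) *
      (speed (c i) s t * potDD g (c i) (f i) s t ^ 2) :=
    fun i => ((hρc i).mul ((hV i).pow 2)).const_mul _
  have c3 : ∀ i, Continuous fun s => K * (speed (c i) s t *
      (potD g (c i) (f i) s t ^ 2 * |potDD g (c i) (f i) s t|)) :=
    fun i => ((hρc i).mul (((hr i).pow 2).mul (hV i).abs)).const_mul _
  have c4 : ∀ i, Continuous fun s => -2 * (dt (f i) s t *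
      (potDD g (c i) (f i) s t * speed (c i) s t)) :=
    fun i => ((hft i).mul ((hV i).mul (hρc i))).const_mul _
  have hsum : ∑ i, ∫ s in (0)..(L i), energyRate g (c i) (f i) s t ≤
      -2 * c₀ * normSq L c (fun i => potDDD g (c i) (f i)) t +
      (4 * (m * M) + 2 * (g₁ * K ^ 2)) * normSq L c (fun i => potDD g (c i) (f i)) t +
      K * (∑ i, ∫ s in (0)..(L i), speed (c i) s t *
        (potD g (c i) (f i) s t ^ 2 * |potDD g (c i) (f i) s t|)) +
      -2 * ∑ i, ∫ s in (0)..(L i),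
        dt (f i) s t * (potDD g (c i) (f i) s t * speed (c i) s t) := by
    rw [normSq, normSq, Finset.mul_sum, Finset.mul_sum, Finset.mul_sum, Finset.mul_sum,
      ← Finset.sum_add_distrib, ← Finset.sum_add_distrib, ← Finset.sum_add_distrib]
    refine Finset.sum_le_sum fun i _ => ?_
    simp only [← intervalIntegral.integral_const_mul]
    rw [← intervalIntegral.integral_add (hI i (c1 i)) (hI i (c2 i)),
      ← intervalIntegral.integral_add ((hI i (c1 i)).add (hI i (c2 i))) (hI i (c3 i)),
      ← intervalIntegral.integral_add (((hI i (c1 i)).add (hI i (c2 i))).add (hI i (c3 i)))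
        (hI i (c4 i))]
    exact intervalIntegral.integral_mono_on (hL i).le
      (hI i (((H i).smooth_energyRate hg).continuous_s ht))
      ((((hI i (c1 i)).add (hI i (c2 i))).add (hI i (c3 i))).add (hI i (c4 i))) fun s _ => hpt i s
  refine hsum.trans ?_
  have := neg_le_abs (∑ i, ∫ s in (0)..(L i),
    dt (f i) s t * (potDD g (c i) (f i) s t * speed (c i) s t))
  linarith

end Family

/-- The form of 2√(ab) ≤ a + b used for every absorption. -/
theorem le_add_of_sq_le_four_mul {x a b : ℝ} (ha : 0 ≤ a) (hb : 0 ≤ b) (h : x ^ 2 ≤ 4 * (a * b)) :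
    x ≤ a + b :=
  abs_le_of_sq_le_sq' (h.trans (by nlinarith [sq_nonneg (a - b)])) (add_nonneg ha hb) |>.2

/-- The energy inequality follows by absorption. -/
theorem rate_add_le {c₀ C₂ C₃ K P : ℝ} (hc₀ : 0 < c₀) (hC₂ : 0 ≤ C₂) (hC₃ : 0 < C₃) (hP : 0 ≤ P)
    {rate D B E Y N X : ℝ} (hD : 0 ≤ D) (hE : 0 ≤ E) (hB : 0 ≤ B)
    (hrate : rate ≤ -2 * c₀ * D + C₂ * B + K * Y + 2 * X) (hBE : B ^ 2 ≤ E * D)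
    (hY : Y ^ 2 ≤ 4 * P * E ^ 2 * D) (hX : X ≤ N * √(C₃ * (D + B) + 1)) :
    rate + c₀ * D ≤ (4 * C₃ / c₀ + (c₀ / (4 * C₃) + (C₂ + c₀ / 4) ^ 2 / c₀ + 4 * K ^ 2 * P / c₀)) *
        N ^ 2 + (4 * C₃ / c₀ + (c₀ / (4 * C₃) + (C₂ + c₀ / 4) ^ 2 / c₀ + 4 * K ^ 2 * P / c₀)) *
        (1 + E) ^ (7 / 3 : ℝ) := by
  have hQ : 0 ≤ C₃ * (D + B) + 1 := by positivity
  have h1 : 2 * X ≤ 4 * C₃ / c₀ * N ^ 2 + (c₀ / 4 * (D + B) + c₀ / (4 * C₃)) := by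
    refine (mul_le_mul_of_nonneg_left hX zero_le_two).trans
      (le_add_of_sq_le_four_mul (by positivity) (by positivity) ?_)
    rw [mul_pow, mul_pow, Real.sq_sqrt hQ]
    apply le_of_eq
    field_simp
    ring
  have h2 : (C₂ + c₀ / 4) * B ≤ c₀ / 4 * D + (C₂ + c₀ / 4) ^ 2 / c₀ * E := by
    -- The coefficient of B includes the c₀/4 left by the forcing term. The three absorptions each
    -- cost c₀D/4, so of the dissipation 2c₀D more than c₀D survives.
    refine le_add_of_sq_le_four_mul (by positivity) (by positivity) ?_
    rw [mul_pow]
    refine (mul_le_mul_of_nonneg_left hBE (sq_nonneg _)).trans (le_of_eq ?_)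
    field_simp
  have h3 : K * Y ≤ c₀ / 4 * D + 4 * K ^ 2 * P / c₀ * E ^ 2 := by
    refine le_add_of_sq_le_four_mul (by positivity) (by positivity) ?_
    rw [mul_pow]
    refine (mul_le_mul_of_nonneg_left hY (sq_nonneg _)).trans (le_of_eq ?_)
    field_simp
  -- All remainders grow at most quadratically in E, below the stated power.
  have h73 : (1 + E) ^ 2 ≤ (1 + E) ^ (7 / 3 : ℝ) := by
    rw [← Real.rpow_natCast]
    exact Real.rpow_le_rpow_of_exponent_le (by linarith) (by norm_num)
  set S := (1 + E) ^ (7 / 3 : ℝ) with hS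
  have hS1 : 1 ≤ S := le_trans (by nlinarith) h73
  have hSE : E ≤ S := le_trans (by nlinarith) h73
  have hSE2 : E ^ 2 ≤ S := le_trans (by nlinarith) h73
  have ha : 0 ≤ c₀ / (4 * C₃) := by positivity
  have hb : 0 ≤ (C₂ + c₀ / 4) ^ 2 / c₀ := by positivity
  have hd : 0 ≤ 4 * K ^ 2 * P / c₀ := by positivity
  have he : 0 ≤ 4 * C₃ / c₀ := by positivity
  have k1 := mul_le_mul_of_nonneg_left hS1 ha
  have k2 := mul_le_mul_of_nonneg_left hSE hb
  have k3 := mul_le_mul_of_nonneg_left hSE2 hd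
  have k4 : 0 ≤ 4 * C₃ / c₀ * S := mul_nonneg he (by linarith)
  have k5 : 0 ≤ (c₀ / (4 * C₃) + (C₂ + c₀ / 4) ^ 2 / c₀ + 4 * K ^ 2 * P / c₀) * N ^ 2 := by positivity
  have k6 : 0 ≤ c₀ * D := by positivity
  linarith

open CurveFlow

/-! ### Bounds in terms of the height function -/

theorem exists_bound_of_periodic {ι : Type} [Finite ι] {L : ι → ℝ} (hL : ∀ i, 0 < L i)
    {a : ι → ℝ → ℝ} (ha : ∀ i, Function.Periodic (a i) (L i)) (hc : ∀ i, Continuous (a i)) :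
    ∃ M : ℝ, ∀ i s, |a i s| ≤ M := by
  have h1 : ∀ i, ∃ M : ℝ, ∀ s, |a i s| ≤ M := fun i => by
    obtain ⟨M, hM⟩ := isCompact_Icc.exists_bound_of_continuousOn
      (s := Icc 0 (L i)) (hc i).continuousOn
    refine ⟨M, fun s => ?_⟩
    obtain ⟨v, hv, hsv⟩ := (ha i).exists_mem_Ico₀ (hL i) s
    rw [hsv]
    exact hM v (Ico_subset_Icc_self hv)
  choose M hM using h1
  obtain ⟨M', hM'⟩ := (Set.finite_range M).bddAbove
  exact ⟨M', fun i s => (hM i s).trans (hM' ⟨i, rfl⟩)⟩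

theorem periodic_deriv {E : Type*} [NormedAddCommGroup E] [NormedSpace ℝ E] {a : ℝ → E} {L : ℝ}
    (ha : Function.Periodic a L) : Function.Periodic (deriv a) L :=
  periodic_ds (a := fun s _ => a s) (t := 0) ha

section Param

variable {G : Set Plane} {η : ℝ} {ι : Type} {L : ι → ℝ} {γ : ι → ℝ → Plane}

/-- If |κ| > 1/η, then r = -1/κ is admissible and 1 + rκ = 0, against positivity in the tube. -/
theorem abs_curvatureAlong_le (hG : IsSmoothSet G) (hη : IsTubularRadius G η)
    (hP : IsBoundaryParam G L γ) (hγ : ∀ i s, ‖deriv (γ i) s‖ = 1) (i : ι) (s : ℝ) :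
    |curvatureAlong G (γ i) s| ≤ 1 / η := by
  by_contra! h
  have hη0 := hη.pos
  have hk : 0 < |curvatureAlong G (γ i) s| := lt_trans (by positivity) h
  have hk0 : curvatureAlong G (γ i) s ≠ 0 := abs_pos.1 hk
  have h1 := one_add_mul_curvatureAlong_pos hG hη hP hγ i s
    (r := -(curvatureAlong G (γ i) s)⁻¹) (by
      rw [abs_neg, abs_inv]
      rw [one_div] at h
      exact inv_lt_of_inv_lt₀ hη0 h)
  rw [neg_mul, inv_mul_cancel₀ hk0] at h1
  linarith

theorem IsBoundaryParam.periodic_curvatureAlong (hP : IsBoundaryParam G L γ) (i : ι) :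
    Function.Periodic (curvatureAlong G (γ i)) (L i) := fun s => by
  have h1 := periodic_deriv (hP.periodic i) s
  have h2 := periodic_deriv (a := fun s => outerNormal G (γ i s))
    (fun s => congrArg (outerNormal G) (hP.periodic i s)) s
  rw [curvatureAlong, curvatureAlong, h1, h2]

theorem IsBoundaryParam.hasDerivAt_deriv (hG : IsSmoothSet G) (hη : IsTubularRadius G η)
    (hP : IsBoundaryParam G L γ) (hγ : ∀ i s, ‖deriv (γ i) s‖ = 1) (i : ι) (s : ℝ) :
    HasDerivAt (deriv (γ i)) (-curvatureAlong G (γ i) s • outerNormal G (γ i s)) s := by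
  have h1 := IsCurveFlow.hasDerivAt_rot (hP.hasDerivAt_normal hG hη hγ i s)
  simp only [hP.rot_normal hγ] at h1
  refine h1.congr_deriv ?_
  rw [rot_smul, ← hP.rot_normal hγ, rot_rot, smul_neg, neg_smul]

theorem le_holderNorm (k : ℕ) (α : ℝ) (u : Plane → ℝ) {j : ℕ} (hj : j ≤ k) {x : Plane}
    (hx : x ∈ frontier G) : ‖((tderiv G)^[j] u) x‖ₑ ≤ holderNorm G k α u := by
  refine le_trans ?_ le_self_add
  refine le_trans ?_ (Finset.single_le_sum (f := fun j => ⨆ x ∈ frontier G, ‖((tderiv G)^[j] u) x‖ₑ)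
    (fun _ _ => zero_le) (Finset.mem_range.2 (Nat.lt_succ_of_le hj)))
  exact le_iSup₂_of_le x hx le_rfl

theorem abs_le_of_holderNorm_le {k : ℕ} {α : ℝ} {u : Plane → ℝ} {M : ℝ≥0}
    (hu : holderNorm G k α u ≤ M) {j : ℕ} (hj : j ≤ k) {x : Plane} (hx : x ∈ frontier G) :
    |((tderiv G)^[j] u) x| ≤ M := by
  have h1 := (le_holderNorm k α u hj hx).trans hu
  rw [← ofReal_norm, ENNReal.ofReal_le_coe] at h1
  exact h1

theorem IsBoundaryParam.tderiv_eq_deriv [Fintype ι] (hP : IsBoundaryParam G L γ)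
    (hγ : ∀ i s, ‖deriv (γ i) s‖ = 1) {u : Plane → ℝ} {i : ι} {a : ℝ → ℝ} (ha : Differentiable ℝ a)
    (hu : ∀ s, u (γ i s) = a s) (s : ℝ) : tderiv G u (γ i s) = deriv a s := by
  have h1 : (fun s => u (γ i s)) = a := funext hu
  rw [hP.tderiv_eq (by rw [h1]; exact ha s), h1, hγ, inv_one, one_smul]

theorem IsBoundaryParam.abs_deriv_le_of_holderNorm_le [Fintype ι] (hP : IsBoundaryParam G L γ)
    (hγ : ∀ i s, ‖deriv (γ i) s‖ = 1) {k : ℕ} {α : ℝ} {u : Plane → ℝ} {M : ℝ≥0}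
    (hu : holderNorm G k α u ≤ M) (hk : 1 ≤ k) {i : ι} (ha : Differentiable ℝ fun s => u (γ i s))
    (s : ℝ) : |deriv (fun s => u (γ i s)) s| ≤ M := by
  have h1 := abs_le_of_holderNorm_le hu hk (hP.mem_frontier i s)
  rwa [Function.iterate_one, hP.tderiv_eq_deriv hγ ha (fun _ => rfl)] at h1

theorem IsBoundaryParam.abs_deriv_deriv_le_of_holderNorm_le [Fintype ι] (hP : IsBoundaryParam G L γ)
    (hγ : ∀ i s, ‖deriv (γ i) s‖ = 1) {k : ℕ} {α : ℝ} {u : Plane → ℝ} {M : ℝ≥0}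
    (hu : holderNorm G k α u ≤ M) (hk : 2 ≤ k) {i : ι} (ha : Differentiable ℝ fun s => u (γ i s))
    (ha' : Differentiable ℝ (deriv fun s => u (γ i s)))
    (s : ℝ) : |deriv (deriv fun s => u (γ i s)) s| ≤ M := by
  have h1 := abs_le_of_holderNorm_le hu hk (hP.mem_frontier i s)
  change |tderiv G (tderiv G u) (γ i s)| ≤ M at h1
  rwa [hP.tderiv_eq_deriv hγ ha' (hP.tderiv_eq_deriv hγ ha fun _ => rfl)] at h1

end Param

section Flow

variable {φ : Plane → ℝ} {G : Set Plane} {η T : ℝ} {ι : Type} {L : ι → ℝ} {γ : ι → ℝ → Plane}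
  {f : ℝ → Plane → ℝ} {F : ℝ → Set Plane} {h : ℝ → Plane → ℝ}

/-- Heights up to η/2 and |κ| ≤ 1/η keep 1 + hκ between 1/2 and 3/2, which makes the bounds on speed
and tangential velocity uniform. -/
theorem IsSmoothFlow.abs_height_mul_curvature_le (hf : IsSmoothFlow G η T F h) (hG : IsSmoothSet G)
    (hη : IsTubularRadius G η) (hP : IsBoundaryParam G L γ) (hγ : ∀ i s, ‖deriv (γ i) s‖ = 1)
    (i : ι) (s : ℝ) {t : ℝ} (ht : t ∈ Ioo 0 T) :
    |h t (γ i s) * curvatureAlong G (γ i) s| ≤ 1 / 2 := by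
  have hη0 := hη.pos
  have h1 := hf.height_le t ⟨ht.1.le, ht.2⟩ _ (hP.mem_frontier i s)
  have h2 := abs_curvatureAlong_le hG hη hP hγ i s
  rw [abs_mul]
  calc |h t (γ i s)| * |curvatureAlong G (γ i) s| ≤ η / 2 * (1 / η) := by gcongr
    _ = 1 / 2 := by field_simp

theorem IsSmoothFlow.half_le_speed (hf : IsSmoothFlow G η T F h) (hG : IsSmoothSet G)
    (hη : IsTubularRadius G η) (hP : IsBoundaryParam G L γ) (hγ : ∀ i s, ‖deriv (γ i) s‖ = 1)
    (i : ι) (s : ℝ) {t : ℝ} (ht : t ∈ Ioo 0 T) : 1 / 2 ≤ speed (graphCurve G h (γ i)) s t := by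
  have h1 := abs_le.1 (hf.abs_height_mul_curvature_le hG hη hP hγ i s ht)
  have h2 := hf.speed_sq hG hη hP hγ i s ht
  have h3 : 0 ≤ speed (graphCurve G h (γ i)) s t := norm_nonneg _
  refine (le_abs_self _).trans (abs_le_of_sq_le_sq ?_ h3)
  rw [h2]
  nlinarith [sq_nonneg (ds (alongCurve h (γ i)) s t)]

theorem IsSmoothFlow.speed_le (hf : IsSmoothFlow G η T F h) (hG : IsSmoothSet G)
    (hη : IsTubularRadius G η) (hP : IsBoundaryParam G L γ) (hγ : ∀ i s, ‖deriv (γ i) s‖ = 1)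
    (i : ι) (s : ℝ) {t : ℝ} (ht : t ∈ Ioo 0 T) {M : ℝ}
    (hM : |ds (alongCurve h (γ i)) s t| ≤ M) : speed (graphCurve G h (γ i)) s t ≤ 3 / 2 + M := by
  have h1 := abs_le.1 (hf.abs_height_mul_curvature_le hG hη hP hγ i s ht)
  have h2 := hf.speed_sq hG hη hP hγ i s ht
  have hM0 : 0 ≤ M := (abs_nonneg _).trans hM
  have h4 : ds (alongCurve h (γ i)) s t ^ 2 ≤ M ^ 2 := sq_le_sq' (abs_le.1 hM).1 (abs_le.1 hM).2
  refine (le_abs_self _).trans (abs_le_of_sq_le_sq ?_ (by positivity))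
  rw [h2]
  nlinarith

theorem IsForcedFlow.abs_tangVel_le [Fintype ι] (hf : IsForcedFlow φ G η T f F h)
    (hF : IsSmoothForcing G f) (hG : IsSmoothSet G) (hη : IsTubularRadius G η)
    (hP : IsBoundaryParam G L γ) (hγ : ∀ i s, ‖deriv (γ i) s‖ = 1) (hφ : IsAnisotropy φ)
    (i : ι) (s : ℝ) {t : ℝ} (ht : t ∈ Ioo 0 T) {M : ℝ}
    (hM : |ds (alongCurve h (γ i)) s t| ≤ M) : |tangVel (graphCurve G h (γ i)) s t| ≤
      2 * M * |potDD (anisoWeight φ) (graphCurve G h (γ i)) (alongCurve f (γ i)) s t| := by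
  have h1 := abs_le.1 (hf.flow.abs_height_mul_curvature_le hG hη hP hγ i s ht)
  have h2 := congrArg abs (hf.tangVel_graphCurve hF hG hη hP hγ hφ i s ht)
  rw [abs_mul, abs_mul] at h2
  set V := |potDD (anisoWeight φ) (graphCurve G h (γ i)) (alongCurve f (γ i)) s t|
  have h3 : 1 / 2 ≤ |1 + h t (γ i s) * curvatureAlong G (γ i) s| :=
    le_trans (by linarith) (le_abs_self _)
  have h4 : V * |ds (alongCurve h (γ i)) s t| ≤ V * M := mul_le_mul_of_nonneg_left hM (abs_nonneg _)
  nlinarith [abs_nonneg (tangVel (graphCurve G h (γ i)) s t)]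

theorem IsSmoothFlow.ds_ds_graphCurve (hf : IsSmoothFlow G η T F h) (hG : IsSmoothSet G)
    (hη : IsTubularRadius G η) (hP : IsBoundaryParam G L γ) (hγ : ∀ i s, ‖deriv (γ i) s‖ = 1)
    (i : ι) (s : ℝ) {t : ℝ} (ht : t ∈ Ioo 0 T) :
    ds (ds (graphCurve G h (γ i))) s t =
      (2 * (ds (alongCurve h (γ i)) s t * curvatureAlong G (γ i) s) +
        h t (γ i s) * deriv (curvatureAlong G (γ i)) s) • deriv (γ i) s +
      (ds (ds (alongCurve h (γ i))) s t - (1 + h t (γ i s) * curvatureAlong G (γ i) s) *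
        curvatureAlong G (γ i) s) • outerNormal G (γ i s) := by
  have hh := (hf.smoothFor_height hP i).hasDerivAt_s isOpen_Ioo ht s
  have hh' := ((hf.smoothFor_height hP i).ds isOpen_Ioo).hasDerivAt_s isOpen_Ioo ht s
  have hκ := ((hP.contDiff_curvatureAlong hη i).differentiable (by simp) s).hasDerivAt
  have h1 := (((hh.mul hκ).const_add 1).smul (hP.hasDerivAt_deriv hG hη hγ i s)).add
    (hh'.smul (hP.hasDerivAt_normal hG hη hγ i s))
  have h2 : ds (ds (graphCurve G h (γ i))) s t = _ := (h1.congr_of_eventuallyEq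
    (f₁ := fun v => ds (graphCurve G h (γ i)) v t)
    (Eventually.of_forall fun v => hf.ds_graphCurve hG hη hP hγ i v ht)).deriv
  rw [h2]
  simp only [Pi.mul_apply, alongCurve]
  module

theorem IsCurveFlow.ds_ds_eq {I : Set ℝ} {ℓ : ℝ} {c : ℝ → ℝ → Plane} {a : ℝ → ℝ → ℝ}
    (H : IsCurveFlow I ℓ c a) (s : ℝ) {t : ℝ} (ht : t ∈ I) :
    ds (ds c) s t = ds (speed c) s t • tangent c s t -
      (speed c s t ^ 2 * curv c s t) • normal c s t := by
  have h1 := (H.smooth_speed.hasDerivAt_s H.isOpen ht s).smul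
    (H.smooth_tangent.hasDerivAt_s H.isOpen ht s)
  have h2 : ds (ds c) s t = _ := (h1.congr_of_eventuallyEq (f₁ := fun v => ds c v t)
    (Eventually.of_forall fun v => H.ds_eq_smul v ht)).deriv
  rw [h2, H.ds_tangent s ht]
  module

/-- The frame components of ∂_s² c are ∂_s ρ and -ρ²k, so a bound on this vector controls both. -/
theorem IsCurveFlow.abs_ds_speed_le {I : Set ℝ} {ℓ : ℝ} {c : ℝ → ℝ → Plane} {a : ℝ → ℝ → ℝ}
    (H : IsCurveFlow I ℓ c a) (s : ℝ) {t : ℝ} (ht : t ∈ I) {A : ℝ} (hA : ‖ds (ds c) s t‖ ≤ A) :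
    |ds (speed c) s t| ≤ A ∧ speed c s t ^ 2 * |curv c s t| ≤ A := by
  have h0 := IsCurveFlow.inner_tangent_normal c s t
  have h0' : (inner ℝ (normal c s t) (tangent c s t) : ℝ) = 0 := by rw [real_inner_comm]; exact h0
  have h1 : (inner ℝ (ds (ds c) s t) (tangent c s t) : ℝ) = ds (speed c) s t := by
    rw [H.ds_ds_eq s ht, inner_sub_left, real_inner_smul_left, real_inner_smul_left, h0',
      real_inner_self_eq_norm_sq, H.norm_tangent s ht]
    ring
  have h2 : (inner ℝ (ds (ds c) s t) (normal c s t) : ℝ) = -(speed c s t ^ 2 * curv c s t) := by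
    rw [H.ds_ds_eq s ht, inner_sub_left, real_inner_smul_left, real_inner_smul_left, h0,
      real_inner_self_eq_norm_sq, H.norm_normal s ht]
    ring
  constructor
  · have := abs_real_inner_le_norm (ds (ds c) s t) (tangent c s t)
    rw [h1, H.norm_tangent s ht, mul_one] at this
    exact this.trans hA
  · have := abs_real_inner_le_norm (ds (ds c) s t) (normal c s t)
    rw [h2, H.norm_normal s ht, mul_one, abs_neg, abs_mul, abs_of_nonneg (sq_nonneg _)] at this
    exact this.trans hA

theorem IsSmoothFlow.norm_ds_ds_graphCurve_le (hf : IsSmoothFlow G η T F h) (hG : IsSmoothSet G)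
    (hη : IsTubularRadius G η) (hP : IsBoundaryParam G L γ) (hγ : ∀ i s, ‖deriv (γ i) s‖ = 1)
    (i : ι) (s : ℝ) {t : ℝ} (ht : t ∈ Ioo 0 T) {M K : ℝ}
    (hM : |ds (alongCurve h (γ i)) s t| ≤ M) (hM' : |ds (ds (alongCurve h (γ i))) s t| ≤ M)
    (hK : |deriv (curvatureAlong G (γ i)) s| ≤ K) :
    ‖ds (ds (graphCurve G h (γ i))) s t‖ ≤
      2 * (M * (1 / η)) + η / 2 * K + (M + 3 / 2 * (1 / η)) := by
  have hη0 := hη.pos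
  have h1 := hf.abs_height_mul_curvature_le hG hη hP hγ i s ht
  have h2 := abs_curvatureAlong_le hG hη hP hγ i s
  have h3 := hf.height_le t ⟨ht.1.le, ht.2⟩ _ (hP.mem_frontier i s)
  have hM0 : 0 ≤ M := (abs_nonneg _).trans hM
  have hK0 : 0 ≤ K := (abs_nonneg _).trans hK
  rw [hf.ds_ds_graphCurve hG hη hP hγ i s ht]
  refine (norm_add_le _ _).trans ?_
  rw [norm_smul, norm_smul, hγ, hP.norm_normal hG, mul_one, mul_one, Real.norm_eq_abs,
    Real.norm_eq_abs]
  refine add_le_add ((abs_add_le _ _).trans (add_le_add ?_ ?_)) ((abs_sub _ _).trans (add_le_add hM' ?_))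
  · rw [abs_mul, abs_mul, abs_two]
    gcongr
  · rw [abs_mul]
    gcongr
  · rw [abs_mul]
    have h4 : |1 + h t (γ i s) * curvatureAlong G (γ i) s| ≤ 3 / 2 :=
      (abs_add_le _ _).trans (by rw [abs_one]; linarith)
    gcongr

end Flow

open CurveFlow

/-! ### The energy inequality -/

theorem sobolevSq_eq_ofReal {ι : Type} [Fintype ι] {L : ι → ℝ} (hL : ∀ i, 0 ≤ L i)
    {u u' : ι → ℝ → ℝ} (hu : ∀ i, Continuous (u i)) (hu' : ∀ i, Continuous (u' i)) :
    sobolevSq L u u' = ENNReal.ofReal (∑ i, ∫ s in (0)..(L i), (u i s ^ 2 + u' i s ^ 2)) := by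
  have h1 : ∀ i {v : ℝ → ℝ}, Continuous v → ∫⁻ s in Ioc 0 (L i), ‖v s‖ₑ ^ 2 =
      ENNReal.ofReal (∫ s in (0)..(L i), v s ^ 2) := fun i v hv => by
    have hc : Continuous fun s => v s ^ 2 := hv.pow 2
    simp_rw [enorm_sq_eq_ofReal]
    rw [intervalIntegral.integral_of_le (hL i), ofReal_integral_eq_lintegral_ofReal
      hc.integrableOn_Ioc (ae_of_all _ fun s => sq_nonneg _)]
  have h2 : ∀ i (v : ℝ → ℝ), 0 ≤ ∫ s in (0)..(L i), v s ^ 2 := fun i v =>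
    intervalIntegral.integral_nonneg (hL i) fun s _ => sq_nonneg _
  have h3 : ∀ i, ∫ s in (0)..(L i), (u i s ^ 2 + u' i s ^ 2) =
      (∫ s in (0)..(L i), u i s ^ 2) + ∫ s in (0)..(L i), u' i s ^ 2 := fun i =>
    intervalIntegral.integral_add (((hu i).pow 2).intervalIntegrable _ _)
      (((hu' i).pow 2).intervalIntegrable _ _)
  simp_rw [h3]
  rw [sobolevSq, ENNReal.ofReal_sum_of_nonneg fun i _ => add_nonneg (h2 i _) (h2 i _)]
  refine Finset.sum_congr rfl fun i _ => ?_
  rw [h1 i (hu i), h1 i (hu' i), ENNReal.ofReal_add (h2 i _) (h2 i _)]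

section Family

variable {ι : Type} [Fintype ι] {I : Set ℝ} {L : ι → ℝ} {c : ι → ℝ → ℝ → Plane}
  {f : ι → ℝ → ℝ → ℝ} {g : Plane → ℝ}

/-- The normal velocity, weighted with the speed, is bounded in `H¹`. -/
theorem sobolevSq_potDD_mul_speed_le (H : ∀ i, IsCurveFlow I (L i) (c i) (f i)) (hL : ∀ i, 0 < L i)
    (hg : ContDiffOn ℝ ∞ g {0}ᶜ) {t : ℝ} (ht : t ∈ I) {A b : ℝ}
    (hρ : ∀ i s, 1 / 2 ≤ speed (c i) s t) (hρb : ∀ i s, speed (c i) s t ≤ b)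
    (hA : ∀ i s, |ds (speed (c i)) s t| ≤ A) (hb : 0 ≤ b) :
    sobolevSq L (fun i s => potDD g (c i) (f i) s t * speed (c i) s t)
      (fun i s => ds (potDD g (c i) (f i)) s t * speed (c i) s t +
        potDD g (c i) (f i) s t * ds (speed (c i)) s t) ≤
      ENNReal.ofReal ((b + 4 * A ^ 2 + 2 * b ^ 3) *
        (normSq L c (fun i => potDDD g (c i) (f i)) t +
          normSq L c (fun i => potDD g (c i) (f i)) t)) := by
  have hρc : ∀ i, Continuous fun s => speed (c i) s t := fun i => (H i).smooth_speed.continuous_s ht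
  have hρc' : ∀ i, Continuous fun s => ds (speed (c i)) s t := fun i =>
    ((H i).smooth_speed.ds (H i).isOpen).continuous_s ht
  have hV : ∀ i, Continuous fun s => potDD g (c i) (f i) s t := fun i =>
    ((H i).smooth_potDD hg).continuous_s ht
  have hV' : ∀ i, Continuous fun s => ds (potDD g (c i) (f i)) s t := fun i =>
    (((H i).smooth_potDD hg).ds (H i).isOpen).continuous_s ht
  have hZ : ∀ i, Continuous fun s => potDDD g (c i) (f i) s t := fun i =>
    ((H i).smooth_potDDD hg).continuous_s ht
  rw [sobolevSq_eq_ofReal (u := fun i s => potDD g (c i) (f i) s t * speed (c i) s t)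
    (u' := fun i s => ds (potDD g (c i) (f i)) s t * speed (c i) s t +
      potDD g (c i) (f i) s t * ds (speed (c i)) s t)
    (fun i => (hL i).le) (fun i => (hV i).mul (hρc i))
    (fun i => ((hV' i).mul (hρc i)).add ((hV i).mul (hρc' i)))]
  apply ENNReal.ofReal_le_ofReal
  rw [normSq, normSq, ← Finset.sum_add_distrib, Finset.mul_sum]
  refine Finset.sum_le_sum fun i _ => ?_
  have cZ : Continuous fun s => speed (c i) s t * potDDD g (c i) (f i) s t ^ 2 :=
    (hρc i).mul ((hZ i).pow 2)
  have cV : Continuous fun s => speed (c i) s t * potDD g (c i) (f i) s t ^ 2 :=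
    (hρc i).mul ((hV i).pow 2)
  rw [← intervalIntegral.integral_add (cZ.intervalIntegrable _ _) (cV.intervalIntegrable _ _),
    ← intervalIntegral.integral_const_mul]
  refine intervalIntegral.integral_mono_on (hL i).le
    (((((hV i).mul (hρc i)).pow 2).add
      ((((hV' i).mul (hρc i)).add ((hV i).mul (hρc' i))).pow 2)).intervalIntegrable _ _)
    (((cZ.add cV).const_mul _).intervalIntegrable _ _) fun s _ => ?_
  rw [(H i).ds_potDD g s ht]
  set ρ := speed (c i) s t
  set V := potDD g (c i) (f i) s t
  set Z := potDDD g (c i) (f i) s t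
  set ρ' := ds (speed (c i)) s t
  have h1 : 1 / 2 ≤ ρ := hρ i s
  have h0 : 0 ≤ ρ := by linarith
  have h2 : ρ ≤ b := hρb i s
  have h3 : ρ' ^ 2 ≤ A ^ 2 := sq_le_sq' (abs_le.1 (hA i s)).1 (abs_le.1 (hA i s)).2
  have e1 : (V * ρ) ^ 2 ≤ b * (ρ * V ^ 2) := by
    calc (V * ρ) ^ 2 = ρ * (ρ * V ^ 2) := by ring
      _ ≤ _ := by gcongr
  have e2 : (ρ * Z * ρ + V * ρ') ^ 2 ≤ 2 * (ρ * Z * ρ) ^ 2 + 2 * (V * ρ') ^ 2 := by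
    nlinarith [sq_nonneg (ρ * Z * ρ - V * ρ')]
  have e3 : (ρ * Z * ρ) ^ 2 ≤ b ^ 3 * (ρ * Z ^ 2) := by
    calc (ρ * Z * ρ) ^ 2 = ρ ^ 3 * (ρ * Z ^ 2) := by ring
      _ ≤ _ := by gcongr
  have e4 : (V * ρ') ^ 2 ≤ 2 * A ^ 2 * (ρ * V ^ 2) := by
    calc (V * ρ') ^ 2 = ρ' ^ 2 * V ^ 2 := by ring
      _ ≤ A ^ 2 * (2 * ρ * V ^ 2) := by
          gcongr
          nlinarith [sq_nonneg V]
      _ = _ := by ring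
  -- Nonnegative surplus that lets a single constant multiply D + B.
  have k1 : 0 ≤ b ^ 3 * (ρ * V ^ 2) := by positivity
  have k2 : 0 ≤ (b + 4 * A ^ 2) * (ρ * Z ^ 2) := by positivity
  linarith

end Family

section Flow

variable {φ : Plane → ℝ} {G : Set Plane} {η T : ℝ} {ι : Type} {L : ι → ℝ} {γ : ι → ℝ → Plane}
  {f : ℝ → Plane → ℝ} {F : ℝ → Set Plane} {h : ℝ → Plane → ℝ}

/-- In unit speed parameters of ∂G the sum is the pairing of ∂_t f with the function on ∂G equal to
ρV along the curves, so duality applies. The added 1 makes the bound on its norm strictly positive.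
-/
theorem IsForcedFlow.abs_forcing_term_le [Fintype ι] (hf : IsForcedFlow φ G η T f F h)
    (hF : IsSmoothForcing G f) (hG : IsSmoothSet G) (hη : IsTubularRadius G η)
    (hP : IsBoundaryParam G L γ) (hγ : ∀ i s, ‖deriv (γ i) s‖ = 1) (hφ : IsAnisotropy φ)
    {t : ℝ} (ht : t ∈ Ioo 0 T) {C : ℝ≥0}
    (hC : ∀ (w : Plane → ℝ) (u u' : ι → ℝ → ℝ), (∀ i s, w (γ i s) = u i s) →
      (∀ i, Function.Periodic (u i) (L i)) → (∀ i s, HasDerivAt (u i) (u' i s) s) →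
      (∀ i, Continuous (u' i)) → hHalfNormSq G w ≤ C * sobolevSq L u u')
    {A b : ℝ} (hρb : ∀ i s, speed (graphCurve G h (γ i)) s t ≤ b)
    (hA : ∀ i s, |ds (speed (graphCurve G h (γ i))) s t| ≤ A) (hb : 0 ≤ b) :
    |∑ i, ∫ s in (0)..(L i), dt (alongCurve f (γ i)) s t *
        (potDD (anisoWeight φ) (graphCurve G h (γ i)) (alongCurve f (γ i)) s t *
          speed (graphCurve G h (γ i)) s t)| ≤
      (hNegHalfNorm G fun x => deriv (fun s => f s x) t).toReal *
        √((C * (b + 4 * A ^ 2 + 2 * b ^ 3) + 1) *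
          (normSq L (fun i => graphCurve G h (γ i))
              (fun i => potDDD (anisoWeight φ) (graphCurve G h (γ i)) (alongCurve f (γ i))) t +
            normSq L (fun i => graphCurve G h (γ i))
              (fun i => potDD (anisoWeight φ) (graphCurve G h (γ i)) (alongCurve f (γ i))) t) + 1) := by
  have hg := hφ.contDiffOn_anisoWeight
  have H : ∀ i, IsCurveFlow (Ioo 0 T) (L i) (graphCurve G h (γ i)) (alongCurve f (γ i)) := fun i =>
    hf.flow.isCurveFlow hF hG hη hP hγ i
  have hV := fun i => (H i).smooth_potDD hg
  have hρ := fun i => (H i).smooth_speed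
  set D := normSq L (fun i => graphCurve G h (γ i))
    (fun i => potDDD (anisoWeight φ) (graphCurve G h (γ i)) (alongCurve f (γ i))) t
  set B := normSq L (fun i => graphCurve G h (γ i))
    (fun i => potDD (anisoWeight φ) (graphCurve G h (γ i)) (alongCurve f (γ i))) t
  have hD : 0 ≤ D := normSq_nonneg (fun i => (hP.period_pos i).le) _ _ _
  have hB : 0 ≤ B := normSq_nonneg (fun i => (hP.period_pos i).le) _ _ _
  have hper : ∀ i, Function.Periodic (fun s =>
      potDD (anisoWeight φ) (graphCurve G h (γ i)) (alongCurve f (γ i)) s t *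
        speed (graphCurve G h (γ i)) s t) (L i) := fun i =>
    ((H i).periodic_potDD _ ht).mul ((H i).periodic_speed ht)
  obtain ⟨w, hw⟩ := hP.exists_function hper
  have hwc : ∀ i, Continuous fun s => w (γ i s) := fun i => by
    simp_rw [hw]
    exact ((hV i).continuous_s ht).mul ((hρ i).continuous_s ht)
  have hfc : ∀ i, Continuous fun s => dt (alongCurve f (γ i)) s t := fun i =>
    ((H i).smooth_forcing.dt isOpen_Ioo).continuous_s ht
  have hint : (bdryIntegral G fun x => deriv (fun s => f s x) t * w x) =
      ∑ i, ∫ s in (0)..(L i), dt (alongCurve f (γ i)) s t *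
        (potDD (anisoWeight φ) (graphCurve G h (γ i)) (alongCurve f (γ i)) s t *
          speed (graphCurve G h (γ i)) s t) := by
    rw [hP.bdryIntegral_eq (u := fun x => deriv (fun s => f s x) t * w x)
      fun i => (hfc i).mul (hwc i)]
    simp_rw [hγ, one_mul, hw]
    rfl
  obtain ⟨M, hM⟩ := exists_bound_of_periodic hP.period_pos
    (a := fun i s => dt (alongCurve f (γ i)) s t)
    (fun i => periodic_dt (H i).isOpen (H i).periodic_forcing t ht) hfc
  have hfin : hNegHalfNorm G (fun x => deriv (fun s => f s x) t) < ⊤ := by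
    refine hP.hNegHalfNorm_lt_top hγ (M := M.toNNReal) fun x hx => ?_
    obtain ⟨i, s, rfl⟩ := hP.exists_eq hx
    rw [← ofReal_norm]
    exact ENNReal.ofReal_le_ofReal (hM i s)
  have hw' := hC w _ (fun i s =>
      ds (potDD (anisoWeight φ) (graphCurve G h (γ i)) (alongCurve f (γ i))) s t *
        speed (graphCurve G h (γ i)) s t +
      potDD (anisoWeight φ) (graphCurve G h (γ i)) (alongCurve f (γ i)) s t *
        ds (speed (graphCurve G h (γ i))) s t) hw hper
    (fun i s => ((hV i).hasDerivAt_s isOpen_Ioo ht s).mul ((hρ i).hasDerivAt_s isOpen_Ioo ht s))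
    (fun i => ((((hV i).ds isOpen_Ioo).continuous_s ht).mul ((hρ i).continuous_s ht)).add
      (((hV i).continuous_s ht).mul (((hρ i).ds isOpen_Ioo).continuous_s ht)))
  have hS := sobolevSq_potDD_mul_speed_le H hP.period_pos hg ht
    (fun i s => hf.flow.half_le_speed hG hη hP hγ i s ht) hρb hA hb
  rw [← hint]
  refine abs_bdryIntegral_mul_le hfin (hP.integrableOn hwc).aestronglyMeasurable (by positivity) ?_
  refine (hw'.trans (mul_le_mul_right hS _)).trans ?_
  rw [← ENNReal.ofReal_coe_nnreal, ← ENNReal.ofReal_mul C.coe_nonneg]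
  apply ENNReal.ofReal_le_ofReal
  have : 0 ≤ D + B := add_nonneg hD hB
  linarith

/-- The curves, the Sobolev constant and the bounds on κ' and on g over the unit circle are fixed
before `T`, the forcing and the flow appear; the flow enters only through the two Hölder bounds. -/
theorem exists_energy_bound {c₀ : ℝ} (hφ : IsAnisotropy φ) (hc₀ : IsElliptic φ c₀)
    (hG : IsSmoothSet G) (hη : IsTubularRadius G η) (α : ℝ) (Mh Mf : ℝ≥0) :
    ∃ C₁ : ℝ, 0 < C₁ ∧
      ∀ (T : ℝ) (f : ℝ → Plane → ℝ) (F : ℝ → Set Plane) (h : ℝ → Plane → ℝ),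
        IsSmoothForcing G f → IsForcedFlow φ G η T f F h →
        (∀ t ∈ Ioo 0 T, holderNorm G 2 α (h t) ≤ Mh) →
        (∀ t ∈ Ioo 0 T, holderNorm G 1 α (f t) ≤ Mf) →
        ∀ t ∈ Ioo 0 T, ∃ D : ℝ,
          HasDerivAt (fun s => bdryIntegral (F s) fun x =>
            tderiv (F s) (potential φ G (f s) (F s)) x ^ 2) D t ∧
          D + c₀ * (bdryIntegral (F t) fun x =>
              tderiv (F t) (tderiv (F t) (tderiv (F t) (potential φ G (f t) (F t)))) x ^ 2) ≤
            C₁ * (hNegHalfNorm G fun x => deriv (fun s => f s x) t).toReal ^ 2 +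
            C₁ * (1 + bdryIntegral (F t) fun x =>
              tderiv (F t) (potential φ G (f t) (F t)) x ^ 2) ^ (7 / 3 : ℝ) := by
  obtain ⟨ι, hι, L, γ, hP, hγ⟩ := exists_boundaryParam hG hη
  have hg := hφ.contDiffOn_anisoWeight
  have hη0 := hη.pos
  have hc0 : 0 < c₀ := hc₀.1
  obtain ⟨C, hC⟩ := hP.exists_hHalfNormSq_le hγ
  obtain ⟨κ₁, hκ₁⟩ := exists_bound_of_periodic hP.period_pos
    (fun i => periodic_deriv (hP.periodic_curvatureAlong i))
    (fun i => (hP.contDiff_curvatureAlong hη i).continuous_deriv (by simp))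
  obtain ⟨g₁, hg₁⟩ := (isCompact_sphere (0 : Plane) 1).exists_bound_of_continuousOn
    (f := anisoWeight φ) (hg.continuousOn.mono fun v hv h0 => by
      rw [mem_sphere_zero_iff_norm, mem_singleton_iff.1 h0, norm_zero] at hv
      exact zero_ne_one hv)
  have hgb : ∀ v, ‖v‖ = 1 → |anisoWeight φ v| ≤ |g₁| := fun v hv =>
    (hg₁ v (mem_sphere_zero_iff_norm.2 hv)).trans (le_abs_self _)
  have hgc : ∀ v, ‖v‖ = 1 → c₀ ≤ anisoWeight φ v := fun v hv =>
    hc₀.2 v (rot v) hv (by rw [norm_rot, hv]) (inner_rot_self v)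
  -- `A` bounds |∂_s² c|, `b` the speed, `P` the total length, and K = 4A the curvature, since ρ² ≥
  -- 1/4.
  set A : ℝ := 2 * (Mh * (1 / η)) + η / 2 * κ₁ + (Mh + 3 / 2 * (1 / η)) with hA
  set b : ℝ := 3 / 2 + Mh with hb
  have hb0 : 0 ≤ b := by positivity
  set P : ℝ := ∑ i, L i * b with hPdef
  have hP0 : 0 ≤ P := Finset.sum_nonneg fun i _ => mul_nonneg (hP.period_pos i).le hb0
  set K : ℝ := 4 * A with hK
  set C₂ : ℝ := 4 * (2 * Mh * Mf) + 2 * (|g₁| * K ^ 2) with hC₂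
  set C₃ : ℝ := C * (b + 4 * A ^ 2 + 2 * b ^ 3) + 1 with hC₃
  have hC₂0 : 0 ≤ C₂ := by positivity
  have hC₃0 : 0 < C₃ := by positivity
  refine ⟨4 * C₃ / c₀ + (c₀ / (4 * C₃) + (C₂ + c₀ / 4) ^ 2 / c₀ + 4 * K ^ 2 * P / c₀),
    by positivity, fun T f F h hF hf hMh hMf t ht => ?_⟩
  have H : ∀ i, IsCurveFlow (Ioo 0 T) (L i) (graphCurve G h (γ i)) (alongCurve f (γ i)) := fun i =>
    hf.flow.isCurveFlow hF hG hη hP hγ i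
  refine ⟨_, hf.hasDerivAt_energy hF hG hη hP hγ hφ ht, ?_⟩
  have hh := fun i => hf.flow.contDiff_height hP i ht
  have hh1 : ∀ i s, |ds (alongCurve h (γ i)) s t| ≤ Mh := fun i s =>
    hP.abs_deriv_le_of_holderNorm_le hγ (hMh t ht) one_le_two ((hh i).differentiable (by simp)) s
  have hh2 : ∀ i s, |ds (ds (alongCurve h (γ i))) s t| ≤ Mh := fun i s =>
    hP.abs_deriv_deriv_le_of_holderNorm_le hγ (hMh t ht) le_rfl ((hh i).differentiable (by simp))
      ((contDiff_infty_iff_deriv.1 (hh i)).2.differentiable (by simp)) s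
  have hf1 : ∀ i s, |ds (alongCurve f (γ i)) s t| ≤ Mf := fun i s =>
    hP.abs_deriv_le_of_holderNorm_le hγ (hMf t ht) le_rfl
      (((H i).smooth_forcing.contDiff_s ht).differentiable (by simp)) s
  have hρ := fun i s => hf.flow.half_le_speed hG hη hP hγ i s ht
  have hρb := fun i s => hf.flow.speed_le hG hη hP hγ i s ht (hh1 i s)
  have hds := fun i s => (H i).abs_ds_speed_le s ht
    (hf.flow.norm_ds_ds_graphCurve_le hG hη hP hγ i s ht (hh1 i s) (hh2 i s) (hκ₁ i s))
  have hk : ∀ i s, |curv (graphCurve G h (γ i)) s t| ≤ K := fun i s => by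
    have h1 := (hds i s).2
    have h2 := hρ i s
    have h3 : (1 / 2 : ℝ) ^ 2 ≤ speed (graphCurve G h (γ i)) s t ^ 2 :=
      pow_le_pow_left₀ (by norm_num) h2 2
    nlinarith [abs_nonneg (curv (graphCurve G h (γ i)) s t)]
  have hE : (bdryIntegral (F t) fun x => tderiv (F t) (potential φ G (f t) (F t)) x ^ 2) =
      normSq L (fun i => graphCurve G h (γ i))
        (fun i => potD (anisoWeight φ) (graphCurve G h (γ i)) (alongCurve f (γ i))) t :=
    hf.flow.bdryIntegral_graphCurve hG hη hP hγ
      (a := fun i s t => potD (anisoWeight φ) (graphCurve G h (γ i)) (alongCurve f (γ i)) s t ^ 2)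
      (fun i => ((H i).smooth_potD hg).pow 2) ht
      fun i s => congrArg (· ^ 2) (hf.flow.tderiv_potential hF hG hη hP hγ hφ i s ht)
  have hD : (bdryIntegral (F t) fun x =>
        tderiv (F t) (tderiv (F t) (tderiv (F t) (potential φ G (f t) (F t)))) x ^ 2) =
      normSq L (fun i => graphCurve G h (γ i))
        (fun i => potDDD (anisoWeight φ) (graphCurve G h (γ i)) (alongCurve f (γ i))) t :=
    hf.flow.bdryIntegral_graphCurve hG hη hP hγ
      (a := fun i s t => potDDD (anisoWeight φ) (graphCurve G h (γ i)) (alongCurve f (γ i)) s t ^ 2)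
      (fun i => ((H i).smooth_potDDD hg).pow 2) ht
      fun i s => congrArg (· ^ 2)
        (hf.flow.tderiv_tderiv_tderiv_potential hF hG hη hP hγ hφ i s ht)
  have hlen : totalLength L (fun i => graphCurve G h (γ i)) t ≤ P := by
    refine Finset.sum_le_sum fun i _ => ?_
    have h1 := intervalIntegral.integral_mono_on (μ := volume) (g := fun _ => b) (hP.period_pos i).le
      (((H i).smooth_speed.continuous_s ht).intervalIntegrable 0 (L i))
      (continuous_const.intervalIntegrable 0 (L i)) fun s _ => hρb i s
    rwa [intervalIntegral.integral_const, sub_zero, smul_eq_mul] at h1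
  have hL0 : ∀ i, 0 ≤ L i := fun i => (hP.period_pos i).le
  rw [hE, hD]
  refine rate_add_le hc0 hC₂0 hC₃0 hP0 (normSq_nonneg hL0 _ _ _) (normSq_nonneg hL0 _ _ _)
    (normSq_nonneg hL0 _ _ _)
    (sum_integral_energyRate_le H hP.period_pos hg ht hgc hgb hρ hk
      (fun i s => hf.abs_tangVel_le hF hG hη hP hγ hφ i s ht (hh1 i s)) hf1)
    (normSq_potDD_sq_le H hP.period_pos hg ht)
    ((cubic_term_sq_le H hP.period_pos hg ht).trans ?_)
    (hf.abs_forcing_term_le hF hG hη hP hγ hφ ht hC hρb (fun i s => (hds i s).1) hb0)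
  have h1 := normSq_nonneg hL0 (fun i => graphCurve G h (γ i))
    (fun i => potDDD (anisoWeight φ) (graphCurve G h (γ i)) (alongCurve f (γ i))) t
  gcongr

end Flow

end

/-! ### Assembly of the two assertions -/

theorem lemma3p3 (φ : Plane → ℝ) (hφ : IsAnisotropy φ) (c₀ : ℝ) (hc₀ : IsElliptic φ c₀)
    (G : Set Plane) (hG : IsSmoothSet G) (η : ℝ) (hη : IsTubularRadius G η) :
    (∀ (T : ℝ) (f : ℝ → Plane → ℝ) (F : ℝ → Set Plane) (h : ℝ → Plane → ℝ),
      IsSmoothForcing G f → IsForcedFlow φ G η T f F h → ∀ t ∈ Ioo 0 T,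
        HasDerivAt (fun s => ∫ x in F s ∆ G, infDist x (frontier G))
          (bdryIntegral (F t) fun x => signedDistFrom G x *
            tderiv (F t) (tderiv (F t) (potential φ G (f t) (F t))) x) t ∧
        (bdryIntegral (F t) fun x => signedDistFrom G x *
            tderiv (F t) (tderiv (F t) (potential φ G (f t) (F t))) x) ≤
          √(perimeter (F t)) *
            √(bdryIntegral (F t) fun x => tderiv (F t) (potential φ G (f t) (F t)) x ^ 2)) ∧
    (∀ α : ℝ, 0 < α → α < 1 → ∀ Mh Mf : ℝ≥0, ∃ C₁ : ℝ, 0 < C₁ ∧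
      ∀ (T : ℝ) (f : ℝ → Plane → ℝ) (F : ℝ → Set Plane) (h : ℝ → Plane → ℝ),
        IsSmoothForcing G f → IsForcedFlow φ G η T f F h →
        (∀ t ∈ Ioo 0 T, holderNorm G 2 α (h t) ≤ Mh) →
        (∀ t ∈ Ioo 0 T, holderNorm G 1 α (f t) ≤ Mf) →
        ∀ t ∈ Ioo 0 T, ∃ D : ℝ,
          HasDerivAt (fun s => bdryIntegral (F s) fun x =>
            tderiv (F s) (potential φ G (f s) (F s)) x ^ 2) D t ∧
          D + c₀ * (bdryIntegral (F t) fun x =>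
              tderiv (F t) (tderiv (F t) (tderiv (F t) (potential φ G (f t) (F t)))) x ^ 2) ≤
            C₁ * (hNegHalfNorm G fun x => deriv (fun s => f s x) t).toReal ^ 2 +
            C₁ * (1 + bdryIntegral (F t) fun x =>
              tderiv (F t) (potential φ G (f t) (F t)) x ^ 2) ^ (7 / 3 : ℝ)) := by
  obtain ⟨ι, hι, L, γ, hP, hγ⟩ := exists_boundaryParam hG hη
  exact ⟨fun T f F h hF hf t ht => ⟨hf.hasDerivAt_integral_symmDiff hF hG hη hP hγ hφ ht,
      hf.bdryIntegral_dist_mul_le hF hG hη hP hγ hφ ht⟩,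
    fun α _ _ Mh Mf => exists_energy_bound hφ hc₀ hG hη α Mh Mf⟩
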